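/- Let $N,K,L\ge 1$ be integers. Let $g:\mathbb R\to\mathbb R$ be an integrable, differentiable pulse with $g'\in L^2(\mathbb R)$, with Fourier transform $\widehat g(f)=\int g(t)e^{-2\pi \mathrm{j} ft}\,dt$, and let $\widehat{g'}$ be the ($L^2$) Fourier transform of $g'$. Let $J_N=[-\frac{N-1}{2},\frac{N-1}{2}]$, $f_i=\frac{2i-N-1}{2}$ for $1\le i\le N$, $$E_0=\int_{J_N}|\widehat g|^2,\qquad E_1=\int_{J_N}|\widehat{g'}|^2,\qquad \rho=\max\Big\{\frac{V(|\widehat g|^2\mathbf 1_{J_N})}{E_0},\ \frac{V(|\widehat{g'}|^2\mathbf 1_{J_N})}{E_1}\Big\},$$ where $V(u)$ is the total variation on $\mathbb R$ of the function $u$ (taken modulo null sets, i.e. the total variation norm of its distributional derivative); assume that $E_1>0$ and that both variations are finite. Let $G=\mathrm{diag}(\widehat g(f_1),\dots,\widehat g(f_N))$ and $[\Phi_\gamma]_{i,k}=e^{-2\pi \mathrm{j}\gamma_kf_i}$ for $\gamma\in\mathbb R^K$. Let $X\in\mathbb C^{K\times L}$ have no zero row, and put $$\kappa=\frac{\|XX^*\|_{\infty\to2}}{\min\mathrm{diag}(XX^*)},\qquad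 \eta=\frac{\|X\|\,\|X\|_F}{\min\mathrm{diag}(XX^*)},$$ where $\|\cdot\|$ is the spectral norm, $\|\cdot\|_F$ the Frobenius norm and $\|\cdot\|_{\infty\to2}$ the largest $\ell_2$ norm of a column. Let $\tau\in\mathbb R^K$ and $\Delta\le 1$ satisfy $|\tau_k-\tau_{k'}+j|\ge\Delta$ for all $k\ne k'$ and $j\in\mathbb Z$ (for $K\ge2$ this already forces $\Delta\le1$), and suppose that $\Delta>\frac23\rho\kappa$. For $Z\in\mathbb C^{N\times L}$ let $\ell(\gamma,Z)=\|P_\gamma^\perp(G\Phi_\tau X+Z)\|_F^2$, where $P_\gamma^\perp$ is the orthogonal projection onto the orthogonal complement of the column space of $G\Phi_\gamma$. Let $\psi:\mathbb C^{N\times L}\to\mathbb R^K$ be any inverse map: $\psi(Z)$ minimizes $\ell(\cdot,Z)$ for all $Z$ in a neighbourhood of $0$, $\psi(0)=\tau$, and $\psi$ is continuous at $0$. (Locations on the torus $(\mathbb R/\mathbb Z)^K$ are represented by vectors in $\mathbb R^K$; $\ell(\cdot,Z)$ is $1$-periodic in each coordinate.) Then $\psi$ is differentiable at $0$ as a function of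 the real and imaginary parts $\iota(Z)\in\mathbb R^{2LN}$ of the entries of $Z$, and the spectral norm of its Jacobian matrix satisfies $$\|\nabla_{\iota(Z)}\psi(0)\|\cdot\|G\Phi_\tau X\|_F\ \le\ \frac{\eta\,\sqrt{\left(1+\frac23\rho\Delta^{-1}\right)\left(1+\frac12\rho\Delta^{-1}\right)}}{\sqrt{E_1/E_0}\,\left(1-\frac23\rho\kappa\Delta^{-1}\right)}.$$ -/

import Mathlib

open MeasureTheory Filter Topology
open scoped FourierTransform ENNReal Matrix

noncomputable section

namespace PulseLocation

/-- The Frobenius norm of a complex matrix. -/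
def frobNorm {m n : ℕ} (A : Matrix (Fin m) (Fin n) ℂ) : ℝ :=
  √(∑ i : Fin m, ∑ j : Fin n, ‖A i j‖ ^ 2)

/-- The spectral norm (largest singular value) of a complex matrix. -/
def spectralNorm {m n : ℕ} (A : Matrix (Fin m) (Fin n) ℂ) : ℝ :=
  ‖LinearMap.toContinuousLinearMap (Matrix.toEuclideanLin A)‖

/-- `‖A‖_{∞→2}`: the largest `ℓ²` norm of the columns of a matrix. -/
def maxColNorm {m n : ℕ} (A : Matrix (Fin m) (Fin n) ℂ) : ℝ :=
  ⨆ k : Fin n, √(∑ j : Fin m, ‖A j k‖ ^ 2)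

/-- The smallest diagonal entry of `X X*`, that is, the smallest squared norm of a row of `X`. -/
def minDiag {K L : ℕ} (X : Matrix (Fin K) (Fin L) ℂ) : ℝ :=
  ⨅ k : Fin K, ((X * Xᴴ) k k).re

/-- The dynamic range `κ = ‖X X*‖_{∞→2} / min diag (X X*)` of the amplitudes. -/
def dynRange {K L : ℕ} (X : Matrix (Fin K) (Fin L) ℂ) : ℝ :=
  maxColNorm (X * Xᴴ) / minDiag X

/-- `η = ‖X‖ ‖X‖_F / min diag (X X*)`. -/
def ampRange {K L : ℕ} (X : Matrix (Fin K) (Fin L) ℂ) : ℝ :=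
  spectralNorm X * frobNorm X / minDiag X

/-- The sampled frequencies `f_i = (2 i - N - 1) / 2`, `i = 1, …, N` (here `i` starts at `0`). -/
def freq (N : ℕ) (i : Fin N) : ℝ := (2 * ((i : ℝ) + 1) - N - 1) / 2

/-- The bandwidth `J_N = [-(N-1)/2, (N-1)/2]`. -/
def band (N : ℕ) : Set ℝ := Set.Icc (-(((N : ℝ) - 1) / 2)) (((N : ℝ) - 1) / 2)

/-- The Fourier transform `ĝ(f) = ∫ g(t) e^{-2πi f t} dt` of the pulse, pointwise. -/
def ghat (g : ℝ → ℝ) : ℝ → ℂ := 𝓕 (fun t : ℝ => (g t : ℂ))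

/-- The Fourier transform of the derivative `g'` of the pulse, in the sense of `L²` (Plancherel);
it is determined up to a null set. -/
def ghatDeriv (g : ℝ → ℝ) (hg' : MemLp (fun t : ℝ => ((deriv g t : ℝ) : ℂ)) 2 volume) : ℝ → ℂ :=
  ((𝓕 (hg'.toLp (fun t : ℝ => ((deriv g t : ℝ) : ℂ))) : Lp ℂ 2 (volume : Measure ℝ)) : ℝ → ℂ)

/-- The total variation on the real line of (the class modulo null sets of) a function `u`: the
least pointwise variation among the functions that agree with `u` almost everywhere. It is the
total variation norm of the distributional derivative of `u`. -/
def totalVar (u : ℝ → ℝ) : ℝ≥0∞ :=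
  ⨅ (v : ℝ → ℝ) (_ : v =ᵐ[volume] u), eVariationOn v Set.univ

/-- The energy `‖h 1_{J_N}‖²_{L²}` of `h` in the band. -/
def bandEnergy (N : ℕ) (h : ℝ → ℂ) : ℝ := ∫ f in band N, ‖h f‖ ^ 2

/-- The total variation of `|h|² 1_{J_N}`, jumps at the ends of the band included. -/
def bandVar (N : ℕ) (h : ℝ → ℂ) : ℝ≥0∞ :=
  totalVar ((band N).indicator fun f => ‖h f‖ ^ 2)

/-- The flatness parameter `ρ`: the larger of the normalized total variations of `|h₀|² 1_{J_N}`
and `|h₁|² 1_{J_N}`. It is used for `h₀ = ĝ`, `h₁` the transform of `g'`, with both variations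
finite and both energies positive. -/
def flatness (N : ℕ) (h₀ h₁ : ℝ → ℂ) : ℝ :=
  max ((bandVar N h₀).toReal / bandEnergy N h₀) ((bandVar N h₁).toReal / bandEnergy N h₁)

/-- The matrix `Φ_γ` with entries `e^{-2πi γ_k f_i}`. -/
def Phi (N : ℕ) {K : ℕ} (γ : EuclideanSpace ℝ (Fin K)) : Matrix (Fin N) (Fin K) ℂ :=
  Matrix.of fun i k => Complex.exp (-(2 * Real.pi * γ k * freq N i : ℝ) * Complex.I)

/-- The diagonal matrix `G = diag (ĝ(f_1), …, ĝ(f_N))`. -/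
def G (g : ℝ → ℝ) (N : ℕ) : Matrix (Fin N) (Fin N) ℂ :=
  Matrix.diagonal fun i => ghat g (freq N i)

/-- The matrix `P_γ^⊥` of the orthogonal projection of `ℂ^N` onto the orthogonal complement of the
column space of `G Φ_γ`. -/
def Pperp (g : ℝ → ℝ) (N : ℕ) {K : ℕ} (γ : EuclideanSpace ℝ (Fin K)) :
    Matrix (Fin N) (Fin N) ℂ :=
  Matrix.toEuclideanLin.symm
    ((LinearMap.range (Matrix.toEuclideanLin (G g N * Phi N γ)))ᗮ.starProjection :
      EuclideanSpace ℂ (Fin N) →ₗ[ℂ] EuclideanSpace ℂ (Fin N))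

/-- The least squares loss `ℓ(γ, Z) = ‖P_γ^⊥ (G Φ_τ X + Z)‖_F²`. -/
def loss (g : ℝ → ℝ) (N : ℕ) {K L : ℕ} (τ : EuclideanSpace ℝ (Fin K))
    (X : Matrix (Fin K) (Fin L) ℂ) (γ : EuclideanSpace ℝ (Fin K))
    (Z : Matrix (Fin N) (Fin L) ℂ) : ℝ :=
  frobNorm (Pperp g N γ * (G g N * Phi N τ * X + Z)) ^ 2

/-- `ψ` is (a branch near the ground truth of) the inverse map from noise to locations: for all
small noise `Z`, `ψ Z` minimizes `ℓ(·, Z)`; it recovers `τ` without noise, and is continuous there.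
Locations on the torus `(ℝ/ℤ)^K` are represented by vectors in `ℝ^K`: `ℓ(·, Z)` has period `1` in
each coordinate (shifting `γ_k` by `1` multiplies a column of `Φ_γ` by `±1`), so minimizing over
`ℝ^K` is minimizing over the torus. -/
structure IsInverseMap (g : ℝ → ℝ) (N : ℕ) {K L : ℕ} (τ : EuclideanSpace ℝ (Fin K))
    (X : Matrix (Fin K) (Fin L) ℂ)
    (ψ : Matrix (Fin N) (Fin L) ℂ → EuclideanSpace ℝ (Fin K)) : Prop where
  argmin : ∀ᶠ Z in 𝓝 (0 : Matrix (Fin N) (Fin L) ℂ),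
    ∀ γ : EuclideanSpace ℝ (Fin K), loss g N τ X (ψ Z) Z ≤ loss g N τ X γ Z
  map_zero : ψ 0 = τ
  continuousAt_zero : ContinuousAt ψ 0

/-- The inverse of the isometric real-linear bijection `ι`, which stacks the real and the imaginary
parts of the entries of a complex `N × L` matrix in a real vector of length `2 L N`. -/
def iotaInv {N L : ℕ} (z : EuclideanSpace ℝ ((Fin N × Fin L) ⊕ (Fin N × Fin L))) :
    Matrix (Fin N) (Fin L) ℂ :=
  Matrix.of fun i l => (z (Sum.inl (i, l)) : ℂ) + (z (Sum.inr (i, l)) : ℂ) * Complex.I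

end PulseLocation

end

/-!
# Stability of pulse localization by least squares

Minimizing `ℓ(γ, Z)` over `γ` amounts to fitting `G Φ_γ B` to the data by least squares, with the
amplitudes `B` profiled out (`loss_le_norm_residual_sq`, `exists_norm_residual_sq_eq_loss`). A
convergent family of least squares solutions of a model whose derivative `T` is injective is
differentiable, with the pseudoinverse of `T` as derivative (`hasFDerivAt_of_forall_norm_sub_le`);
so the Jacobian of `ψ` has norm at most `1 / σ` as soon as the linearized model
`T (δ, B) = D diag(δ) X + A B`, with `A = G Φ_τ` and `D diag(b)` the derivative of `G Φ_γ b` in `γ`,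
satisfies `‖T (δ, B)‖ ≥ σ ‖δ‖` (`IsInverseMap.differentiableAt_and_norm_fderiv_le`). The theorem is
this coercivity (`FlatPair.coercive`), together with `‖A b‖² ≤ E₀ (1 + ρ / (2 Δ)) ‖b‖²`.

Put `p = |ĝ|² / E₀` and `q = |ĝ'|² / E₁ = (s f)² p`, with `s = 2π √(E₀ / E₁)`; this form of `q` is
`ghatDeriv_ae_eq`. Both densities are even, have mass one on the band, and have variation at most
`ρ` after extension by zero (`flatPair_ghat`; that the continuous representative has the least
variation in its class modulo null sets is `eVariationOn_indicator_le`). With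
`F_b(f) = ∑ b_k e^{-2πiτ_k f}`, the quadratic form `‖A b - D c‖²` becomes, after rescaling `b` and
`c`, the sum of `p |F_b + i s f F_c|²` over the sampled frequencies
(`norm_pulseMap_sub_derivMap_sq`). As `p` is even, the real and imaginary parts of the amplitudes
decouple (`FlatPair.energyFormC_eq`), and the claim becomes that this sum is close to
`‖b‖² + ‖c‖²`.

The off-diagonal terms of `|F_b|²` have explicit discrete primitives in the frequency. Summation by
parts against a function of bounded variation (`abs_sum_jump_add_integral_le`) therefore compares
sums over the samples with integrals, with an error of at most `ρ` times the size of the primitive.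
That size is given by the inequality of Montgomery and Vaughan for the form with kernel
`1 / sin (π (τ_k - τ_l))` (`hermitian_form_le`, `abs_hilbert_form_le`), with the
constant `1 / Δ - 1` in place of `1 / Δ`; it follows from the product formula for cotangents and from
the bound for `∑ 1 / sin² (π (τ_k - τ_l))` (`Separated.sum_inv_sin_sq_le`).

The cross term of the form, with density `s f p`, is the difficulty, since this density is not among
those whose variation is given. It is split as `s f p = η₁ p + η₂ q` with `η₁ = t² η₂` and
`η₂ = s f / (t² + (s f)²)`. The derivatives of the weights leave a slow term proportional to `s`,
which is summed by parts a second time; there `s ≤ 1.2456 ρ` (`FlatPair.s_le`), because `p` and `q`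
cannot concentrate near the center and the ends of the band. This yields two lower bounds for the
form: one on all vectors (`FlatPair.energyForm_ge`), good enough when `ρ / Δ ≤ 1.12`, and a sharper
one on vectors `c` with a single nonzero coordinate (`FlatPair.energyForm_single_ge`). The hypothesis
forces `ρ / Δ < 3 / 2`; for `ρ / Δ > 1.12` the second bound says that the columns of `V†V`, with `V`
the part of `D` orthogonal to the range of `A`, are close to those of a multiple of the identity, and
Schur's test against the Gram matrix `X X*` gives the coercivity of `δ ↦ V diag(δ) X`
(`sum_norm_sq_ge_of_diag`).
-/

namespace PulseLocation

/-! ### Cosecant sums over separated points -/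

/-- The partial fraction expansion `π² / sin² (π x) = ∑ 1 / (x + m)²`. It is Parseval's identity
for the function `t ↦ e^{2πixt}` on the unit interval. -/
lemma hasSum_inv_add_int_sq {x : ℝ} (hx : Real.sin (Real.pi * x) ≠ 0) :
    HasSum (fun m : ℤ => ((x + m) ^ 2)⁻¹) (Real.pi ^ 2 / Real.sin (Real.pi * x) ^ 2) := by
  have hpi := Real.pi_pos
  have hxm : ∀ m : ℤ, x + m ≠ 0 := by
    intro m hm
    apply hx
    have : x = ((-m : ℤ) : ℝ) := by push_cast; linarith
    rw [this, mul_comm, Real.sin_int_mul_pi]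
  set f : ℝ → ℂ := fun t => Complex.exp (2 * Real.pi * Complex.I * x * t) with hf
  have hfn : ∀ t, ‖f t‖ = 1 := by
    intro t
    rw [hf]
    have : (2 * Real.pi * Complex.I * x * t : ℂ) = ((2 * Real.pi * x * t : ℝ) : ℂ) * Complex.I := by
      push_cast; ring
    simp only [this, Complex.norm_exp_ofReal_mul_I]
  have hfc : Continuous f := by fun_prop
  have hL2 : MemLp f 2 (volume.restrict (Set.Ioc (0 : ℝ) 1)) :=
    MemLp.of_bound hfc.aestronglyMeasurable 1 (ae_of_all _ fun t => (hfn t).le)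
  have key := hasSum_sq_fourierCoeffOn (zero_lt_one' ℝ) hL2
  have hval : ∀ i : ℤ, ‖fourierCoeffOn (zero_lt_one' ℝ) f (-i)‖ ^ 2 =
      Real.sin (Real.pi * x) ^ 2 / Real.pi ^ 2 * ((x + i) ^ 2)⁻¹ := by
    intro i
    rw [fourierCoeffOn_eq_integral]
    have h1 : ∀ t : ℝ, (fourier (- -i)) (t : AddCircle ((1 : ℝ) - 0)) • f t =
        Complex.exp ((2 * Real.pi * Complex.I * (x + i)) * t) := by
      intro t
      rw [fourier_coe_apply, hf, smul_eq_mul, ← Complex.exp_add]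
      congr 1
      push_cast
      ring
    simp_rw [h1]
    have hne : (2 * Real.pi * Complex.I * (x + i) : ℂ) ≠ 0 := by
      have : ((x : ℂ) + i) ≠ 0 := by exact_mod_cast hxm i
      have : (Real.pi : ℂ) ≠ 0 := by exact_mod_cast hpi.ne'
      simp [*]
    rw [integral_exp_mul_complex hne]
    have h2 : Complex.exp (2 * Real.pi * Complex.I * (x + i) * (1 : ℝ)) =
        Complex.exp ((2 * Real.pi * x : ℝ) * Complex.I) := by
      have : (2 * Real.pi * Complex.I * (x + i) * (1 : ℝ) : ℂ) =
        (2 * Real.pi * x : ℝ) * Complex.I + i * (2 * Real.pi * Complex.I) := by push_cast; ring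
      rw [this, Complex.exp_add, Complex.exp_int_mul_two_pi_mul_I, mul_one]
    rw [h2]
    simp only [Complex.ofReal_zero, mul_zero, Complex.exp_zero, sub_zero, div_one, one_smul]
    rw [norm_div, div_pow]
    have h3 : ‖(2 * Real.pi * Complex.I * (x + i) : ℂ)‖ ^ 2 = 4 * Real.pi ^ 2 * (x + i) ^ 2 := by
      have : ((x : ℂ) + i) = ((x + i : ℝ) : ℂ) := by push_cast; rfl
      rw [this]
      simp only [norm_mul, Complex.norm_I, Complex.norm_real, Complex.norm_ofNat, mul_one,
        Real.norm_eq_abs, mul_pow, sq_abs]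
      ring
    have h4 : ‖Complex.exp ((2 * Real.pi * x : ℝ) * Complex.I) - 1‖ ^ 2 =
        4 * Real.sin (Real.pi * x) ^ 2 := by
      rw [← Complex.normSq_eq_norm_sq, Complex.normSq_apply]
      simp only [Complex.sub_re, Complex.sub_im, Complex.exp_ofReal_mul_I_re,
        Complex.exp_ofReal_mul_I_im, Complex.one_re, Complex.one_im]
      have h5 : 2 * Real.pi * x = 2 * (Real.pi * x) := by ring
      rw [h5, Real.cos_two_mul, Real.sin_two_mul]
      nlinarith [Real.sin_sq_add_cos_sq (Real.pi * x)]
    rw [h3, h4]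
    have := hxm i
    field_simp
  have hint : ((1 : ℝ) - 0)⁻¹ • ∫ t in (0 : ℝ)..1, ‖f t‖ ^ 2 = 1 := by
    simp [hfn]
  rw [hint] at key
  have key2 := (Equiv.neg ℤ).hasSum_iff.mpr key
  have key3 := key2.mul_left (Real.pi ^ 2 / Real.sin (Real.pi * x) ^ 2)
  rw [mul_one] at key3
  refine key3.congr_fun fun m => ?_
  have h6 : (Real.pi ^ 2 / Real.sin (Real.pi * x) ^ 2) *
      ‖fourierCoeffOn (zero_lt_one' ℝ) f (-m)‖ ^ 2 = ((x + m) ^ 2)⁻¹ := by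
    rw [hval]
    field_simp
  exact h6.symm

lemma hasSum_int_inv_sq : HasSum (fun m : ℤ => ((m : ℝ) ^ 2)⁻¹) (Real.pi ^ 2 / 3) := by
  have h := hasSum_zeta_two
  have h2 : HasSum (fun n : ℕ => (((n : ℤ) : ℝ) ^ 2)⁻¹) (Real.pi ^ 2 / 6) := by
    simpa using h
  have h3 := HasSum.of_nat_of_neg (f := fun m : ℤ => ((m : ℝ) ^ 2)⁻¹) h2 (by simpa using h)
  have e : Real.pi ^ 2 / 6 + Real.pi ^ 2 / 6 - (((0 : ℤ) : ℝ) ^ 2)⁻¹ = Real.pi ^ 2 / 3 := by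
    norm_num
    ring
  exact e ▸ h3

/-- Points are `Δ`-separated on the circle `ℝ / ℤ`. -/
def Separated {ι : Type*} (τ : ι → ℝ) (Δ : ℝ) : Prop :=
  ∀ k l : ι, k ≠ l → ∀ j : ℤ, Δ ≤ |τ k - τ l + j|

namespace Separated
variable {ι : Type*} {τ : ι → ℝ} {Δ : ℝ}

lemma sin_ne_zero (h : Separated τ Δ) (hΔ : 0 < Δ) {k l : ι} (hkl : k ≠ l) :
    Real.sin (Real.pi * (τ k - τ l)) ≠ 0 := by
  intro h0
  obtain ⟨n, hn⟩ := Real.sin_eq_zero_iff.mp h0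
  have h1 : τ k - τ l = n := mul_left_cancel₀ Real.pi_ne_zero (by linarith)
  have := h k l hkl (-n)
  rw [h1] at this
  simp at this
  linarith

end Separated

/-- Rounding `t / Δ` towards zero maps a `Δ`-separated set that avoids `(-Δ, Δ)` injectively to
nonzero integers, without increasing absolute values. -/
lemma exists_int_round_inj {S : Set ℝ} {Δ : ℝ} (hΔ : 0 < Δ) (h0 : ∀ t ∈ S, Δ ≤ |t|)
    (hS : ∀ t ∈ S, ∀ u ∈ S, t ≠ u → Δ ≤ |t - u|) :
    ∃ r : ℝ → ℤ, Set.InjOn r S ∧ (∀ t ∈ S, r t ≠ 0) ∧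
      ∀ t ∈ S, (t ^ 2)⁻¹ ≤ (Δ ^ 2)⁻¹ * ((r t : ℝ) ^ 2)⁻¹ := by
  classical
  refine ⟨fun t => if 0 ≤ t then ⌊t / Δ⌋ else ⌈t / Δ⌉, ?_, ?_, ?_⟩
  · intro t ht u hu htu
    by_contra hne
    have h1 := hS t ht u hu hne
    have ha := h0 t ht
    have hb := h0 u hu
    have : |t / Δ - u / Δ| < 1 := by
      simp only at htu
      split_ifs at htu with h2 h3 h3
      · exact Int.abs_sub_lt_one_of_floor_eq_floor htu
      · exfalso
        have h4 : (1 : ℤ) ≤ ⌊t / Δ⌋ := by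
          rw [Int.le_floor]; push_cast; rw [le_div_iff₀ hΔ, one_mul]
          rwa [abs_of_nonneg h2] at ha
        have h5 : ⌈u / Δ⌉ ≤ 0 := by
          rw [Int.ceil_le]; push_cast; exact (div_neg_of_neg_of_pos (not_le.mp h3) hΔ).le
        omega
      · exfalso
        have h4 : (1 : ℤ) ≤ ⌊u / Δ⌋ := by
          rw [Int.le_floor]; push_cast; rw [le_div_iff₀ hΔ, one_mul]
          rwa [abs_of_nonneg h3] at hb
        have h5 : ⌈t / Δ⌉ ≤ 0 := by
          rw [Int.ceil_le]; push_cast; exact (div_neg_of_neg_of_pos (not_le.mp h2) hΔ).le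
        omega
      · have h6 := Int.ceil_lt_add_one (t / Δ)
        have h7 := Int.ceil_lt_add_one (u / Δ)
        have h8 := Int.le_ceil (t / Δ)
        have h9 := Int.le_ceil (u / Δ)
        rw [htu] at h6 h8
        rw [abs_lt]
        constructor <;> linarith
    rw [← sub_div, abs_div, abs_of_pos hΔ, div_lt_one hΔ] at this
    linarith
  · intro t ht h
    have ha := h0 t ht
    simp only at h
    split_ifs at h with h2
    · rw [abs_of_nonneg h2] at ha
      have h4 : (1 : ℤ) ≤ ⌊t / Δ⌋ := by
        rw [Int.le_floor]; push_cast; rwa [le_div_iff₀ hΔ, one_mul]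
      omega
    · rw [abs_of_neg (not_le.mp h2)] at ha
      have h4 : ⌈t / Δ⌉ ≤ -1 := by
        rw [Int.ceil_le]; push_cast; rw [div_le_iff₀ hΔ]; linarith
      omega
  · intro t ht
    have ha := h0 t ht
    have ht0 : 0 < |t| := hΔ.trans_le ha
    rw [← mul_inv, ← mul_pow, ← sq_abs t]
    have hr : |Δ * ((if 0 ≤ t then ⌊t / Δ⌋ else ⌈t / Δ⌉ : ℤ) : ℝ)| ≤ |t| ∧
        0 < |Δ * ((if 0 ≤ t then ⌊t / Δ⌋ else ⌈t / Δ⌉ : ℤ) : ℝ)| := by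
      rw [abs_mul, abs_of_pos hΔ]
      split_ifs with h2
      · rw [abs_of_nonneg h2] at ha ⊢
        have h4 : (1 : ℤ) ≤ ⌊t / Δ⌋ := by
          rw [Int.le_floor]; push_cast; rwa [le_div_iff₀ hΔ, one_mul]
        have h4' : (1 : ℝ) ≤ (⌊t / Δ⌋ : ℝ) := by exact_mod_cast h4
        have h5 := Int.floor_le (t / Δ)
        rw [le_div_iff₀ hΔ] at h5
        rw [abs_of_pos (by linarith)]
        exact ⟨by linarith, by positivity⟩
      · rw [abs_of_neg (not_le.mp h2)] at ha ⊢
        have h4 : ⌈t / Δ⌉ ≤ -1 := by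
          rw [Int.ceil_le]; push_cast; rw [div_le_iff₀ hΔ]; linarith
        have h4' : (⌈t / Δ⌉ : ℝ) ≤ -1 := by exact_mod_cast h4
        have h5 := Int.le_ceil (t / Δ)
        rw [div_le_iff₀ hΔ] at h5
        rw [abs_of_neg (by linarith)]
        exact ⟨by linarith, mul_pos hΔ (by linarith)⟩
    rw [← sq_abs (Δ * _)]
    exact inv_anti₀ (pow_pos hr.2 2) (pow_le_pow_left₀ hr.2.le hr.1 2)

namespace Separated
variable {ι : Type*} [Fintype ι] [DecidableEq ι] {τ : ι → ℝ} {Δ : ℝ}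

/-- The translates of the differences `τ_k - τ_l` by integers, without zero, form a `Δ`-separated
subset of the line at distance `Δ` from zero, so that the sum of their inverse squares is at most
`2 ζ(2) / Δ²`. The integers themselves contribute `2 ζ(2)`. -/
lemma sum_inv_sin_sq_le (h : Separated τ Δ) (hΔ : 0 < Δ) (hΔ1 : Δ ≤ 1) (k : ι) :
    ∑ l ∈ Finset.univ.erase k, (Real.sin (Real.pi * (τ k - τ l)) ^ 2)⁻¹ ≤ ((Δ ^ 2)⁻¹ - 1) / 3 := by
  have hpi := Real.pi_pos
  -- all translates, the zero one included (it contributes nothing as `0⁻¹ = 0`)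
  set y : ι × ℤ → ℝ := fun p => τ k - τ p.1 + p.2 with hy
  have hsep : ∀ p p' : ι × ℤ, p ≠ p' → Δ ≤ |y p - y p'| := by
    rintro ⟨l, m⟩ ⟨l', m'⟩ hne
    by_cases hl : l = l'
    · subst hl
      have hm : m ≠ m' := fun hm => hne (by rw [hm])
      have : y (l, m) - y (l, m') = ((m - m' : ℤ) : ℝ) := by simp [hy]
      rw [this, ← Int.cast_abs]
      have h1 : (1 : ℤ) ≤ |m - m'| := Int.one_le_abs (sub_ne_zero.mpr hm)
      have : (1 : ℝ) ≤ ((|m - m'| : ℤ) : ℝ) := by exact_mod_cast h1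
      linarith
    · have := h l' l (Ne.symm hl) (m - m')
      have h2 : y (l, m) - y (l', m') = τ l' - τ l + ((m - m' : ℤ) : ℝ) := by
        simp [hy]; ring
      rwa [h2]
  have hyinj : Function.Injective y := by
    intro p p' hpp
    by_contra hne
    have := hsep p p' hne
    rw [hpp] at this
    simp at this
    linarith
  have hyk : y (k, 0) = 0 := by simp [hy]
  set S : Set ℝ := y '' {(k, 0)}ᶜ with hSdef
  obtain ⟨r, hrinj, hr0, hrle⟩ := exists_int_round_inj (S := S) hΔ
    (by
      rintro _ ⟨p, hp, rfl⟩
      have := hsep p (k, 0) hp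
      rwa [hyk, sub_zero] at this)
    (by
      rintro _ ⟨p, hp, rfl⟩ _ ⟨p', hp', rfl⟩ hne
      exact hsep p p' (fun e => hne (by rw [e])))
  -- summation over all translates
  have hrow : ∀ l ∈ Finset.univ.erase k, HasSum (fun m : ℤ => ((y (l, m)) ^ 2)⁻¹)
      (Real.pi ^ 2 / Real.sin (Real.pi * (τ k - τ l)) ^ 2) := by
    intro l hl
    have := hasSum_inv_add_int_sq (h.sin_ne_zero hΔ (Finset.ne_of_mem_erase hl).symm)
    simpa only [hy] using this
  have hown : HasSum (fun m : ℤ => ((y (k, m)) ^ 2)⁻¹) (Real.pi ^ 2 / 3) := by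
    simpa [hy] using hasSum_int_inv_sq
  have hpart : ∀ T : Finset ℤ, ∑ l, ∑ m ∈ T, ((y (l, m)) ^ 2)⁻¹ ≤
      (Δ ^ 2)⁻¹ * (Real.pi ^ 2 / 3) := by
    intro T
    have e1 : ∑ l, ∑ m ∈ T, ((y (l, m)) ^ 2)⁻¹ =
        ∑ p ∈ (Finset.univ ×ˢ T).erase (k, 0), ((y p) ^ 2)⁻¹ := by
      rw [← Finset.sum_product']
      symm
      apply Finset.sum_erase
      rw [hyk]; simp
    rw [e1]
    have hmem : ∀ p ∈ (Finset.univ ×ˢ T).erase (k, 0), y p ∈ S := fun p hp =>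
      ⟨p, Finset.ne_of_mem_erase hp, rfl⟩
    calc ∑ p ∈ (Finset.univ ×ˢ T).erase (k, 0), ((y p) ^ 2)⁻¹
        ≤ ∑ p ∈ (Finset.univ ×ˢ T).erase (k, 0), (Δ ^ 2)⁻¹ * ((r (y p) : ℝ) ^ 2)⁻¹ :=
          Finset.sum_le_sum fun p hp => hrle _ (hmem p hp)
      _ = (Δ ^ 2)⁻¹ * ∑ n ∈ ((Finset.univ ×ˢ T).erase (k, 0)).image (fun p => r (y p)),
            ((n : ℝ) ^ 2)⁻¹ := by
          rw [Finset.sum_image, Finset.mul_sum]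
          intro p hp p' hp' e
          exact hyinj (hrinj (hmem p hp) (hmem p' hp') e)
      _ ≤ (Δ ^ 2)⁻¹ * (Real.pi ^ 2 / 3) := by
          gcongr
          exact sum_le_hasSum _ (fun _ _ => by positivity) hasSum_int_inv_sq
  have htot : HasSum (fun m : ℤ => ∑ l, ((y (l, m)) ^ 2)⁻¹)
      (Real.pi ^ 2 / 3 + ∑ l ∈ Finset.univ.erase k,
        Real.pi ^ 2 / Real.sin (Real.pi * (τ k - τ l)) ^ 2) := by
    have := hown.add (hasSum_sum hrow)
    convert this using 2 with m
    rw [Finset.add_sum_erase _ (fun l => ((y (l, m)) ^ 2)⁻¹) (Finset.mem_univ k)]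
  have hfin := htot.summable.tsum_le_of_sum_le
    (fun T => by rw [Finset.sum_comm]; exact hpart T)
  rw [htot.tsum_eq] at hfin
  have e2 : ∑ l ∈ Finset.univ.erase k, Real.pi ^ 2 / Real.sin (Real.pi * (τ k - τ l)) ^ 2 =
      Real.pi ^ 2 * ∑ l ∈ Finset.univ.erase k, (Real.sin (Real.pi * (τ k - τ l)) ^ 2)⁻¹ := by
    simp only [Finset.mul_sum, div_eq_mul_inv]
  rw [e2] at hfin
  have hpi2 : 0 < Real.pi ^ 2 := by positivity
  nlinarith

end Separated

/-! ### A Hilbert-type inequality for separated points -/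

section
variable {ι : Type*} {τ : ι → ℝ} {Δ : ℝ}

/-- The matrix `cot (π (τ_r - τ_s))`. Its diagonal vanishes, as `cot 0 = 0` by convention. -/
noncomputable def cotMat (τ : ι → ℝ) (r s : ι) : ℝ := Real.cot (Real.pi * (τ r - τ s))

lemma cotMat_self (r : ι) : cotMat τ r r = 0 := by simp [cotMat, Real.cot_eq_cos_div_sin]

lemma cotMat_antisymm (r s : ι) : cotMat τ s r = -cotMat τ r s := by
  have : Real.pi * (τ s - τ r) = -(Real.pi * (τ r - τ s)) := by ring
  rw [cotMat, cotMat, this, Real.cot_eq_cos_div_sin, Real.cot_eq_cos_div_sin, Real.cos_neg,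
    Real.sin_neg, div_neg]

/-- The product formula for cotangents. -/
lemma cotMat_mul_cotMat (h : Separated τ Δ) (hΔ : 0 < Δ) {r s t : ι} (hrs : r ≠ s) (hrt : r ≠ t)
    (hst : s ≠ t) :
    cotMat τ r s * cotMat τ r t = -1 + cotMat τ t s * (cotMat τ r t - cotMat τ r s) := by
  have h1 := h.sin_ne_zero hΔ hrs
  have h2 := h.sin_ne_zero hΔ hrt
  have h3 := h.sin_ne_zero hΔ hst.symm
  have e : Real.pi * (τ t - τ s) = Real.pi * (τ r - τ s) - Real.pi * (τ r - τ t) := by ring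
  simp only [cotMat, Real.cot_eq_cos_div_sin] at *
  rw [e] at h3 ⊢
  rw [Real.sin_sub] at h3
  rw [Real.sin_sub, Real.cos_sub]
  field_simp
  ring

variable [Fintype ι] [DecidableEq ι]

lemma sum_cotMat_sq_le (h : Separated τ Δ) (hΔ : 0 < Δ) (hΔ1 : Δ ≤ 1) (s : ι) :
    ∑ r, cotMat τ r s ^ 2 ≤ ((Δ ^ 2)⁻¹ - 1) / 3 - (Fintype.card ι - 1) := by
  have h1 := h.sum_inv_sin_sq_le hΔ hΔ1 s
  have h2 : ∑ r, cotMat τ r s ^ 2 = ∑ r ∈ Finset.univ.erase s, cotMat τ r s ^ 2 := by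
    symm
    apply Finset.sum_erase
    rw [cotMat_self]; simp
  have h3 : ∀ r ∈ Finset.univ.erase s, cotMat τ r s ^ 2 =
      (Real.sin (Real.pi * (τ s - τ r)) ^ 2)⁻¹ - 1 := by
    intro r hr
    have h0 := h.sin_ne_zero hΔ (Finset.ne_of_mem_erase hr).symm
    rw [cotMat_antisymm, neg_sq, cotMat, Real.cot_eq_cos_div_sin, div_pow, Real.cos_sq']
    field_simp
  rw [h2, Finset.sum_congr rfl h3, Finset.sum_sub_distrib]
  have h4 : ((Finset.univ.erase s).card : ℝ) = Fintype.card ι - 1 := by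
    rw [Finset.card_erase_of_mem (Finset.mem_univ s), Finset.card_univ,
      Nat.cast_sub (Fintype.card_pos_iff.mpr ⟨s⟩)]
    simp
  simp only [Finset.sum_const, nsmul_eq_mul, mul_one, h4]
  linarith

lemma sum_cotMat_mul_cotMat (h : Separated τ Δ) (hΔ : 0 < Δ) (s t : ι) :
    ∑ r, cotMat τ r s * cotMat τ r t =
      2 - Fintype.card ι + cotMat τ t s * (∑ r, cotMat τ r t - ∑ r, cotMat τ r s) +
        2 * cotMat τ t s ^ 2 +
        if s = t then (∑ r, cotMat τ r s ^ 2) + Fintype.card ι - 2 else 0 := by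
  by_cases hst : s = t
  · subst hst
    simp [cotMat_self, sq]
  · rw [if_neg hst, add_zero]
    have key : ∀ r, cotMat τ r s * cotMat τ r t =
        -1 + cotMat τ t s * (cotMat τ r t - cotMat τ r s) +
          ((if r = s then 1 + cotMat τ t s ^ 2 else 0) +
            (if r = t then 1 + cotMat τ t s ^ 2 else 0)) := by
      intro r
      by_cases hrs : r = s
      · subst hrs
        rw [if_pos rfl, if_neg hst, cotMat_self, cotMat_antisymm t r]
        ring
      · by_cases hrt : r = t
        · subst hrt
          rw [if_pos rfl, if_neg hrs, cotMat_self]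
          ring
        · rw [if_neg hrs, if_neg hrt, cotMat_mul_cotMat h hΔ hrs hrt hst]
          ring
    rw [Finset.sum_congr rfl fun r _ => key r]
    simp only [Finset.sum_add_distrib, ← Finset.mul_sum, Finset.sum_sub_distrib,
      Finset.sum_ite_eq', Finset.mem_univ, if_true, Finset.sum_const, Finset.card_univ,
      nsmul_eq_mul]
    ring

/-- Eigenvalues `ev` of the Hermitian matrix `1 - i cot (π (τ_r - τ_s))` satisfy `ev ≤ 1 / Δ`. The
product formula for cotangents turns the squared norm of `cot u` into
`ev² = ∑ |u_s|² D_s + 2 ∑ ū_s u_t cot²_{ts} + K - 2 + 2 |∑ u_s|²` for a unit eigenvector `u`, with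
`D_s` the column sums of the squared cotangents and `K` the number of points. -/
lemma sq_eigenvalue_le (h : Separated τ Δ) (hΔ : 0 < Δ) (hΔ1 : Δ ≤ 1) (u : ι → ℂ) (ev : ℝ)
    (hu : ∑ s, ‖u s‖ ^ 2 = 1)
    (heig : ∀ r, ∑ s, (1 - Complex.I * cotMat τ r s) * u s = ev * u r) :
    ev ^ 2 ≤ (Δ ^ 2)⁻¹ := by
  set C : ι → ι → ℂ := fun r s => (cotMat τ r s : ℂ) with hC
  set U : ℂ := ∑ s, u s with hU
  set K : ℂ := (Fintype.card ι : ℂ) with hK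
  set cc : ι → ℂ := fun t => ∑ r, C r t with hcc
  set D : ι → ℝ := fun s => ∑ r, cotMat τ r s ^ 2 with hD
  have huc : ∑ s, starRingEnd ℂ (u s) * u s = 1 := by
    have : ∀ s, starRingEnd ℂ (u s) * u s = ((‖u s‖ ^ 2 : ℝ) : ℂ) := fun s => by
      rw [mul_comm, Complex.mul_conj, Complex.normSq_eq_norm_sq]
    simp_rw [this]
    rw [← Complex.ofReal_sum, hu, Complex.ofReal_one]
  have hv : ∀ r, ∑ s, C r s * u s = Complex.I * (ev * u r - U) := by
    intro r
    have h1 := heig r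
    have h2 : ∑ s, (1 - Complex.I * cotMat τ r s) * u s = U - Complex.I * ∑ s, C r s * u s := by
      rw [hU, Finset.mul_sum, ← Finset.sum_sub_distrib]
      exact Finset.sum_congr rfl fun s _ => by simp only [hC]; ring
    rw [h2] at h1
    linear_combination Complex.I * h1 + (∑ s, C r s * u s) * Complex.I_mul_I
  have hvc : ∀ r, ∑ s, C r s * starRingEnd ℂ (u s) =
      -Complex.I * (ev * starRingEnd ℂ (u r) - starRingEnd ℂ U) := by
    intro r
    have := congrArg (starRingEnd ℂ) (hv r)
    simpa [map_sum, hC] using this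
  have hanti : ∀ r s, C s r = -C r s := fun r s => by
    simp only [hC]; rw [cotMat_antisymm]; push_cast; rfl
  set Uc : ℂ := starRingEnd ℂ U with hUc
  -- the column sums of the cotangents against `u`
  have hcu : ∑ t, cc t * u t = Complex.I * (ev - K) * U := by
    simp only [hcc, Finset.sum_mul]
    rw [Finset.sum_comm, Finset.sum_congr rfl fun r _ => hv r, ← Finset.mul_sum,
      Finset.sum_sub_distrib, ← Finset.mul_sum]
    simp only [Finset.sum_const, Finset.card_univ, nsmul_eq_mul]
    rw [← hU]; ring
  have hcuc : ∑ t, cc t * starRingEnd ℂ (u t) = -Complex.I * (ev - K) * Uc := by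
    have := congrArg (starRingEnd ℂ) hcu
    simpa [map_sum, hC, hcc, hK] using this
  -- first evaluation of the squared norm
  have hN1 : ∑ r, (∑ s, C r s * starRingEnd ℂ (u s)) * (∑ t, C r t * u t) =
      ev ^ 2 - 2 * ev * (Uc * U) + K * (Uc * U) := by
    have h1 : ∀ r, (∑ s, C r s * starRingEnd ℂ (u s)) * (∑ t, C r t * u t) =
        ev ^ 2 * (starRingEnd ℂ (u r) * u r) - ev * Uc * u r - ev * U * starRingEnd ℂ (u r)
          + Uc * U := by
      intro r
      rw [hv, hvc]
      linear_combination (-(ev * starRingEnd ℂ (u r) - Uc) * (ev * u r - U)) * Complex.I_mul_I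
    rw [Finset.sum_congr rfl fun r _ => h1 r]
    simp only [Finset.sum_add_distrib, Finset.sum_sub_distrib, ← Finset.mul_sum, huc,
      Finset.sum_const, Finset.card_univ, nsmul_eq_mul]
    rw [← hU, ← map_sum]
    ring
  -- second evaluation
  have hP : ∀ s t, ∑ r, C r s * C r t = 2 - K + C t s * (cc t - cc s) + 2 * C t s ^ 2 +
      if s = t then (D s : ℂ) + K - 2 else 0 := by
    intro s t
    have := congrArg (fun z : ℝ => (z : ℂ)) (sum_cotMat_mul_cotMat h hΔ s t)
    simp only [hC, hcc, hD, hK]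
    by_cases hst : s = t
    · rw [if_pos hst] at this ⊢
      push_cast at this ⊢
      rw [this]
    · rw [if_neg hst] at this ⊢
      push_cast at this ⊢
      exact this
  have hW : ∑ s, ∑ t, starRingEnd ℂ (u s) * u t * (C t s * (cc t - cc s)) =
      -2 * (ev - K) * (Uc * U) := by
    have h1 : ∑ s, ∑ t, starRingEnd ℂ (u s) * u t * (C t s * (cc t - cc s)) =
        ∑ t, cc t * u t * (∑ s, C t s * starRingEnd ℂ (u s)) +
          ∑ s, cc s * starRingEnd ℂ (u s) * (∑ t, C s t * u t) := by
      simp only [Finset.mul_sum]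
      rw [Finset.sum_comm (f := fun t s => cc t * u t * (C t s * starRingEnd ℂ (u s))),
        ← Finset.sum_add_distrib]
      refine Finset.sum_congr rfl fun s _ => ?_
      rw [← Finset.sum_add_distrib]
      refine Finset.sum_congr rfl fun t _ => ?_
      rw [hanti t s]; ring
    rw [h1]
    have h2 : ∀ t, cc t * u t * (∑ s, C t s * starRingEnd ℂ (u s)) =
        -Complex.I * ev * (cc t * (starRingEnd ℂ (u t) * u t)) + Complex.I * Uc * (cc t * u t) := by
      intro t; rw [hvc]; ring
    have h3 : ∀ t, cc t * starRingEnd ℂ (u t) * (∑ s, C t s * u s) =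
        Complex.I * ev * (cc t * (starRingEnd ℂ (u t) * u t))
          - Complex.I * U * (cc t * starRingEnd ℂ (u t)) := by
      intro t; rw [hv]; ring
    rw [Finset.sum_congr rfl fun r _ => h2 r, Finset.sum_congr rfl fun r _ => h3 r]
    simp only [Finset.sum_add_distrib, Finset.sum_sub_distrib, ← Finset.mul_sum, hcu, hcuc]
    linear_combination (2 * (ev - K) * Uc * U) * Complex.I_mul_I
  have hN2 : ∑ r, (∑ s, C r s * starRingEnd ℂ (u s)) * (∑ t, C r t * u t) =
      (2 - K) * (Uc * U) + (∑ s, (D s : ℂ) * (starRingEnd ℂ (u s) * u s)) + (K - 2)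
        + 2 * (∑ s, ∑ t, starRingEnd ℂ (u s) * u t * C t s ^ 2) - 2 * (ev - K) * (Uc * U) := by
    have h1 : ∑ r, (∑ s, C r s * starRingEnd ℂ (u s)) * (∑ t, C r t * u t) =
        ∑ s, ∑ t, starRingEnd ℂ (u s) * u t * ∑ r, C r s * C r t := by
      rw [Finset.sum_congr rfl fun r _ => Finset.sum_mul_sum _ _ _ _, Finset.sum_comm]
      refine Finset.sum_congr rfl fun s _ => ?_
      rw [Finset.sum_comm]
      refine Finset.sum_congr rfl fun t _ => ?_
      rw [Finset.mul_sum]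
      exact Finset.sum_congr rfl fun r _ => by ring
    rw [h1]
    simp only [hP, mul_add (starRingEnd ℂ _ * _), Finset.sum_add_distrib, hW, mul_ite, mul_zero,
    Finset.sum_ite_eq,
      Finset.mem_univ, if_true]
    have h2 : ∑ s, ∑ t, starRingEnd ℂ (u s) * u t * (2 - K) = (2 - K) * (Uc * U) := by
      simp only [← Finset.sum_mul, ← Finset.mul_sum]
      rw [← hU, ← map_sum]
      ring
    have h3 : ∑ s, starRingEnd ℂ (u s) * u s * ((D s : ℂ) + K - 2) =
        (∑ s, (D s : ℂ) * (starRingEnd ℂ (u s) * u s)) + (K - 2) := by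
      have : ∀ s, starRingEnd ℂ (u s) * u s * ((D s : ℂ) + K - 2) =
        (D s : ℂ) * (starRingEnd ℂ (u s) * u s) + (K - 2) * (starRingEnd ℂ (u s) * u s) :=
        fun s => by ring
      rw [Finset.sum_congr rfl fun s _ => this s, Finset.sum_add_distrib, ← Finset.mul_sum, huc,
        mul_one]
    have h4 : ∑ s, ∑ t, starRingEnd ℂ (u s) * u t * (2 * C t s ^ 2) =
        2 * (∑ s, ∑ t, starRingEnd ℂ (u s) * u t * C t s ^ 2) := by
      simp only [Finset.mul_sum]
      refine Finset.sum_congr rfl fun s _ => Finset.sum_congr rfl fun t _ => by ring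
    rw [h2, h4, h3]
    ring
  have hid : (ev : ℂ) ^ 2 = (∑ s, (D s : ℂ) * (starRingEnd ℂ (u s) * u s)) + (K - 2) +
      2 * (∑ s, ∑ t, starRingEnd ℂ (u s) * u t * C t s ^ 2) + 2 * (Uc * U) := by
    linear_combination hN2 - hN1
  -- real parts
  have hre := congrArg Complex.re hid
  have e0 : ((ev : ℂ) ^ 2).re = ev ^ 2 := by norm_cast
  have e1 : (∑ s, (D s : ℂ) * (starRingEnd ℂ (u s) * u s)).re = ∑ s, D s * ‖u s‖ ^ 2 := by
    rw [Complex.re_sum]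
    refine Finset.sum_congr rfl fun s _ => ?_
    rw [mul_comm (starRingEnd ℂ (u s)), Complex.mul_conj, Complex.normSq_eq_norm_sq]
    norm_cast
  have e2 : (Uc * U).re ≤ Fintype.card ι := by
    rw [hUc, mul_comm, Complex.mul_conj, Complex.ofReal_re, Complex.normSq_eq_norm_sq]
    calc ‖U‖ ^ 2 ≤ (∑ s, ‖u s‖) ^ 2 := by gcongr; exact norm_sum_le _ _
      _ ≤ (Finset.univ.card : ℝ) * ∑ s, ‖u s‖ ^ 2 := sq_sum_le_card_mul_sum_sq
      _ = Fintype.card ι := by rw [hu, mul_one, Finset.card_univ]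
  have e3 : (∑ s, ∑ t, starRingEnd ℂ (u s) * u t * C t s ^ 2).re ≤ ∑ s, D s * ‖u s‖ ^ 2 := by
    rw [Complex.re_sum]
    have hb : ∀ s t, (starRingEnd ℂ (u s) * u t * C t s ^ 2).re ≤
        (‖u s‖ ^ 2 * cotMat τ t s ^ 2 + ‖u t‖ ^ 2 * cotMat τ t s ^ 2) / 2 := by
      intro s t
      have : (starRingEnd ℂ (u s) * u t * C t s ^ 2).re =
          (starRingEnd ℂ (u s) * u t).re * cotMat τ t s ^ 2 := by
        rw [hC]; rw [← Complex.ofReal_pow, Complex.re_mul_ofReal]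
      rw [this]
      have h5 : (starRingEnd ℂ (u s) * u t).re ≤ ‖u s‖ * ‖u t‖ := by
        refine (Complex.re_le_norm _).trans ?_
        rw [norm_mul, RCLike.norm_conj]
      have h6 : 0 ≤ cotMat τ t s ^ 2 := sq_nonneg _
      nlinarith [sq_nonneg (‖u s‖ - ‖u t‖)]
    calc ∑ s, (∑ t, starRingEnd ℂ (u s) * u t * C t s ^ 2).re
        ≤ ∑ s, ∑ t, (‖u s‖ ^ 2 * cotMat τ t s ^ 2 + ‖u t‖ ^ 2 * cotMat τ t s ^ 2) / 2 := by
          refine Finset.sum_le_sum fun s _ => ?_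
          rw [Complex.re_sum]
          exact Finset.sum_le_sum fun t _ => hb s t
      _ = ∑ s, D s * ‖u s‖ ^ 2 := by
          simp only [add_div, Finset.sum_add_distrib]
          rw [Finset.sum_comm (f := fun s t => ‖u t‖ ^ 2 * cotMat τ t s ^ 2 / 2)]
          rw [← Finset.sum_add_distrib]
          refine Finset.sum_congr rfl fun s _ => ?_
          rw [← Finset.sum_add_distrib, hD, Finset.sum_mul]
          refine Finset.sum_congr rfl fun t _ => ?_
          rw [cotMat_antisymm t s]; ring
  have e4 : ∑ s, D s * ‖u s‖ ^ 2 ≤ ((Δ ^ 2)⁻¹ - 1) / 3 - (Fintype.card ι - 1) := by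
    calc ∑ s, D s * ‖u s‖ ^ 2
        ≤ ∑ s, (((Δ ^ 2)⁻¹ - 1) / 3 - (Fintype.card ι - 1)) * ‖u s‖ ^ 2 := by
          refine Finset.sum_le_sum fun s _ => ?_
          gcongr
          exact sum_cotMat_sq_le h hΔ hΔ1 s
      _ = _ := by rw [← Finset.mul_sum, hu, mul_one]
  rw [e0] at hre
  simp only [Complex.add_re, Complex.sub_re, e1, Complex.mul_re, Complex.re_ofNat, Complex.im_ofNat,
    zero_mul, sub_zero] at hre
  have e5 : K.re = Fintype.card ι := by rw [hK]; simp
  rw [e5] at hre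
  have e6 : Uc.re * U.re - Uc.im * U.im = (Uc * U).re := by rw [Complex.mul_re]
  rw [e6] at hre
  nlinarith

open scoped ComplexOrder in
/-- The bound `1 / Δ` for the Hermitian form of `1 - i cot (π (τ_r - τ_s))`. Up to unimodular
factors, `1 - i cot x = -i e^{ix} / sin x` off the diagonal, so this is an inequality of Montgomery–Vaughan
type in which the diagonal of the form is included. -/
lemma hermitian_form_le (h : Separated τ Δ) (hΔ : 0 < Δ) (hΔ1 : Δ ≤ 1) (a : ι → ℂ) :
    (∑ r, ∑ s, starRingEnd ℂ (a r) * (1 - Complex.I * cotMat τ r s) * a s).re ≤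
      Δ⁻¹ * ∑ s, ‖a s‖ ^ 2 := by
  set B : Matrix ι ι ℂ := Matrix.of fun r s => (1 - Complex.I * cotMat τ r s : ℂ) with hB
  set M : Matrix ι ι ℂ := ((Δ⁻¹ : ℝ) : ℂ) • (1 : Matrix ι ι ℂ) - B with hM
  have hBh : B.IsHermitian := by
    ext r s
    simp [hB, cotMat_antisymm r s, sub_eq_add_neg]
  have hMh : M.IsHermitian := by
    refine Matrix.IsHermitian.sub ?_ hBh
    ext r s
    by_cases hrs : r = s
    · simp [hrs]
    · simp [hrs, Ne.symm hrs]
  have hpos : M.PosSemidef := by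
    rw [hMh.posSemidef_iff_eigenvalues_nonneg]
    intro j
    set u := hMh.eigenvectorBasis j with hu
    have h1 : M *ᵥ u = hMh.eigenvalues j • (u : ι → ℂ) := hMh.mulVec_eigenvectorBasis j
    have hnorm : ∑ s, ‖u s‖ ^ 2 = 1 := by
      rw [← EuclideanSpace.norm_sq_eq, hMh.eigenvectorBasis.orthonormal.1 j, one_pow]
    have h2 := sq_eigenvalue_le h hΔ hΔ1 u (Δ⁻¹ - hMh.eigenvalues j) hnorm (by
      intro r
      have h3 := congrFun h1 r
      have hMu : M *ᵥ u = ((Δ⁻¹ : ℝ) : ℂ) • (u : ι → ℂ) - B *ᵥ u := by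
        rw [hM, Matrix.sub_mulVec, Matrix.smul_mulVec, Matrix.one_mulVec]
      rw [hMu] at h3
      simp only [Pi.sub_apply, Pi.smul_apply, smul_eq_mul, Complex.real_smul] at h3
      have h4 : (B *ᵥ u) r = ∑ s, (1 - Complex.I * cotMat τ r s) * u s := rfl
      rw [← h4]
      push_cast at h3 ⊢
      linear_combination -h3)
    have h5 : (Δ⁻¹ - hMh.eigenvalues j) ^ 2 ≤ (Δ⁻¹) ^ 2 := by rwa [inv_pow]
    have h6 := abs_le_of_sq_le_sq h5 (by positivity)
    rw [abs_le] at h6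
    simp only [Pi.zero_apply]
    linarith [h6.2]
  have h7 := hpos.re_dotProduct_nonneg a
  rw [hM, Matrix.sub_mulVec, Matrix.smul_mulVec, Matrix.one_mulVec, dotProduct_sub,
    dotProduct_smul] at h7
  have h8 : star a ⬝ᵥ a = ((∑ s, ‖a s‖ ^ 2 : ℝ) : ℂ) := by
    rw [dotProduct, Complex.ofReal_sum]
    refine Finset.sum_congr rfl fun s _ => ?_
    rw [Pi.star_apply, mul_comm, Complex.star_def, Complex.mul_conj, Complex.normSq_eq_norm_sq]
  have h9 : star a ⬝ᵥ B *ᵥ a =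
      ∑ r, ∑ s, starRingEnd ℂ (a r) * (1 - Complex.I * cotMat τ r s) * a s := by
    rw [dotProduct]
    refine Finset.sum_congr rfl fun r _ => ?_
    rw [Matrix.mulVec, dotProduct, Finset.mul_sum]
    refine Finset.sum_congr rfl fun s _ => ?_
    rw [hB, Matrix.of_apply, Pi.star_apply, Complex.star_def, mul_assoc]
  rw [h8, h9, smul_eq_mul, ← Complex.ofReal_mul] at h7
  simp only [map_sub, RCLike.re_eq_complex_re, Complex.ofReal_re] at h7
  linarith

end

/-! ### Trigonometric kernels between the sampled frequencies -/

section
variable {ι : Type*} [Fintype ι] {τ : ι → ℝ} {Δ : ℝ}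

/-- `∑ b_k c_l cos (2π (τ_k - τ_l) f)`; for `b = c` this is `|∑ b_k e^{-2πiτ_k f}|²`. -/
noncomputable def cosSum (τ : ι → ℝ) (f : ℝ) (b c : ι → ℝ) : ℝ :=
  ∑ k, ∑ l, b k * c l * Real.cos (2 * Real.pi * (τ k - τ l) * f)

/-- `∑ b_k c_l sin (2π (τ_k - τ_l) f)`. -/
noncomputable def sinSum (τ : ι → ℝ) (f : ℝ) (b c : ι → ℝ) : ℝ :=
  ∑ k, ∑ l, b k * c l * Real.sin (2 * Real.pi * (τ k - τ l) * f)

/-- `∑_{k ≠ l} b_k b_l sin (2π (τ_k - τ_l) f) / (2 sin (π (τ_k - τ_l)))`, a discrete primitive of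
the off-diagonal part of `cosSum`. The diagonal terms vanish by the convention `0 / 0 = 0`. -/
noncomputable def sinForm (τ : ι → ℝ) (f : ℝ) (b : ι → ℝ) : ℝ :=
  ∑ k, ∑ l, b k * b l *
    (Real.sin (2 * Real.pi * (τ k - τ l) * f) / (2 * Real.sin (Real.pi * (τ k - τ l))))

/-- `∑_{k ≠ l} b_k c_l cos (2π (τ_k - τ_l) f) / (2 sin (π (τ_k - τ_l)))`, a discrete primitive of
`-sinSum`. The diagonal terms vanish by the convention `1 / 0 = 0`. -/
noncomputable def cosForm (τ : ι → ℝ) (f : ℝ) (b c : ι → ℝ) : ℝ :=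
  ∑ k, ∑ l, b k * c l *
    (Real.cos (2 * Real.pi * (τ k - τ l) * f) / (2 * Real.sin (Real.pi * (τ k - τ l))))

/-- `∑_{k ≠ l} b_k c_l sin (2π (τ_k - τ_l) f) / (4 sin² (π (τ_k - τ_l)))`, a discrete primitive of
`cosForm`. -/
noncomputable def sinForm₂ (τ : ι → ℝ) (f : ℝ) (b c : ι → ℝ) : ℝ :=
  ∑ k, ∑ l, b k * c l *
    (Real.sin (2 * Real.pi * (τ k - τ l) * f) / (4 * Real.sin (Real.pi * (τ k - τ l)) ^ 2))

lemma sinForm_neg (f : ℝ) (b : ι → ℝ) : sinForm τ (-f) b = -sinForm τ f b := by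
  simp only [sinForm, ← Finset.sum_neg_distrib]
  refine Finset.sum_congr rfl fun k _ => Finset.sum_congr rfl fun l _ => ?_
  rw [mul_neg, Real.sin_neg]
  ring

lemma cosForm_neg (f : ℝ) (b c : ι → ℝ) : cosForm τ (-f) b c = cosForm τ f b c := by
  simp only [cosForm]
  refine Finset.sum_congr rfl fun k _ => Finset.sum_congr rfl fun l _ => ?_
  rw [mul_neg, Real.cos_neg]

lemma sinForm_neg_right (f : ℝ) (b : ι → ℝ) : sinForm τ f (-b) = sinForm τ f b := by
  simp [sinForm]

lemma cosForm_smul_left (f r : ℝ) (b c : ι → ℝ) :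
    cosForm τ f (r • b) c = r * cosForm τ f b c := by
  simp only [cosForm, Finset.mul_sum, Pi.smul_apply, smul_eq_mul]
  exact Finset.sum_congr rfl fun k _ => Finset.sum_congr rfl fun l _ => by ring

lemma cosForm_smul_right (f r : ℝ) (b c : ι → ℝ) :
    cosForm τ f b (r • c) = r * cosForm τ f b c := by
  simp only [cosForm, Finset.mul_sum, Pi.smul_apply, smul_eq_mul]
  exact Finset.sum_congr rfl fun k _ => Finset.sum_congr rfl fun l _ => by ring

lemma sinForm_smul (f r : ℝ) (b : ι → ℝ) :
    sinForm τ f (r • b) = r ^ 2 * sinForm τ f b := by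
  simp only [sinForm, Finset.mul_sum, Pi.smul_apply, smul_eq_mul]
  exact Finset.sum_congr rfl fun k _ => Finset.sum_congr rfl fun l _ => by ring

lemma cosForm_neg_right (f : ℝ) (b c : ι → ℝ) : cosForm τ f b (-c) = -cosForm τ f b c := by
  simp [cosForm]

lemma cosForm_swap (f : ℝ) (b c : ι → ℝ) : cosForm τ f c b = -cosForm τ f b c := by
  simp only [cosForm]
  rw [Finset.sum_comm, ← Finset.sum_neg_distrib]
  refine Finset.sum_congr rfl fun k _ => ?_
  rw [← Finset.sum_neg_distrib]
  refine Finset.sum_congr rfl fun l _ => ?_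
  have e1 : 2 * Real.pi * (τ l - τ k) * f = -(2 * Real.pi * (τ k - τ l) * f) := by ring
  have e2 : Real.pi * (τ l - τ k) = -(Real.pi * (τ k - τ l)) := by ring
  rw [e1, e2, Real.cos_neg, Real.sin_neg, mul_neg, div_neg]
  ring

lemma cosForm_add_half_sub (h : Separated τ Δ) (hΔ : 0 < Δ) (f : ℝ) (b c : ι → ℝ) :
    cosForm τ (f + 1 / 2) b c - cosForm τ (f - 1 / 2) b c = -sinSum τ f b c := by
  simp only [cosForm, sinSum, ← Finset.sum_sub_distrib, ← Finset.sum_neg_distrib]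
  refine Finset.sum_congr rfl fun k _ => Finset.sum_congr rfl fun l _ => ?_
  by_cases hkl : k = l
  · subst hkl; simp
  have h0 := h.sin_ne_zero hΔ hkl
  have e1 : 2 * Real.pi * (τ k - τ l) * (f + 1 / 2) =
    2 * Real.pi * (τ k - τ l) * f + Real.pi * (τ k - τ l) := by ring
  have e2 : 2 * Real.pi * (τ k - τ l) * (f - 1 / 2) =
    2 * Real.pi * (τ k - τ l) * f - Real.pi * (τ k - τ l) := by ring
  rw [e1, e2, Real.cos_add, Real.cos_sub]
  field_simp
  ring

lemma sinForm_add_half_sub [DecidableEq ι] (h : Separated τ Δ) (hΔ : 0 < Δ) (f : ℝ) (b : ι → ℝ) :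
    sinForm τ (f + 1 / 2) b - sinForm τ (f - 1 / 2) b = cosSum τ f b b - ∑ k, b k ^ 2 := by
  have e : ∑ k, b k ^ 2 = ∑ k, ∑ l, if k = l then b k ^ 2 else 0 := by simp
  rw [e]
  simp only [sinForm, cosSum, ← Finset.sum_sub_distrib]
  refine Finset.sum_congr rfl fun k _ => Finset.sum_congr rfl fun l _ => ?_
  by_cases hkl : k = l
  · subst hkl; simp; ring
  have h0 := h.sin_ne_zero hΔ hkl
  have e1 : 2 * Real.pi * (τ k - τ l) * (f + 1 / 2) =
    2 * Real.pi * (τ k - τ l) * f + Real.pi * (τ k - τ l) := by ring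
  have e2 : 2 * Real.pi * (τ k - τ l) * (f - 1 / 2) =
    2 * Real.pi * (τ k - τ l) * f - Real.pi * (τ k - τ l) := by ring
  rw [e1, e2, Real.sin_add, Real.sin_sub, if_neg hkl]
  field_simp
  ring

lemma sinForm₂_add_half_sub (h : Separated τ Δ) (hΔ : 0 < Δ) (f : ℝ) (b c : ι → ℝ) :
    sinForm₂ τ (f + 1 / 2) b c - sinForm₂ τ (f - 1 / 2) b c = cosForm τ f b c := by
  simp only [sinForm₂, cosForm, ← Finset.sum_sub_distrib]
  refine Finset.sum_congr rfl fun k _ => Finset.sum_congr rfl fun l _ => ?_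
  by_cases hkl : k = l
  · subst hkl; simp
  have h0 := h.sin_ne_zero hΔ hkl
  have e1 : 2 * Real.pi * (τ k - τ l) * (f + 1 / 2) =
    2 * Real.pi * (τ k - τ l) * f + Real.pi * (τ k - τ l) := by ring
  have e2 : 2 * Real.pi * (τ k - τ l) * (f - 1 / 2) =
    2 * Real.pi * (τ k - τ l) * f - Real.pi * (τ k - τ l) := by ring
  rw [e1, e2, Real.sin_add, Real.sin_sub]
  field_simp
  ring

/-- A sharpened Montgomery–Vaughan type inequality, in real form: `b` and `c` are the real and
imaginary parts of the coefficients. -/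
lemma hilbert_form_le (h : Separated τ Δ) (hΔ : 0 < Δ) (hΔ1 : Δ ≤ 1) (f : ℝ)
    (b c : ι → ℝ) :
    sinForm τ f b + 2 * cosForm τ f b c + sinForm τ f c ≤
      1 / 2 * (Δ⁻¹ - 1) * (∑ k, b k ^ 2 + ∑ k, c k ^ 2) := by
  classical
  set a : ι → ℂ := fun k =>
    (b k + c k * Complex.I) *
      Complex.exp (((-(2 * Real.pi * τ k * (f - 1 / 2)) : ℝ) : ℂ) * Complex.I)
    with ha
  have h1 := hermitian_form_le h hΔ hΔ1 a
  have h2 : ∀ k, ‖a k‖ ^ 2 = b k ^ 2 + c k ^ 2 := by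
    intro k
    rw [ha]
    simp only [norm_mul, Complex.norm_exp_ofReal_mul_I, mul_one]
    rw [← Complex.normSq_eq_norm_sq, Complex.normSq_add_mul_I]
  have h3 : ∀ k l, (starRingEnd ℂ (a k) * (1 - Complex.I * cotMat τ k l) * a l).re =
      (if k = l then b k ^ 2 + c k ^ 2 else 0) +
      2 * ((b k * b l) * (Real.sin (2 * Real.pi * (τ k - τ l) * f) /
        (2 * Real.sin (Real.pi * (τ k - τ l)))) +
      (c k * c l) * (Real.sin (2 * Real.pi * (τ k - τ l) * f) /
        (2 * Real.sin (Real.pi * (τ k - τ l)))) +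
      (b k * c l) * (Real.cos (2 * Real.pi * (τ k - τ l) * f) /
        (2 * Real.sin (Real.pi * (τ k - τ l)))) -
      (c k * b l) * (Real.cos (2 * Real.pi * (τ k - τ l) * f) /
        (2 * Real.sin (Real.pi * (τ k - τ l))))) := by
    intro k l
    by_cases hkl : k = l
    · subst hkl
      rw [if_pos rfl, cotMat_self]
      simp only [Complex.ofReal_zero, mul_zero, sub_zero, mul_one, sub_self, Real.sin_zero,
        div_zero, add_zero]
      rw [mul_comm, Complex.mul_conj, Complex.ofReal_re, Complex.normSq_eq_norm_sq, h2]
    · rw [if_neg hkl, zero_add]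
      have h0 := h.sin_ne_zero hΔ hkl
      have h4 : starRingEnd ℂ (a k) * (1 - Complex.I * cotMat τ k l) * a l =
          (((b k * b l + c k * c l : ℝ) : ℂ) + ((b k * c l - c k * b l : ℝ) : ℂ) * Complex.I) *
          (1 - Complex.I * cotMat τ k l) *
          Complex.exp (((2 * Real.pi * (τ k - τ l) * f - Real.pi * (τ k - τ l) : ℝ) : ℂ) *
            Complex.I) := by
        have h5 : Complex.exp (((2 * Real.pi * (τ k - τ l) * f - Real.pi * (τ k - τ l) : ℝ) : ℂ) *
            Complex.I) = starRingEnd ℂ (Complex.exp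
              (((-(2 * Real.pi * τ k * (f - 1 / 2)) : ℝ) : ℂ) * Complex.I)) *
              Complex.exp (((-(2 * Real.pi * τ l * (f - 1 / 2)) : ℝ) : ℂ) * Complex.I) := by
          rw [← Complex.exp_conj, map_mul, Complex.conj_I, Complex.conj_ofReal, ← Complex.exp_add]
          congr 1
          push_cast
          ring
        rw [h5, ha]
        simp only [map_mul, map_add, Complex.conj_ofReal, Complex.conj_I]
        push_cast
        linear_combination (-(c k : ℂ) * c l * (1 - Complex.I * cotMat τ k l) * (starRingEnd ℂ (Complex.exp
              (-(2 * Real.pi * τ k * (f - 1 / 2)) * Complex.I))) *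
              Complex.exp (-(2 * Real.pi * τ l * (f - 1 / 2)) * Complex.I)) * Complex.I_mul_I
      rw [h4, Complex.exp_mul_I, ← Complex.ofReal_cos, ← Complex.ofReal_sin]
      simp only [Complex.mul_re, Complex.add_re, Complex.sub_re, Complex.ofReal_re, Complex.I_re,
        Complex.I_im, Complex.ofReal_im, Complex.mul_im, Complex.add_im, Complex.sub_im,
        Complex.one_re, Complex.one_im]
      rw [cotMat, Real.cot_eq_cos_div_sin]
      have e1 := Real.sin_add (2 * Real.pi * (τ k - τ l) * f - Real.pi * (τ k - τ l))
        (Real.pi * (τ k - τ l))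
      have e2 := Real.cos_add (2 * Real.pi * (τ k - τ l) * f - Real.pi * (τ k - τ l))
        (Real.pi * (τ k - τ l))
      rw [sub_add_cancel] at e1 e2
      rw [e1, e2]
      field_simp
      ring
  have h6 : (∑ r, ∑ s, starRingEnd ℂ (a r) * (1 - Complex.I * cotMat τ r s) * a s).re =
      (∑ k, b k ^ 2 + ∑ k, c k ^ 2) +
        2 * (sinForm τ f b + sinForm τ f c + cosForm τ f b c - cosForm τ f c b) := by
    simp only [Complex.re_sum, h3, Finset.sum_add_distrib, Finset.sum_sub_distrib,
      ← Finset.mul_sum, Finset.sum_ite_eq, Finset.mem_univ, if_true]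
    rfl
  rw [h6, cosForm_swap f b c] at h1
  simp only [h2, Finset.sum_add_distrib] at h1
  linarith

lemma abs_hilbert_form_le (h : Separated τ Δ) (hΔ : 0 < Δ) (hΔ1 : Δ ≤ 1) (f : ℝ)
    (b c : ι → ℝ) :
    |sinForm τ f b + 2 * cosForm τ f b c + sinForm τ f c| ≤
      1 / 2 * (Δ⁻¹ - 1) * (∑ k, b k ^ 2 + ∑ k, c k ^ 2) := by
  rw [abs_le]
  refine ⟨?_, hilbert_form_le h hΔ hΔ1 f b c⟩
  have h1 := hilbert_form_le h hΔ hΔ1 (-f) b (-c)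
  rw [sinForm_neg, sinForm_neg, cosForm_neg, cosForm_neg_right, sinForm_neg_right] at h1
  simp only [Pi.neg_apply, neg_sq] at h1
  linarith

/-- The Schur test for a matrix dominated by a symmetric matrix with small row sums. -/
lemma abs_sum_sum_le_of_row_sum_le (T M : ι → ι → ℝ) (R : ℝ) (hM : ∀ k l, |T k l| ≤ M k l)
    (hsymm : ∀ k l, M k l = M l k) (hrow : ∀ k, ∑ l, M k l ≤ R) (b c : ι → ℝ) :
    |∑ k, ∑ l, b k * c l * T k l| ≤ R / 2 * (∑ k, b k ^ 2 + ∑ k, c k ^ 2) := by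
  have h1 : ∀ k l, |b k * c l * T k l| ≤ (b k ^ 2 * M k l + c l ^ 2 * M k l) / 2 := by
    intro k l
    rw [abs_mul, abs_mul]
    have h2 : |b k| * |c l| ≤ (b k ^ 2 + c l ^ 2) / 2 := by
      nlinarith [sq_nonneg (|b k| - |c l|), sq_abs (b k), sq_abs (c l)]
    calc |b k| * |c l| * |T k l| ≤ (b k ^ 2 + c l ^ 2) / 2 * M k l :=
          mul_le_mul h2 (hM k l) (abs_nonneg _) (by positivity)
      _ = _ := by ring
  calc |∑ k, ∑ l, b k * c l * T k l| ≤ ∑ k, ∑ l, |b k * c l * T k l| :=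
        (Finset.abs_sum_le_sum_abs _ _).trans
          (Finset.sum_le_sum fun k _ => Finset.abs_sum_le_sum_abs _ _)
    _ ≤ ∑ k, ∑ l, (b k ^ 2 * M k l + c l ^ 2 * M k l) / 2 :=
        Finset.sum_le_sum fun k _ => Finset.sum_le_sum fun l _ => h1 k l
    _ = (∑ k, b k ^ 2 * ∑ l, M k l + ∑ l, c l ^ 2 * ∑ k, M l k) / 2 := by
        simp only [← Finset.sum_div, Finset.sum_add_distrib, Finset.mul_sum]
        rw [Finset.sum_comm (f := fun k l => c l ^ 2 * M k l)]
        simp only [hsymm]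
    _ ≤ (∑ k, b k ^ 2 * R + ∑ l, c l ^ 2 * R) / 2 := by
        gcongr with k _ l _
        · exact hrow k
        · exact hrow l
    _ = _ := by rw [← Finset.sum_mul, ← Finset.sum_mul]; ring

/-- The second primitive is bounded by Schur's test, with the row sums of `1 / sin²`. -/
lemma abs_sinForm₂_le [DecidableEq ι] (h : Separated τ Δ) (hΔ : 0 < Δ) (hΔ1 : Δ ≤ 1) (f : ℝ)
    (b c : ι → ℝ) :
    |sinForm₂ τ f b c| ≤ ((Δ ^ 2)⁻¹ - 1) / 24 * (∑ k, b k ^ 2 + ∑ k, c k ^ 2) := by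
  have h1 := abs_sum_sum_le_of_row_sum_le
    (fun k l =>
      Real.sin (2 * Real.pi * (τ k - τ l) * f) / (4 * Real.sin (Real.pi * (τ k - τ l)) ^ 2))
    (fun k l => (Real.sin (Real.pi * (τ k - τ l)) ^ 2)⁻¹ / 4) (((Δ ^ 2)⁻¹ - 1) / 12)
    (by
      intro k l
      have h2 : |4 * Real.sin (Real.pi * (τ k - τ l)) ^ 2| = 4 * Real.sin (Real.pi * (τ k - τ l)) ^ 2 :=
        abs_of_nonneg (by positivity)
      rw [abs_div, h2, div_eq_mul_inv, mul_inv, div_eq_inv_mul]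
      have h3 := Real.abs_sin_le_one (2 * Real.pi * (τ k - τ l) * f)
      exact mul_le_of_le_one_left (by positivity) h3)
    (by
      intro k l
      have e2 : Real.pi * (τ k - τ l) = -(Real.pi * (τ l - τ k)) := by ring
      rw [e2, Real.sin_neg, neg_sq])
    (by
      intro k
      have h2 := h.sum_inv_sin_sq_le hΔ hΔ1 k
      have h3 : ∑ l, (Real.sin (Real.pi * (τ k - τ l)) ^ 2)⁻¹ =
          ∑ l ∈ Finset.univ.erase k, (Real.sin (Real.pi * (τ k - τ l)) ^ 2)⁻¹ := by
        symm
        apply Finset.sum_erase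
        simp
      rw [← Finset.sum_div, h3]
      linarith)
    b c
  rw [sinForm₂]
  linarith

/-- The triple angle formula turns the concavity of the sine into a cubic lower bound. -/
lemma three_mul_sub_le_sin {x : ℝ} (h0 : 0 ≤ x) (h1 : x ≤ 1 / 2) :
    3 * x - 4 * x ^ 3 ≤ Real.sin (Real.pi * x) := by
  have hpi := Real.pi_pos
  set s := Real.sin (Real.pi / 3 * x) with hs
  have e : Real.pi * x = 3 * (Real.pi / 3 * x) := by ring
  rw [e, Real.sin_three_mul, ← hs]
  have hup : s ≤ 1 / 2 := by
    rw [hs, ← Real.sin_pi_div_six]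
    apply Real.sin_le_sin_of_le_of_le_pi_div_two <;> nlinarith
  have hlow : x ≤ s := by
    have hc := strictConcaveOn_sin_Icc.concaveOn.2
      (show (0 : ℝ) ∈ Set.Icc 0 Real.pi from ⟨le_rfl, hpi.le⟩)
      (show Real.pi / 6 ∈ Set.Icc 0 Real.pi from ⟨by positivity, by linarith⟩)
      (show 0 ≤ 1 - 2 * x by linarith) (show 0 ≤ 2 * x by linarith) (by ring)
    simp only [smul_eq_mul, mul_zero, Real.sin_zero, zero_add, Real.sin_pi_div_six] at hc
    have e2 : 2 * x * (Real.pi / 6) = Real.pi / 3 * x := by ring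
    rw [e2] at hc
    linarith
  nlinarith [mul_nonneg (sub_nonneg.mpr hlow) (sub_nonneg.mpr hup),
    mul_nonneg h0 (sub_nonneg.mpr hlow),
    mul_nonneg h0 (sub_nonneg.mpr hup),
    mul_nonneg (sub_nonneg.mpr hlow) (show 0 ≤ 3 - 4 * (s ^ 2 + s * x + x ^ 2) by nlinarith)]

lemma Separated.sq_le_sin_sq (h : Separated τ Δ) (hΔ : 0 < Δ) (hΔ1 : Δ ≤ 1 / 2) {k l : ι}
    (hkl : k ≠ l) : (3 * Δ - 4 * Δ ^ 3) ^ 2 ≤ Real.sin (Real.pi * (τ k - τ l)) ^ 2 := by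
  have hpi := Real.pi_pos
  set x := τ k - τ l with hx
  set y := |x - round x| with hy
  have h1 : y ≤ 1 / 2 := abs_sub_round x
  have h2 : Δ ≤ y := by
    have := h k l hkl (-round x)
    rw [hy]
    push_cast at this
    rwa [← sub_eq_add_neg] at this
  have h3 : Real.sin (Real.pi * x) ^ 2 = Real.sin (Real.pi * y) ^ 2 := by
    have h4 : Real.sin (Real.pi * (x - round x)) ^ 2 = Real.sin (Real.pi * x) ^ 2 := by
      have : Real.pi * (x - round x) = Real.pi * x - round x * Real.pi := by ring
      rw [this, Real.sin_sub_int_mul_pi, mul_pow]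
      have : (((-1 : ℝ) ^ round x) ^ 2) = 1 := by
        rcases Int.even_or_odd (round x) with h5 | h5
        · rw [h5.neg_one_zpow, one_pow]
        · rw [h5.neg_one_zpow]; norm_num
      rw [this, one_mul]
    rw [← h4, hy]
    rcases abs_choice (x - round x) with h5 | h5 <;> rw [h5]
    rw [mul_neg, Real.sin_neg, neg_sq]
  rw [h3]
  have h5 := three_mul_sub_le_sin hΔ.le hΔ1
  have h6 : Real.sin (Real.pi * Δ) ≤ Real.sin (Real.pi * y) := by
    apply Real.sin_le_sin_of_le_of_le_pi_div_two <;> nlinarith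
  have h7 : 0 ≤ 3 * Δ - 4 * Δ ^ 3 := by
    nlinarith [mul_pos hΔ hΔ, mul_nonneg (mul_pos hΔ hΔ).le (sub_nonneg.mpr hΔ1)]
  exact pow_le_pow_left₀ h7 (h5.trans h6) 2

/-- The Cauchy–Schwarz inequality for a column of a matrix. -/
lemma abs_sum_sum_single_le [DecidableEq ι] (T : ι → ι → ℝ) (k : ι) (b : ι → ℝ) (R : ℝ)
    (hR : ∑ l, T l k ^ 2 ≤ R) :
    |∑ i, ∑ l, b i * (Pi.single k (1 : ℝ) : ι → ℝ) l * T i l| ≤ √(∑ i, b i ^ 2) * √R := by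
  have h1 : ∑ i, ∑ l, b i * (Pi.single k (1 : ℝ) : ι → ℝ) l * T i l = ∑ i, b i * T i k := by
    refine Finset.sum_congr rfl fun i _ => ?_
    rw [Finset.sum_eq_single k]
    · simp
    · intro l _ hl; simp [hl]
    · simp
  rw [h1, ← Real.sqrt_mul (by positivity)]
  apply Real.abs_le_sqrt
  exact (Finset.sum_mul_sq_le_sq_mul_sq _ _ _).trans
    (mul_le_mul_of_nonneg_left hR (by positivity))

/-- The sum over all `l`; the term `l = k` vanishes by the convention `0⁻¹ = 0`. -/
lemma Separated.sum_univ_inv_sin_sq_le [DecidableEq ι] (h : Separated τ Δ) (hΔ : 0 < Δ)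
    (hΔ1 : Δ ≤ 1) (k : ι) :
    ∑ l, (Real.sin (Real.pi * (τ l - τ k)) ^ 2)⁻¹ ≤ ((Δ ^ 2)⁻¹ - 1) / 3 := by
  refine le_trans (le_of_eq ?_) (h.sum_inv_sin_sq_le hΔ hΔ1 k)
  rw [← Finset.sum_erase Finset.univ (a := k) (by simp)]
  refine Finset.sum_congr rfl fun l _ => ?_
  have e2 : Real.pi * (τ l - τ k) = -(Real.pi * (τ k - τ l)) := by ring
  rw [e2, Real.sin_neg, neg_sq]

lemma abs_cosForm_single_le [DecidableEq ι] (h : Separated τ Δ) (hΔ : 0 < Δ) (hΔ1 : Δ ≤ 1) (f : ℝ)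
    (b : ι → ℝ) (k : ι) :
    |cosForm τ f b (Pi.single k 1)| ≤ √(∑ i, b i ^ 2) * √(((Δ ^ 2)⁻¹ - 1) / 12) := by
  refine abs_sum_sum_single_le _ k b _ ?_
  calc ∑ l, (Real.cos (2 * Real.pi * (τ l - τ k) * f) / (2 * Real.sin (Real.pi * (τ l - τ k)))) ^ 2
      ≤ ∑ l, (Real.sin (Real.pi * (τ l - τ k)) ^ 2)⁻¹ / 4 := by
        refine Finset.sum_le_sum fun l _ => ?_
        have h3 := Real.cos_sq_le_one (2 * Real.pi * (τ l - τ k) * f)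
        rw [div_pow, mul_pow, div_eq_mul_inv, mul_inv]
        calc _ ≤ 1 * ((2 ^ 2)⁻¹ * (Real.sin (Real.pi * (τ l - τ k)) ^ 2)⁻¹) := by gcongr
          _ = _ := by ring
    _ ≤ ((Δ ^ 2)⁻¹ - 1) / 12 := by
        have := h.sum_univ_inv_sin_sq_le hΔ hΔ1 k
        rw [← Finset.sum_div]
        linarith

lemma abs_sinForm₂_single_le [DecidableEq ι] (h : Separated τ Δ) (hΔ : 0 < Δ) (hΔ1 : Δ ≤ 1 / 2)
    (f : ℝ) (b : ι → ℝ) (k : ι) :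
    |sinForm₂ τ f b (Pi.single k 1)| ≤
      √(∑ i, b i ^ 2) * √(((Δ ^ 2)⁻¹ - 1) / 48 * ((3 * Δ - 4 * Δ ^ 3) ^ 2)⁻¹) := by
  refine abs_sum_sum_single_le _ k b _ ?_
  have hm : 0 < 3 * Δ - 4 * Δ ^ 3 := by nlinarith [mul_pos hΔ hΔ, mul_pos hΔ (mul_pos hΔ hΔ)]
  calc ∑ l, (Real.sin (2 * Real.pi * (τ l - τ k) * f) /
        (4 * Real.sin (Real.pi * (τ l - τ k)) ^ 2)) ^ 2
      ≤ ∑ l, (Real.sin (Real.pi * (τ l - τ k)) ^ 2)⁻¹ * (((3 * Δ - 4 * Δ ^ 3) ^ 2)⁻¹ / 16) := by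
        refine Finset.sum_le_sum fun l _ => ?_
        by_cases hl : l = k
        · subst hl; simp
        have h3 := Real.sin_sq_le_one (2 * Real.pi * (τ l - τ k) * f)
        have h4 : (Real.sin (Real.pi * (τ l - τ k)) ^ 2)⁻¹ ≤ ((3 * Δ - 4 * Δ ^ 3) ^ 2)⁻¹ :=
          inv_anti₀ (by positivity) (h.sq_le_sin_sq hΔ hΔ1 hl)
        rw [div_pow, mul_pow, div_eq_mul_inv, mul_inv, sq (Real.sin (Real.pi * (τ l - τ k)) ^ 2),
          mul_inv]
        calc _ ≤ 1 * ((4 ^ 2)⁻¹ * ((Real.sin (Real.pi * (τ l - τ k)) ^ 2)⁻¹ *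
              ((3 * Δ - 4 * Δ ^ 3) ^ 2)⁻¹)) := by gcongr
          _ = _ := by ring
    _ ≤ ((Δ ^ 2)⁻¹ - 1) / 48 * ((3 * Δ - 4 * Δ ^ 3) ^ 2)⁻¹ := by
        have := h.sum_univ_inv_sin_sq_le hΔ (by linarith) k
        rw [← Finset.sum_mul]
        calc _ ≤ ((Δ ^ 2)⁻¹ - 1) / 3 * (((3 * Δ - 4 * Δ ^ 3) ^ 2)⁻¹ / 16) := by gcongr
          _ = _ := by ring

end

/-! ### Functions of bounded variation on an interval -/

/-- The total variation of `u` on `[a, b]`, as a real number. -/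
noncomputable def intervalVar (u : ℝ → ℝ) (a b : ℝ) : ℝ := (eVariationOn u (Set.Icc a b)).toReal

/-- The total variation on the line of `u` restricted to `[a, b]` and extended by zero. -/
noncomputable def extVar (u : ℝ → ℝ) (a b : ℝ) : ℝ := |u a| + |u b| + intervalVar u a b

section variation
variable {u : ℝ → ℝ} {a b c : ℝ}

lemma intervalVar_nonneg : 0 ≤ intervalVar u a b := ENNReal.toReal_nonneg

lemma extVar_nonneg : 0 ≤ extVar u a b := by
  unfold extVar; have := intervalVar_nonneg (u := u) (a := a) (b := b); positivity

lemma intervalVar_add (hab : a ≤ b) (hbc : b ≤ c) (h : BoundedVariationOn u (Set.Icc a c)) :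
    intervalVar u a b + intervalVar u b c = intervalVar u a c := by
  have h1 := eVariationOn.Icc_add_Icc u (s := Set.univ) hab hbc (Set.mem_univ b)
  simp only [Set.univ_inter] at h1
  rw [intervalVar, intervalVar, intervalVar, ← h1, ENNReal.toReal_add]
  · exact h.mono (Set.Icc_subset_Icc_right hbc)
  · exact h.mono (Set.Icc_subset_Icc_left hab)

lemma abs_sub_le_intervalVar (hab : a ≤ b) (h : BoundedVariationOn u (Set.Icc a b)) :
    |u b - u a| ≤ intervalVar u a b := by
  have := h.dist_le (Set.right_mem_Icc.mpr hab) (Set.left_mem_Icc.mpr hab)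
  rwa [Real.dist_eq] at this

lemma abs_sub_le_intervalVar_of_mem (h : BoundedVariationOn u (Set.Icc a b)) {x y : ℝ}
    (hx : x ∈ Set.Icc a b) (hy : y ∈ Set.Icc a b) : |u x - u y| ≤ intervalVar u a b := by
  have := h.dist_le hx hy
  rwa [Real.dist_eq] at this

lemma boundedVariationOn_and_intervalVar_le {C : ℝ}
    (h : ∀ (n : ℕ) (t : ℕ → ℝ), Monotone t → (∀ i, t i ∈ Set.Icc a b) →
      ∑ i ∈ Finset.range n, |u (t (i + 1)) - u (t i)| ≤ C) :
    BoundedVariationOn u (Set.Icc a b) ∧ (0 ≤ C → intervalVar u a b ≤ C) := by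
  have h1 : eVariationOn u (Set.Icc a b) ≤ ENNReal.ofReal C := by
    refine iSup_le fun p => ?_
    have h2 := h p.1 p.2.1 p.2.2.1 p.2.2.2
    calc ∑ i ∈ Finset.range p.1, edist (u (p.2.1 (i + 1))) (u (p.2.1 i))
        = ENNReal.ofReal (∑ i ∈ Finset.range p.1, |u (p.2.1 (i + 1)) - u (p.2.1 i)|) := by
          rw [ENNReal.ofReal_sum_of_nonneg fun i _ => abs_nonneg _]
          exact Finset.sum_congr rfl fun i _ => by rw [edist_dist, Real.dist_eq]
      _ ≤ _ := ENNReal.ofReal_le_ofReal h2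
  exact ⟨(h1.trans_lt ENNReal.ofReal_lt_top).ne, fun hC => ENNReal.toReal_le_of_le_ofReal hC h1⟩

lemma sum_abs_sub_le_intervalVar (h : BoundedVariationOn u (Set.Icc a b)) (n : ℕ) {t : ℕ → ℝ}
    (ht : Monotone t) (hm : ∀ i, t i ∈ Set.Icc a b) :
    ∑ i ∈ Finset.range n, |u (t (i + 1)) - u (t i)| ≤ intervalVar u a b := by
  have h1 := eVariationOn.sum_le (f := u) (n := n) ht hm
  rw [intervalVar, ← ENNReal.ofReal_le_iff_le_toReal h]
  refine le_trans (le_of_eq ?_) h1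
  rw [ENNReal.ofReal_sum_of_nonneg fun i _ => abs_nonneg _]
  exact Finset.sum_congr rfl fun i _ => by rw [edist_dist, Real.dist_eq]

lemma sum_intervalVar {t : ℕ → ℝ} (ht : Monotone t) (n : ℕ)
    (h : BoundedVariationOn u (Set.Icc (t 0) (t n))) :
    ∑ i ∈ Finset.range n, intervalVar u (t i) (t (i + 1)) = intervalVar u (t 0) (t n) := by
  simp only [intervalVar]
  rw [← eVariationOn.sum' u ht, ENNReal.toReal_sum]
  intro i hi
  exact h.mono (Set.Icc_subset_Icc (ht (Nat.zero_le _)) (ht (Finset.mem_range.mp hi)))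

lemma intervalVar_comp_neg (u : ℝ → ℝ) (a b : ℝ) :
    eVariationOn (fun x => u (-x)) (Set.Icc (-b) (-a)) = eVariationOn u (Set.Icc a b) := by
  have h := eVariationOn.comp_eq_of_antitoneOn u (t := Set.Icc (-b) (-a)) (fun x => -x)
    (fun x _ y _ hxy => neg_le_neg hxy)
  have h2 : (fun x : ℝ => -x) '' Set.Icc (-b) (-a) = Set.Icc a b := by simp
  rw [h2] at h
  exact h

lemma intervalVar_sub_le {v : ℝ → ℝ} (hu : BoundedVariationOn u (Set.Icc a b))
    (hv : BoundedVariationOn v (Set.Icc a b)) :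
    BoundedVariationOn (fun x => u x - v x) (Set.Icc a b) ∧
      intervalVar (fun x => u x - v x) a b ≤ intervalVar u a b + intervalVar v a b := by
  have key := boundedVariationOn_and_intervalVar_le (u := fun x => u x - v x) (a := a) (b := b)
    (C := intervalVar u a b + intervalVar v a b) (by
      intro n t ht hm
      refine le_trans ?_ (add_le_add (sum_abs_sub_le_intervalVar hu n ht hm)
        (sum_abs_sub_le_intervalVar hv n ht hm))
      rw [← Finset.sum_add_distrib]
      refine Finset.sum_le_sum fun i _ => ?_
      have : u (t (i + 1)) - v (t (i + 1)) - (u (t i) - v (t i)) =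
        (u (t (i + 1)) - u (t i)) - (v (t (i + 1)) - v (t i)) := by ring
      rw [this]
      exact abs_sub _ _)
  exact ⟨key.1, key.2 (add_nonneg intervalVar_nonneg intervalVar_nonneg)⟩

/-- Multiplying by an increasing weight. -/
lemma intervalVar_mul_monotone_le {A : ℝ → ℝ} (hab : a ≤ b) (h : BoundedVariationOn u (Set.Icc a b))
    (hA : MonotoneOn A (Set.Icc a b)) (hA0 : 0 ≤ A a) :
    BoundedVariationOn (fun x => u x * A x) (Set.Icc a b) ∧
      intervalVar (fun x => u x * A x) a b + |u a| * A a ≤ A b * (intervalVar u a b + |u a|) := by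
  have ha : a ∈ Set.Icc a b := Set.left_mem_Icc.mpr hab
  have hb : b ∈ Set.Icc a b := Set.right_mem_Icc.mpr hab
  have hpos : ∀ x ∈ Set.Icc a b, 0 ≤ A x := fun x hx => hA0.trans (hA ha hx hx.1)
  have hsub : ∀ x ∈ Set.Icc a b, BoundedVariationOn u (Set.Icc a x) := fun x hx =>
    h.mono (Set.Icc_subset_Icc_right hx.2)
  have hstep : ∀ (n : ℕ) (t : ℕ → ℝ), Monotone t → (∀ i, t i ∈ Set.Icc a b) →
      ∑ i ∈ Finset.range n, |u (t (i + 1)) * A (t (i + 1)) - u (t i) * A (t i)| + |u a| * A a ≤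
        A (t n) * (intervalVar u a (t n) + |u a|) := by
    intro n t ht hm
    induction n with
    | zero =>
      rw [Finset.sum_range_zero, zero_add, mul_comm]
      have h1 := hA ha (hm 0) (hm 0).1
      have h2 := intervalVar_nonneg (u := u) (a := a) (b := t 0)
      have := hpos _ (hm 0)
      gcongr
      linarith
    | succ n ih =>
      rw [Finset.sum_range_succ]
      have hle := ht (Nat.le_succ n)
      have h1 := hA (hm n) (hm (n + 1)) hle
      have h2 := intervalVar_add (hm n).1 hle (hsub _ (hm (n + 1)))
      have h3 := abs_sub_le_intervalVar hle
        ((hsub _ (hm (n + 1))).mono (Set.Icc_subset_Icc_left (hm n).1))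
      have h4 : |u (t n)| ≤ intervalVar u a (t n) + |u a| := by
        have h5 := abs_sub_le_intervalVar (hm n).1 (hsub _ (hm n))
        have h6 := abs_add_le (u (t n) - u a) (u a)
        rw [sub_add_cancel] at h6
        linarith
      have h7 : |u (t (n + 1)) * A (t (n + 1)) - u (t n) * A (t n)| ≤
          A (t (n + 1)) * |u (t (n + 1)) - u (t n)| + |u (t n)| * (A (t (n + 1)) - A (t n)) := by
        have e : u (t (n + 1)) * A (t (n + 1)) - u (t n) * A (t n) =
          A (t (n + 1)) * (u (t (n + 1)) - u (t n)) + u (t n) * (A (t (n + 1)) - A (t n)) := by ring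
        rw [e]
        refine (abs_add_le _ _).trans ?_
        rw [abs_mul, abs_mul, abs_of_nonneg (hpos _ (hm (n + 1))), abs_of_nonneg (sub_nonneg.mpr h1)]
      have h8 := mul_le_mul_of_nonneg_left h3 (hpos _ (hm (n + 1)))
      have h9 := mul_le_mul_of_nonneg_right h4 (sub_nonneg.mpr h1)
      rw [← h2]
      nlinarith
  have key := boundedVariationOn_and_intervalVar_le (u := fun x => u x * A x) (a := a) (b := b)
    (C := A b * (intervalVar u a b + |u a|) - |u a| * A a) (by
      intro n t ht hm
      have h1 := hstep n t ht hm
      have h2 := hA (hm n) hb (hm n).2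
      have h3 := intervalVar_add (hm n).1 (hm n).2 h
      have h4 := intervalVar_nonneg (u := u) (a := t n) (b := b)
      have h5 := intervalVar_nonneg (u := u) (a := a) (b := t n)
      have h6 : A (t n) * (intervalVar u a (t n) + |u a|) ≤ A b * (intervalVar u a b + |u a|) := by
        have := hpos _ hb
        gcongr
        linarith
      linarith)
  refine ⟨key.1, ?_⟩
  have h1 := hstep 0 (fun _ => b) monotone_const (fun _ => hb)
  rw [Finset.sum_range_zero] at h1
  have := key.2 (by linarith)
  linarith

/-- Multiplying by a decreasing weight. -/
lemma intervalVar_mul_antitone_le {A : ℝ → ℝ} (hab : a ≤ b) (h : BoundedVariationOn u (Set.Icc a b))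
    (hA : AntitoneOn A (Set.Icc a b)) (hA0 : 0 ≤ A b) :
    BoundedVariationOn (fun x => u x * A x) (Set.Icc a b) ∧
      intervalVar (fun x => u x * A x) a b + |u b| * A b ≤ A a * (intervalVar u a b + |u b|) := by
  have h1 : BoundedVariationOn (fun x => u (-x)) (Set.Icc (-b) (-a)) := by
    rw [BoundedVariationOn, intervalVar_comp_neg]; exact h
  have h2 := intervalVar_mul_monotone_le (u := fun x => u (-x)) (A := fun x => A (-x))
    (neg_le_neg hab) h1
    (fun x hx y hy hxy => hA ⟨by linarith [hy.2], by linarith [hy.1]⟩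
      ⟨by linarith [hx.2], by linarith [hx.1]⟩ (neg_le_neg hxy)) (by simpa using hA0)
  have h3 := intervalVar_comp_neg (fun x => u x * A x) a b
  rw [BoundedVariationOn, intervalVar, intervalVar, h3, intervalVar_comp_neg] at h2
  simpa [BoundedVariationOn, intervalVar] using h2

/-- The function, extended by zero, rises to `u x` and falls back to zero. -/
lemma abs_le_half_extVar (h : BoundedVariationOn u (Set.Icc a b)) {x : ℝ} (hx : x ∈ Set.Icc a b) :
    |u x| ≤ extVar u a b / 2 := by
  have h1 := abs_sub_le_intervalVar hx.1 (h.mono (Set.Icc_subset_Icc_right hx.2))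
  have h2 := abs_sub_le_intervalVar hx.2 (h.mono (Set.Icc_subset_Icc_left hx.1))
  have h3 := intervalVar_add hx.1 hx.2 h
  have h4 := abs_add_le (u x - u a) (u a)
  have h5 := abs_sub (u b) (u b - u x)
  rw [sub_add_cancel] at h4
  rw [sub_sub_cancel] at h5
  unfold extVar
  linarith

lemma intervalVar_even (hu : ∀ x, u (-x) = u x) : intervalVar u (-b) 0 = intervalVar u 0 b := by
  have h := intervalVar_comp_neg u 0 b
  simp only [hu, neg_zero] at h
  rw [intervalVar, intervalVar, h]

lemma extVar_even (hu : ∀ x, u (-x) = u x) (hb : 0 ≤ b)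
    (h : BoundedVariationOn u (Set.Icc (-b) b)) :
    extVar u (-b) b = 2 * (|u b| + intervalVar u 0 b) := by
  rw [extVar, ← intervalVar_add (by linarith : -b ≤ 0) hb h, intervalVar_even hu, hu]
  ring

lemma boundedVariationOn_even (hu : ∀ x, u (-x) = u x) (hb : 0 ≤ b)
    (h : BoundedVariationOn u (Set.Icc 0 b)) : BoundedVariationOn u (Set.Icc (-b) b) := by
  have h1 := eVariationOn.Icc_add_Icc u (s := Set.univ) (by linarith : -b ≤ 0) hb (Set.mem_univ _)
  simp only [Set.univ_inter] at h1
  have h2 := intervalVar_comp_neg u 0 b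
  simp only [hu, neg_zero] at h2
  rw [BoundedVariationOn, ← h1, h2]
  exact ENNReal.add_ne_top.mpr ⟨h, h⟩

end variation

/-- Partial integration against a function of bounded variation, for a smooth function `g` bounded
by `B`: the boundary terms are those of a Stieltjes integral `∫ g du`. -/
lemma abs_integral_mul_deriv_sub_le {u g g' : ℝ → ℝ} {a b B : ℝ} (hab : a ≤ b)
    (hu : BoundedVariationOn u (Set.Icc a b)) (huc : ContinuousOn u (Set.Icc a b))
    (hg : ∀ x, HasDerivAt g (g' x) x) (hg' : Continuous g') (hB : ∀ x ∈ Set.Icc a b, |g x| ≤ B) :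
    |(∫ x in a..b, u x * g' x) - u b * g b + u a * g a| ≤ B * intervalVar u a b := by
  obtain ⟨C, hC⟩ := (isCompact_Icc (a := a) (b := b)).exists_bound_of_continuousOn hg'.continuousOn
  have hC0 : 0 ≤ C := (norm_nonneg _).trans (hC a (Set.left_mem_Icc.mpr hab))
  -- a piece of the partition
  have hpiece : ∀ x y, a ≤ x → x ≤ y → y ≤ b →
      |(∫ s in x..y, u s * g' s) - u y * g y + u x * g x| ≤
        intervalVar u x y * (B + C * (y - x)) := by
    intro x y hx hxy hy
    have hsub : Set.Icc x y ⊆ Set.Icc a b := Set.Icc_subset_Icc hx hy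
    have huxy := hu.mono hsub
    have hci : ContinuousOn u (Set.uIcc x y) := by
      rw [Set.uIcc_of_le hxy]; exact huc.mono hsub
    have hi1 : IntervalIntegrable (fun s => u s * g' s) volume x y :=
      (hci.mul hg'.continuousOn).intervalIntegrable
    have hi2 : IntervalIntegrable (fun s => u y * g' s) volume x y :=
      (continuousOn_const.mul hg'.continuousOn).intervalIntegrable
    have h1 : ∫ s in x..y, g' s = g y - g x :=
      intervalIntegral.integral_eq_sub_of_hasDerivAt (fun s _ => hg s)
        (hg'.intervalIntegrable _ _)
    have h2 : (∫ s in x..y, u s * g' s) - u y * g y + u x * g x =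
        (∫ s in x..y, (u s - u y) * g' s) - (u y - u x) * g x := by
      have : ∫ s in x..y, (u s - u y) * g' s =
          (∫ s in x..y, u s * g' s) - u y * (g y - g x) := by
        simp only [sub_mul]
        rw [intervalIntegral.integral_sub hi1 hi2, intervalIntegral.integral_const_mul, h1]
      rw [this]; ring
    have h3 : |∫ s in x..y, (u s - u y) * g' s| ≤ intervalVar u x y * C * |y - x| := by
      rw [← Real.norm_eq_abs]
      refine intervalIntegral.norm_integral_le_of_norm_le_const fun s hs => ?_
      rw [Set.uIoc_of_le hxy] at hs
      rw [norm_mul]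
      refine mul_le_mul ?_ (hC s (hsub ⟨hs.1.le, hs.2⟩)) (norm_nonneg _) intervalVar_nonneg
      exact abs_sub_le_intervalVar_of_mem huxy ⟨hs.1.le, hs.2⟩ (Set.right_mem_Icc.mpr hxy)
    have h4 : |(u y - u x) * g x| ≤ intervalVar u x y * B := by
      rw [abs_mul]
      exact mul_le_mul (abs_sub_le_intervalVar hxy huxy) (hB x ⟨hx, hxy.trans hy⟩) (abs_nonneg _)
        intervalVar_nonneg
    rw [h2]
    rw [abs_of_nonneg (sub_nonneg.mpr hxy)] at h3
    calc _ ≤ _ := abs_sub _ _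
      _ ≤ intervalVar u x y * C * (y - x) + intervalVar u x y * B := add_le_add h3 h4
      _ = _ := by ring
  -- refine the partition
  have hn : ∀ n : ℕ, |(∫ x in a..b, u x * g' x) - u b * g b + u a * g a| ≤
      intervalVar u a b * (B + C * ((b - a) / ((n : ℝ) + 1))) := by
    intro n
    set t : ℕ → ℝ := fun i => a + i * ((b - a) / ((n : ℝ) + 1)) with ht
    have hd : 0 ≤ (b - a) / ((n : ℝ) + 1) := div_nonneg (sub_nonneg.mpr hab) (by positivity)
    have hmono : Monotone t := by
      intro i j hij
      have : (i : ℝ) ≤ j := by exact_mod_cast hij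
      simp only [ht]
      gcongr
    have ht0 : t 0 = a := by simp [ht]
    have htn : t (n + 1) = b := by simp only [ht]; push_cast; field_simp; ring
    have hlow : ∀ i, a ≤ t i := fun i => ht0 ▸ hmono (Nat.zero_le i)
    have hup : ∀ i ≤ n + 1, t i ≤ b := fun i hi => htn ▸ hmono hi
    have hstep : ∀ i, t (i + 1) - t i = (b - a) / ((n : ℝ) + 1) := by
      intro i; simp only [ht]; push_cast; ring
    have hint : ∑ i ∈ Finset.range (n + 1), ∫ x in t i..t (i + 1), u x * g' x =
        ∫ x in a..b, u x * g' x := by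
      rw [intervalIntegral.sum_integral_adjacent_intervals, ht0, htn]
      intro i hi
      refine ContinuousOn.intervalIntegrable (ContinuousOn.mul (huc.mono ?_) hg'.continuousOn)
      rw [Set.uIcc_of_le (hmono (Nat.le_succ i))]
      exact Set.Icc_subset_Icc (hlow i) (hup _ hi)
    have htel : ∑ i ∈ Finset.range (n + 1), (u (t (i + 1)) * g (t (i + 1)) - u (t i) * g (t i)) =
        u b * g b - u a * g a := by
      rw [Finset.sum_range_sub (fun i => u (t i) * g (t i)), ht0, htn]
    have e : (∫ x in a..b, u x * g' x) - u b * g b + u a * g a =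
        ∑ i ∈ Finset.range (n + 1), ((∫ x in t i..t (i + 1), u x * g' x) -
          u (t (i + 1)) * g (t (i + 1)) + u (t i) * g (t i)) := by
      simp only [sub_add, Finset.sum_sub_distrib] at htel ⊢
      rw [hint, htel]
    rw [e]
    refine (Finset.abs_sum_le_sum_abs _ _).trans ?_
    have hvar := sum_intervalVar hmono (n + 1) (u := u) (by rw [ht0, htn]; exact hu)
    rw [ht0, htn] at hvar
    rw [← hvar, Finset.sum_mul]
    refine Finset.sum_le_sum fun i hi => ?_
    have := hpiece (t i) (t (i + 1)) (hlow i) (hmono (Nat.le_succ i))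
      (hup _ (Finset.mem_range.mp hi))
    rwa [hstep] at this
  have hlim : Tendsto (fun n : ℕ => intervalVar u a b * (B + C * ((b - a) / ((n : ℝ) + 1))))
      atTop (𝓝 (intervalVar u a b * (B + C * 0))) := by
    refine Tendsto.const_mul _ (Tendsto.const_add _ (Tendsto.const_mul _ ?_))
    have h := tendsto_one_div_add_atTop_nhds_zero_nat.const_mul (b - a)
    simpa [div_eq_mul_inv] using h
  have := ge_of_tendsto' hlim hn
  linarith

/-- Summation by parts of a function `u` of bounded variation against a family of kernels, one for
each cell between consecutive nodes `a + n`: the jumps of the kernels at the nodes and the integrals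
of their derivatives in the cells are controlled by the size of the kernels. -/
lemma abs_sum_jump_add_integral_le {u : ℝ → ℝ} {a B : ℝ} (M : ℕ) {k k' : ℕ → ℝ → ℝ}
    (hu : BoundedVariationOn u (Set.Icc a (a + M))) (huc : ContinuousOn u (Set.Icc a (a + M)))
    (hk : ∀ n x, HasDerivAt (k n) (k' n x) x) (hk' : ∀ n, Continuous (k' n))
    (hfirst : |k 0 a| ≤ B) (hlast : |k (M + 1) (a + M)| ≤ B)
    (hB : ∀ n < M, ∀ x ∈ Set.Icc (a + n) (a + (n + 1 : ℕ)), |k (n + 1) x| ≤ B) :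
    |∑ n ∈ Finset.range (M + 1), u (a + n) * (k (n + 1) (a + n) - k n (a + n)) +
      ∑ n ∈ Finset.range M, ∫ x in (a + n)..(a + (n + 1 : ℕ)), u x * k' (n + 1) x| ≤
      B * extVar u a (a + M) := by
  have hmono : Monotone fun n : ℕ => a + (n : ℝ) := fun i j hij => by
    have : (i : ℝ) ≤ j := by exact_mod_cast hij
    simp only; linarith
  have hid : ∑ n ∈ Finset.range (M + 1), u (a + n) * (k (n + 1) (a + n) - k n (a + n)) =
      u (a + M) * k (M + 1) (a + M) - u a * k 0 a +
      ∑ n ∈ Finset.range M, (u (a + n) * k (n + 1) (a + n) -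
        u (a + (n + 1 : ℕ)) * k (n + 1) (a + (n + 1 : ℕ))) := by
    simp only [mul_sub, Finset.sum_sub_distrib]
    rw [Finset.sum_range_succ, Finset.sum_range_succ']
    simp only [Nat.cast_zero, add_zero]
    ring
  have hid2 : ∑ n ∈ Finset.range (M + 1), u (a + n) * (k (n + 1) (a + n) - k n (a + n)) +
      ∑ n ∈ Finset.range M, ∫ x in (a + n)..(a + (n + 1 : ℕ)), u x * k' (n + 1) x =
      (u (a + M) * k (M + 1) (a + M) - u a * k 0 a) +
      ∑ n ∈ Finset.range M, ((∫ x in (a + n)..(a + (n + 1 : ℕ)), u x * k' (n + 1) x) -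
        u (a + (n + 1 : ℕ)) * k (n + 1) (a + (n + 1 : ℕ)) + u (a + n) * k (n + 1) (a + n)) := by
    rw [hid]
    simp only [Finset.sum_add_distrib, Finset.sum_sub_distrib]
    ring
  rw [hid2]
  have h1 : |u (a + M) * k (M + 1) (a + M) - u a * k 0 a| ≤ B * (|u a| + |u (a + M)|) := by
    refine (abs_sub _ _).trans ?_
    rw [abs_mul, abs_mul]
    have h2 := mul_le_mul_of_nonneg_left hlast (abs_nonneg (u (a + M)))
    have h3 := mul_le_mul_of_nonneg_left hfirst (abs_nonneg (u a))
    linarith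
  have hcell : ∀ n ∈ Finset.range M, Set.Icc (a + (n : ℝ)) (a + (n + 1 : ℕ)) ⊆
      Set.Icc a (a + M) := fun n hn => by
    have h2 : a + ((0 : ℕ) : ℝ) ≤ a + (n : ℝ) := hmono (Nat.zero_le n)
    have h3 : a + ((n + 1 : ℕ) : ℝ) ≤ a + (M : ℝ) := hmono (Finset.mem_range.mp hn)
    exact Set.Icc_subset_Icc (by simpa using h2) h3
  have h2 : |∑ n ∈ Finset.range M, ((∫ x in (a + n)..(a + (n + 1 : ℕ)), u x * k' (n + 1) x) -
        u (a + (n + 1 : ℕ)) * k (n + 1) (a + (n + 1 : ℕ)) + u (a + n) * k (n + 1) (a + n))| ≤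
      B * intervalVar u a (a + M) := by
    refine (Finset.abs_sum_le_sum_abs _ _).trans ?_
    have hvar := sum_intervalVar hmono M (u := u) (by simp [hu])
    simp only [Nat.cast_zero, add_zero] at hvar
    rw [← hvar, Finset.mul_sum]
    refine Finset.sum_le_sum fun n hn => ?_
    exact abs_integral_mul_deriv_sub_le (hmono (Nat.le_succ n)) (hu.mono (hcell n hn))
      (huc.mono (hcell n hn)) (hk (n + 1)) (hk' (n + 1)) (hB n (Finset.mem_range.mp hn))
  refine (abs_add_le _ _).trans ?_
  unfold extVar
  linarith

/-! ### Pairs of spectral densities in the band -/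

/-- A pair of even densities `p`, `q = (s f)² p` of total mass one on `[-M/2, M/2]`, whose
variations on the line, after extension by zero, are at most `ρ`. For a pulse `g` these are the
normalized energy spectra of `g` and of its derivative. -/
structure FlatPair (M : ℕ) (p q : ℝ → ℝ) (s ρ : ℝ) : Prop where
  s_pos : 0 < s
  cont : Continuous p
  nonneg : ∀ f, 0 ≤ p f
  even : ∀ f, p (-f) = p f
  eq_mul : ∀ f, q f = (s * f) ^ 2 * p f
  integral_p : ∫ f in (-((M : ℝ) / 2))..((M : ℝ) / 2), p f = 1
  integral_q : ∫ f in (-((M : ℝ) / 2))..((M : ℝ) / 2), q f = 1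
  bv_p : BoundedVariationOn p (Set.Icc (-((M : ℝ) / 2)) ((M : ℝ) / 2))
  bv_q : BoundedVariationOn q (Set.Icc (-((M : ℝ) / 2)) ((M : ℝ) / 2))
  extVar_p : extVar p (-((M : ℝ) / 2)) ((M : ℝ) / 2) ≤ ρ
  extVar_q : extVar q (-((M : ℝ) / 2)) ((M : ℝ) / 2) ≤ ρ

/-- The `n`-th sampled frequency. -/
noncomputable def node (M n : ℕ) : ℝ := -((M : ℝ) / 2) + n

/-- The center of the `n`-th cell; the `n`-th node separates the cells `n` and `n + 1`. -/
noncomputable def cellMid (M n : ℕ) : ℝ := node M n - 1 / 2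

lemma cellMid_succ (M n : ℕ) : cellMid M (n + 1) = node M n + 1 / 2 := by
  simp only [cellMid, node]; push_cast; ring

lemma node_zero (M : ℕ) : node M 0 = -((M : ℝ) / 2) := by simp [node]

lemma node_last (M : ℕ) : node M M = (M : ℝ) / 2 := by simp only [node]; ring

/-- The cells between consecutive nodes make up the band. -/
lemma sum_integral_cells {M : ℕ} {u : ℝ → ℝ} (hu : Continuous u) :
    ∑ n ∈ Finset.range M, ∫ x in (node M n)..(node M (n + 1)), u x =
      ∫ x in (-((M : ℝ) / 2))..((M : ℝ) / 2), u x := by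
  rw [intervalIntegral.sum_integral_adjacent_intervals fun i _ => hu.intervalIntegrable _ _,
    node_zero, node_last]

/-- Summation by parts against a family of kernels, in terms of nodes and cells. -/
lemma abs_sum_jump_add_integral_le' {u : ℝ → ℝ} {B : ℝ} (M : ℕ) {k k' : ℕ → ℝ → ℝ}
    (hu : BoundedVariationOn u (Set.Icc (-((M : ℝ) / 2)) ((M : ℝ) / 2))) (huc : Continuous u)
    (hk : ∀ n x, HasDerivAt (k n) (k' n x) x) (hk' : ∀ n, Continuous (k' n))
    (hB : ∀ n x, |cellMid M n - x| ≤ 1 / 2 → |k n x| ≤ B) :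
    |∑ n ∈ Finset.range (M + 1), u (node M n) * (k (n + 1) (node M n) - k n (node M n)) +
      ∑ n ∈ Finset.range M, ∫ x in (node M n)..(node M (n + 1)), u x * k' (n + 1) x| ≤
      B * extVar u (-((M : ℝ) / 2)) ((M : ℝ) / 2) := by
  have e : -((M : ℝ) / 2) + (M : ℝ) = (M : ℝ) / 2 := by ring
  have h := abs_sum_jump_add_integral_le (u := u) (a := -((M : ℝ) / 2)) (B := B) M (k := k)
    (k' := k') (by rwa [e]) huc.continuousOn hk hk'
    (hB _ _ (by
      rw [cellMid, node_zero]
      rw [abs_le]; constructor <;> linarith))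
    (hB _ _ (by
      rw [e, cellMid_succ, node_last]
      rw [abs_le]; constructor <;> linarith))
    (by
      intro n _ x hx
      refine hB _ _ ?_
      rw [cellMid_succ, node, abs_le]
      push_cast at hx
      constructor <;> linarith [hx.1, hx.2])
  rw [e] at h
  exact h

section kernels
variable {ι : Type*} [Fintype ι] [DecidableEq ι] {τ : ι → ℝ} {Δ : ℝ}

/-- Sampling against a trigonometric form: the sums of `θ |∑ v_k e^{-2πiτ_k f}|² - 2 η S(f)`, for
the sine sum `S` of `b` and `c`, against `u` at the nodes, compared with the integral of `u`. -/
lemma abs_sum_form_sub_le (h : Separated τ Δ) (hΔ : 0 < Δ) (M : ℕ) {u η η' : ℝ → ℝ}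
    (hu : BoundedVariationOn u (Set.Icc (-((M : ℝ) / 2)) ((M : ℝ) / 2))) (huc : Continuous u)
    (hη : ∀ x, HasDerivAt η (η' x) x) (hη' : Continuous η') (θ : ℝ) (v b c : ι → ℝ) {B : ℝ}
    (hB : ∀ μ x, |μ - x| ≤ 1 / 2 →
      |θ * (sinForm τ μ v + (μ - x) * ∑ k, v k ^ 2) + 2 * η x * cosForm τ μ b c| ≤ B) :
    |∑ n ∈ Finset.range (M + 1), u (node M n) *
        (θ * cosSum τ (node M n) v v - 2 * η (node M n) * sinSum τ (node M n) b c) -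
      θ * (∑ k, v k ^ 2) * (∫ x in (-((M : ℝ) / 2))..((M : ℝ) / 2), u x) +
      2 * ∑ n ∈ Finset.range M, ∫ x in (node M n)..(node M (n + 1)),
        (u x * η' x) * cosForm τ (cellMid M (n + 1)) b c| ≤
      B * extVar u (-((M : ℝ) / 2)) ((M : ℝ) / 2) := by
  have key := abs_sum_jump_add_integral_le' (u := u) (B := B) M
    (k := fun n x => θ * (sinForm τ (cellMid M n) v + (cellMid M n - x) * ∑ k, v k ^ 2) +
      2 * η x * cosForm τ (cellMid M n) b c)
    (k' := fun n x => θ * (-1 * ∑ k, v k ^ 2) + 2 * η' x * cosForm τ (cellMid M n) b c)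
    hu huc
    (fun n x => by
      refine HasDerivAt.add (HasDerivAt.const_mul _ (HasDerivAt.const_add _
        (HasDerivAt.mul_const ?_ _))) (((hη x).const_mul 2).mul_const _)
      simpa using (hasDerivAt_id x).const_sub (cellMid M n))
    (fun n => by fun_prop) (fun n x hx => hB _ _ hx)
  refine le_trans (le_of_eq ?_) key
  congr 1
  have h1 : ∀ n ∈ Finset.range (M + 1), u (node M n) *
        (θ * cosSum τ (node M n) v v - 2 * η (node M n) * sinSum τ (node M n) b c) =
      u (node M n) * ((θ * (sinForm τ (cellMid M (n + 1)) v +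
          (cellMid M (n + 1) - node M n) * ∑ k, v k ^ 2) +
          2 * η (node M n) * cosForm τ (cellMid M (n + 1)) b c) -
        (θ * (sinForm τ (cellMid M n) v + (cellMid M n - node M n) * ∑ k, v k ^ 2) +
          2 * η (node M n) * cosForm τ (cellMid M n) b c)) := by
    intro n _
    have e1 := sinForm_add_half_sub h hΔ (node M n) v
    have e2 := cosForm_add_half_sub h hΔ (node M n) b c
    rw [cellMid_succ, cellMid]
    linear_combination (-u (node M n) * θ) * e1 - (u (node M n) * 2 * η (node M n)) * e2
  have h2 : ∀ n ∈ Finset.range M, ∫ x in (node M n)..(node M (n + 1)),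
      u x * (θ * (-1 * ∑ k, v k ^ 2) + 2 * η' x * cosForm τ (cellMid M (n + 1)) b c) =
      -(θ * ∑ k, v k ^ 2) * (∫ x in (node M n)..(node M (n + 1)), u x) +
        2 * ∫ x in (node M n)..(node M (n + 1)),
          (u x * η' x) * cosForm τ (cellMid M (n + 1)) b c := by
    intro n _
    rw [← intervalIntegral.integral_const_mul, ← intervalIntegral.integral_const_mul,
      ← intervalIntegral.integral_add]
    · refine intervalIntegral.integral_congr fun x _ => ?_
      ring
    · exact (huc.const_mul _).intervalIntegrable _ _
    · exact ((huc.mul hη').mul continuous_const |>.const_mul _).intervalIntegrable _ _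
  rw [Finset.sum_congr rfl h1, Finset.sum_congr rfl h2, Finset.sum_add_distrib,
    ← Finset.mul_sum, ← Finset.mul_sum, sum_integral_cells huc]
  ring

/-- The integral of a function of bounded variation against the piecewise constant kernel
`cosForm`, which has the piecewise linear interpolation of `sinForm₂` as a continuous primitive. -/
lemma abs_sum_integral_cosForm_le (h : Separated τ Δ) (hΔ : 0 < Δ) (M : ℕ) {u : ℝ → ℝ}
    (hu : BoundedVariationOn u (Set.Icc (-((M : ℝ) / 2)) ((M : ℝ) / 2))) (huc : Continuous u)
    (b c : ι → ℝ) {R : ℝ} (hR : ∀ f, |sinForm₂ τ f b c| ≤ R) :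
    |∑ n ∈ Finset.range M, ∫ x in (node M n)..(node M (n + 1)),
        u x * cosForm τ (cellMid M (n + 1)) b c| ≤
      R * extVar u (-((M : ℝ) / 2)) ((M : ℝ) / 2) := by
  have hY : ∀ m, sinForm₂ τ (cellMid M m + 1 / 2) b c - sinForm₂ τ (cellMid M m - 1 / 2) b c =
      cosForm τ (cellMid M m) b c := fun m => sinForm₂_add_half_sub h hΔ _ b c
  have key := abs_sum_jump_add_integral_le' (u := u) (B := R) M
    (k := fun n x => sinForm₂ τ (cellMid M n - 1 / 2) b c +
      (x - (cellMid M n - 1 / 2)) * cosForm τ (cellMid M n) b c)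
    (k' := fun n _ => 1 * cosForm τ (cellMid M n) b c) hu huc
    (fun n x => by
      refine HasDerivAt.const_add _ (HasDerivAt.mul_const ?_ _)
      simpa using (hasDerivAt_id x).sub_const (cellMid M n - 1 / 2))
    (fun n => by fun_prop)
    (fun n x hx => by
      rw [abs_le] at hx
      have e : sinForm₂ τ (cellMid M n - 1 / 2) b c +
          (x - (cellMid M n - 1 / 2)) * cosForm τ (cellMid M n) b c =
          (1 / 2 + (cellMid M n - x)) * sinForm₂ τ (cellMid M n - 1 / 2) b c +
            (1 / 2 - (cellMid M n - x)) * sinForm₂ τ (cellMid M n + 1 / 2) b c := by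
        rw [← hY]; ring
      rw [e]
      refine (abs_add_le _ _).trans ?_
      rw [abs_mul, abs_mul, abs_of_nonneg (by linarith [hx.1] : (0 : ℝ) ≤ 1 / 2 + (cellMid M n - x)),
        abs_of_nonneg (by linarith [hx.2] : (0 : ℝ) ≤ 1 / 2 - (cellMid M n - x))]
      have h1 := hR (cellMid M n - 1 / 2)
      have h2 := hR (cellMid M n + 1 / 2)
      nlinarith [hx.1, hx.2])
  refine le_trans (le_of_eq ?_) key
  congr 1
  have h1 : ∀ n ∈ Finset.range (M + 1), u (node M n) *
      ((sinForm₂ τ (cellMid M (n + 1) - 1 / 2) b c +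
        (node M n - (cellMid M (n + 1) - 1 / 2)) * cosForm τ (cellMid M (n + 1)) b c) -
      (sinForm₂ τ (cellMid M n - 1 / 2) b c +
        (node M n - (cellMid M n - 1 / 2)) * cosForm τ (cellMid M n) b c)) = 0 := by
    intro n _
    have e1 : cellMid M (n + 1) - 1 / 2 = cellMid M n + 1 / 2 := by
      rw [cellMid_succ, cellMid]; ring
    have e2 : node M n = cellMid M n + 1 / 2 := by rw [cellMid]; ring
    rw [e1, e2]
    linear_combination u (cellMid M n + 1 / 2) * hY n
  rw [Finset.sum_congr rfl h1, Finset.sum_const_zero, zero_add]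
  simp only [one_mul]

end kernels

namespace FlatPair
variable {M : ℕ} {p q : ℝ → ℝ} {s ρ : ℝ}

lemma cont_q (H : FlatPair M p q s ρ) : Continuous q := by
  have : q = fun f => (s * f) ^ 2 * p f := funext H.eq_mul
  rw [this]
  have := H.cont
  fun_prop

lemma even_q (H : FlatPair M p q s ρ) (f : ℝ) : q (-f) = q f := by
  rw [H.eq_mul, H.eq_mul, H.even]; ring

lemma q_nonneg (H : FlatPair M p q s ρ) (f : ℝ) : 0 ≤ q f := by
  rw [H.eq_mul]; exact mul_nonneg (sq_nonneg _) (H.nonneg f)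

lemma half_nonneg (M : ℕ) : (0 : ℝ) ≤ (M : ℝ) / 2 := by positivity

lemma p_le (H : FlatPair M p q s ρ) {f : ℝ}
    (hf : f ∈ Set.Icc (-((M : ℝ) / 2)) ((M : ℝ) / 2)) : p f ≤ ρ / 2 := by
  have h1 := abs_le_half_extVar H.bv_p hf
  rw [abs_of_nonneg (H.nonneg f)] at h1
  linarith [H.extVar_p]

lemma rho_nonneg (H : FlatPair M p q s ρ) : 0 ≤ ρ := extVar_nonneg.trans H.extVar_p

/-- As `q` vanishes at the center of the band, each half of the band carries half of its
variation. -/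
lemma q_le (H : FlatPair M p q s ρ) {f : ℝ} (h0 : 0 ≤ f) (hf : f ≤ (M : ℝ) / 2) : q f ≤ ρ / 4 := by
  have hM := half_nonneg M
  have hbv : BoundedVariationOn q (Set.Icc 0 ((M : ℝ) / 2)) :=
    H.bv_q.mono (Set.Icc_subset_Icc_left (by linarith))
  have h1 := abs_sub_le_intervalVar h0 (hbv.mono (Set.Icc_subset_Icc_right hf))
  have h2 := abs_sub_le_intervalVar hf (hbv.mono (Set.Icc_subset_Icc_left h0))
  have h3 := intervalVar_add h0 hf hbv
  have h4 := extVar_even H.even_q hM H.bv_q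
  have h5 := H.extVar_q
  have h6 : q 0 = 0 := by rw [H.eq_mul]; simp
  rw [h6, sub_zero, abs_of_nonneg (H.q_nonneg f)] at h1
  rw [abs_of_nonneg (H.q_nonneg _)] at h4
  have h7 := abs_le.mp h2
  linarith [h7.1]

/-- The frequency scale `s` is at most a multiple of `ρ`: neither density can concentrate. The
densities are tested with `9 p - q = (9 - (s f)²) p`; `p ≤ ρ / 2` is used for `s f ≤ 7 / 10`, and
`q ≤ ρ / 4` beyond. -/
lemma s_le (H : FlatPair M p q s ρ) : s ≤ 1.2456 * ρ := by
  have hM := half_nonneg M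
  have hs := H.s_pos
  have hρ := H.rho_nonneg
  set h : ℝ := (M : ℝ) / 2 with hh
  have hpc := H.cont
  have hqc := H.cont_q
  set F : ℝ → ℝ := fun f => 9 * p f - q f with hF
  have hFc : Continuous F := by fun_prop
  have htot : ∫ f in (-h)..h, F f = 8 := by
    rw [intervalIntegral.integral_sub ((hpc.const_mul 9).intervalIntegrable _ _)
      (hqc.intervalIntegrable _ _), intervalIntegral.integral_const_mul, H.integral_p,
      H.integral_q]
    norm_num
  have hhalf : ∫ f in (0 : ℝ)..h, F f = 4 := by
    have h1 : ∫ f in (-h)..0, F f = ∫ f in (0 : ℝ)..h, F f := by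
      have h2 := intervalIntegral.integral_comp_neg (a := 0) (b := h) F
      rw [neg_zero] at h2
      rw [← h2]
      refine intervalIntegral.integral_congr fun f _ => ?_
      simp only [hF, H.even, H.even_q]
    have h2 := intervalIntegral.integral_add_adjacent_intervals
      (hFc.intervalIntegrable (μ := volume) (-h) 0) (hFc.intervalIntegrable 0 h)
    linarith
  set c₁ := min h (0.7 / s) with hc₁
  set c₂ := min h (3 / s) with hc₂
  have hc₁0 : 0 ≤ c₁ := le_min hM (by positivity)
  have hc₁₂ : c₁ ≤ c₂ := min_le_min_left _ (by gcongr; norm_num)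
  have hc₂h : c₂ ≤ h := min_le_left _ _
  have hsplit : ∫ f in (0 : ℝ)..h, F f =
      (∫ f in (0 : ℝ)..c₁, F f) + (∫ f in c₁..c₂, F f) + ∫ f in c₂..h, F f := by
    rw [intervalIntegral.integral_add_adjacent_intervals (hFc.intervalIntegrable _ _)
      (hFc.intervalIntegrable _ _), intervalIntegral.integral_add_adjacent_intervals
      (hFc.intervalIntegrable _ _) (hFc.intervalIntegrable _ _)]
  have hFeq : ∀ f, F f = (9 - (s * f) ^ 2) * p f := fun f => by
    simp only [hF, H.eq_mul]; ring
  have hI₃ : ∫ f in c₂..h, F f ≤ 0 := by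
    rw [intervalIntegral.integral_of_le hc₂h]
    refine setIntegral_nonpos measurableSet_Ioc fun f hf => ?_
    rw [hFeq]
    have h1 : 3 / s < f := by
      rcases min_choice h (3 / s) with h2 | h2
      · have h3 := hf.1; rw [hc₂, h2] at h3; exact absurd hf.2 (not_le.mpr h3)
      · have h3 := hf.1; rwa [hc₂, h2] at h3
    rw [div_lt_iff₀ hs] at h1
    refine mul_nonpos_of_nonpos_of_nonneg ?_ (H.nonneg f)
    nlinarith
  have hI₁ : ∫ f in (0 : ℝ)..c₁, F f ≤ ρ / s * 3.0929 := by
    have h1 : ∫ f in (0 : ℝ)..c₁, F f ≤ ∫ f in (0 : ℝ)..c₁, ρ / 2 * (9 - s ^ 2 * f ^ 2) := by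
      refine intervalIntegral.integral_mono_on hc₁0 (hFc.intervalIntegrable _ _)
        ((by fun_prop : Continuous fun f : ℝ => ρ / 2 * (9 - s ^ 2 * f ^ 2)).intervalIntegrable _ _)
        fun f hf => ?_
      rw [hFeq]
      have h2 : f ≤ 0.7 / s := hf.2.trans (min_le_right _ _)
      rw [le_div_iff₀ hs] at h2
      have h3 : p f ≤ ρ / 2 :=
        H.p_le ⟨by linarith [hf.1], hf.2.trans (min_le_left _ _)⟩
      have h4 : 0 ≤ 9 - (s * f) ^ 2 := by
        have := mul_nonneg hs.le hf.1
        nlinarith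
      calc _ ≤ (9 - (s * f) ^ 2) * (ρ / 2) := mul_le_mul_of_nonneg_left h3 h4
        _ = _ := by ring
    refine h1.trans ?_
    rw [intervalIntegral.integral_const_mul, intervalIntegral.integral_sub (by simp)
      ((by fun_prop : Continuous fun f : ℝ => s ^ 2 * f ^ 2).intervalIntegrable _ _),
      intervalIntegral.integral_const_mul, integral_pow]
    simp only [intervalIntegral.integral_const, smul_eq_mul]
    have h2 : c₁ ≤ 0.7 / s := min_le_right _ _
    rw [le_div_iff₀ hs] at h2
    have h5 := mul_nonneg hc₁0 hs.le
    have h3 : 9 * (c₁ * s) - (c₁ * s) ^ 3 / 3 ≤ 6.1858 := by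
      nlinarith [mul_nonneg h5 h5, mul_nonneg (mul_nonneg h5 h5) (sub_nonneg.mpr h2),
        mul_nonneg h5 (sub_nonneg.mpr h2)]
    have h4 : ρ / 2 * ((c₁ - 0) * 9 - s ^ 2 * ((c₁ ^ (2 + 1) - 0 ^ (2 + 1)) / ((2 : ℕ) + 1))) =
        ρ / s * ((9 * (c₁ * s) - (c₁ * s) ^ 3 / 3) / 2) := by
      push_cast; field_simp; ring
    rw [h4]
    gcongr
    linarith
  have hI₂ : ∫ f in c₁..c₂, F f ≤ ρ / s * 1.8893 := by
    by_cases hcase : h ≤ 0.7 / s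
    · have h1 : c₁ = h := min_eq_left hcase
      have h2 : c₂ = h := min_eq_left (hcase.trans (by gcongr; norm_num))
      rw [h1, h2, intervalIntegral.integral_same]
      positivity
    · have h1 : c₁ = 0.7 / s := min_eq_right (not_le.mp hcase).le
      have hc₁pos : 0 < c₁ := by rw [h1]; positivity
      have hc₂pos : 0 < c₂ := hc₁pos.trans_le hc₁₂
      have hderiv : ∀ f ∈ Set.uIcc c₁ c₂,
          HasDerivAt (fun f : ℝ => ρ / 4 * (-(9 / s ^ 2) * f⁻¹ - f))
            (ρ / 4 * (-(9 / s ^ 2) * (-(f ^ 2)⁻¹) - 1)) f := by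
        intro f hf
        rw [Set.uIcc_of_le hc₁₂] at hf
        exact (((hasDerivAt_inv (hc₁pos.trans_le hf.1).ne').const_mul _).sub
          (hasDerivAt_id f)).const_mul _
      have hcont : ContinuousOn (fun f : ℝ => ρ / 4 * (-(9 / s ^ 2) * (-(f ^ 2)⁻¹) - 1))
          (Set.uIcc c₁ c₂) := by
        refine ContinuousOn.mul continuousOn_const (ContinuousOn.sub (ContinuousOn.mul
          continuousOn_const (ContinuousOn.neg (ContinuousOn.inv₀ (by fun_prop) ?_)))
          continuousOn_const)
        intro f hf
        rw [Set.uIcc_of_le hc₁₂] at hf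
        have := hc₁pos.trans_le hf.1
        positivity
      have h2 : ∫ f in c₁..c₂, F f ≤
          ∫ f in c₁..c₂, ρ / 4 * (-(9 / s ^ 2) * (-(f ^ 2)⁻¹) - 1) := by
        refine intervalIntegral.integral_mono_on hc₁₂ (hFc.intervalIntegrable _ _)
          hcont.intervalIntegrable fun f hf => ?_
        have hf0 := hc₁pos.trans_le hf.1
        have h3 : q f ≤ ρ / 4 := H.q_le hf0.le (hf.2.trans hc₂h)
        have h4 : f ≤ 3 / s := hf.2.trans (min_le_right _ _)
        rw [le_div_iff₀ hs] at h4
        have h5 : F f = (9 / (s * f) ^ 2 - 1) * q f := by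
          rw [hFeq, H.eq_mul]; field_simp
        have h6 : 0 ≤ 9 / (s * f) ^ 2 - 1 := by
          rw [sub_nonneg, le_div_iff₀ (by positivity)]
          have := mul_pos hs hf0
          nlinarith
        rw [h5]
        calc _ ≤ (9 / (s * f) ^ 2 - 1) * (ρ / 4) := mul_le_mul_of_nonneg_left h3 h6
          _ = _ := by field_simp
      refine h2.trans ?_
      rw [intervalIntegral.integral_eq_sub_of_hasDerivAt hderiv hcont.intervalIntegrable, h1]
      have h3 : 6 ≤ 9 / (s * c₂) + s * c₂ := by
        have h4 := mul_pos hs hc₂pos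
        have h5 : 9 / (s * c₂) + s * c₂ - 6 = (s * c₂ - 3) ^ 2 / (s * c₂) := by
          field_simp; ring
        have : 0 ≤ (s * c₂ - 3) ^ 2 / (s * c₂) := by positivity
        linarith
      have h4 : ρ / 4 * (-(9 / s ^ 2) * c₂⁻¹ - c₂) - ρ / 4 * (-(9 / s ^ 2) * (0.7 / s)⁻¹ - 0.7 / s) =
          ρ / s * ((9 / 0.7 + 0.7 - (9 / (s * c₂) + s * c₂)) / 4) := by
        field_simp; ring
      rw [h4]
      gcongr
      norm_num
      linarith
  have hfin : 4 ≤ ρ / s * 4.9822 := by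
    have := hsplit.symm.trans hhalf
    linarith
  have h1 : ρ / s * 4.9822 * s = ρ * 4.9822 := by field_simp
  have h2 := mul_le_mul_of_nonneg_right hfin hs.le
  rw [h1] at h2
  nlinarith

end FlatPair

/-! ### Numerical inequalities -/

lemma sq_one_sub_le_of_le {x : ℝ} (h0 : 0 ≤ x) (h1 : x ≤ 1.12) :
    (1 - 2 / 3 * x) ^ 2 ≤ (1 + 2 / 3 * x) * (1 - √2 / 2 * x - 0.12975 * x ^ 2) := by
  have h2 : √2 ≤ 1.41422 := by
    rw [Real.sqrt_le_left (by norm_num)]; norm_num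
  have h3 : (1 + 2 / 3 * x) * (√2 / 2 * x) ≤ (1 + 2 / 3 * x) * (1.41422 / 2 * x) := by gcongr
  have h4 : 0 ≤ x * (1.29288 - 1.0457 * x - 0.0866 * x ^ 2) := by
    refine mul_nonneg h0 ?_
    nlinarith
  nlinarith [mul_nonneg h0 h0, mul_nonneg (mul_nonneg h0 h0) h0]

lemma mul_one_add_div_sq_div_le {W u v S R : ℝ} (hu : 0 < u) (hv : 0 < v)
    (h : 0 ≤ R * v * u ^ 2 - W * (u + S) ^ 2) : W * (1 + S / u) ^ 2 / v ≤ R := by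
  rw [div_le_iff₀ hv]
  have e : W * (1 + S / u) ^ 2 = W * (u + S) ^ 2 / u ^ 2 := by field_simp
  rw [e, div_le_iff₀ (by positivity)]
  linarith

/-- The polynomial inequality behind the lower bound for the diagonal of the Schur complement. Its
coefficients in the Bernstein basis of the box are positive. -/
lemma diagonal_defect_le {x Δ : ℝ} (hx : 1.12 ≤ x) (hx' : x < 1.5) (hΔ : 0 ≤ Δ) (hΔ' : Δ ≤ 1 / 2) :
    x / 2 * (1 - Δ) + (x ^ 3 / 8 * (1 - Δ) + (1 - Δ ^ 2) / 48 *
      (1 + 1.2456 * (x ^ 2 + 1 / 4) / (3 - 4 * Δ ^ 2)) ^ 2 / (1 - x / 2)) ≤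
      (2 / 3 * x) ^ 2 * (1 + x / 2 - x * Δ) := by
  have hu : 0 < 3 - 4 * Δ ^ 2 := by nlinarith
  have hy : 0 < 1 - x / 2 := by linarith
  have hb : ∀ i i' j j' : ℕ, 0 ≤ (x - 1.12) ^ i * (1.5 - x) ^ i' * (Δ ^ j * (1 / 2 - Δ) ^ j') := by
    intro i i' j j'
    have h1 : 0 ≤ x - 1.12 := by linarith
    have h2 : 0 ≤ 1.5 - x := by linarith
    have h3 : 0 ≤ 1 / 2 - Δ := by linarith
    positivity
  have key : 0 ≤ ((2 / 3 * x) ^ 2 * (1 + x / 2 - x * Δ) - x / 2 * (1 - Δ) - x ^ 3 / 8 * (1 - Δ)) *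
      (1 - x / 2) * (3 - 4 * Δ ^ 2) ^ 2 -
      (1 - Δ ^ 2) / 48 * (3 - 4 * Δ ^ 2 + 1.2456 * (x ^ 2 + 1 / 4)) ^ 2 := by
    linarith [hb 0 4 0 6, hb 0 4 1 5, hb 0 4 2 4, hb 0 4 3 3, hb 0 4 4 2, hb 0 4 5 1, hb 0 4 6 0,
      hb 1 3 0 6, hb 1 3 1 5, hb 1 3 2 4, hb 1 3 3 3, hb 1 3 4 2, hb 1 3 5 1, hb 1 3 6 0,
      hb 2 2 0 6, hb 2 2 1 5, hb 2 2 2 4, hb 2 2 3 3, hb 2 2 4 2, hb 2 2 5 1, hb 2 2 6 0,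
      hb 3 1 0 6, hb 3 1 1 5, hb 3 1 2 4, hb 3 1 3 3, hb 3 1 4 2, hb 3 1 5 1, hb 3 1 6 0,
      hb 4 0 0 6, hb 4 0 1 5, hb 4 0 2 4, hb 4 0 3 3, hb 4 0 4 2, hb 4 0 5 1, hb 4 0 6 0]
  have := mul_one_add_div_sq_div_le hu hy key
  linarith

/-! ### Lower bounds for the energy form -/

/-- The weight with which `p` enters the splitting `s f p = η₁ p + η₂ q`. -/
noncomputable def weightP (s t f : ℝ) : ℝ := t ^ 2 * (s * f) / (t ^ 2 + (s * f) ^ 2)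

/-- The weight with which `q` enters the splitting `s f p = η₁ p + η₂ q`. -/
noncomputable def weightQ (s t f : ℝ) : ℝ := s * f / (t ^ 2 + (s * f) ^ 2)

section weights
variable {s t : ℝ}

lemma hasDerivAt_weightQ (ht : 0 < t) (f : ℝ) : HasDerivAt (weightQ s t)
    (s * (t ^ 2 - (s * f) ^ 2) / (t ^ 2 + (s * f) ^ 2) ^ 2) f := by
  have h1 : HasDerivAt (fun f : ℝ => s * f) s f := by simpa using (hasDerivAt_id f).const_mul s
  have h2 : t ^ 2 + (s * f) ^ 2 ≠ 0 := by positivity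
  have h3 := h1.div ((h1.pow 2).const_add (t ^ 2)) h2
  refine h3.congr_deriv ?_
  simp only [Pi.pow_apply]
  congr 1
  push_cast
  ring

lemma weightP_eq (f : ℝ) : weightP s t f = t ^ 2 * weightQ s t f := by
  rw [weightP, weightQ, mul_div_assoc]

lemma hasDerivAt_weightP (ht : 0 < t) (f : ℝ) : HasDerivAt (weightP s t)
    (t ^ 2 * (s * (t ^ 2 - (s * f) ^ 2) / (t ^ 2 + (s * f) ^ 2) ^ 2)) f := by
  have : weightP s t = fun f => t ^ 2 * weightQ s t f := funext weightP_eq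
  rw [this]
  exact (hasDerivAt_weightQ ht f).const_mul _

lemma abs_weightQ_le (ht : 0 < t) (f : ℝ) : |weightQ s t f| ≤ 1 / (2 * t) := by
  have h2 : 0 < t ^ 2 + (s * f) ^ 2 := by positivity
  rw [weightQ, abs_div, abs_of_pos h2, div_le_div_iff₀ h2 (by positivity)]
  nlinarith [sq_nonneg (t - |s * f|), sq_abs (s * f)]

lemma abs_weightP_le (ht : 0 < t) (f : ℝ) : |weightP s t f| ≤ t / 2 := by
  rw [weightP_eq, abs_mul, abs_of_pos (by positivity : 0 < t ^ 2)]
  have := mul_le_mul_of_nonneg_left (abs_weightQ_le (s := s) ht f) (by positivity : 0 ≤ t ^ 2)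
  refine this.trans (le_of_eq ?_)
  field_simp

lemma continuous_weight_deriv (ht : 0 < t) :
    Continuous fun f : ℝ => s * (t ^ 2 - (s * f) ^ 2) / (t ^ 2 + (s * f) ^ 2) ^ 2 := by
  refine Continuous.div (by fun_prop) (by fun_prop) fun f => ?_
  positivity

end weights

namespace FlatPair
variable {M : ℕ} {p q : ℝ → ℝ} {s ρ : ℝ}

/-- The density which multiplies the slow term of the splitting: a difference of `p` and `q`, each
with a weight that is unimodal on either half of the band. -/
lemma extVar_slow_le (H : FlatPair M p q s ρ) {t : ℝ} (ht : 0 < t) :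
    BoundedVariationOn (fun f => p f * ((t ^ 2 - (s * f) ^ 2) / (t ^ 2 + (s * f) ^ 2)))
      (Set.Icc (-((M : ℝ) / 2)) ((M : ℝ) / 2)) ∧
    extVar (fun f => p f * ((t ^ 2 - (s * f) ^ 2) / (t ^ 2 + (s * f) ^ 2)))
      (-((M : ℝ) / 2)) ((M : ℝ) / 2) ≤ ρ * (1 + 1 / (4 * t ^ 2)) := by
  have hM := half_nonneg M
  have hs := H.s_pos
  set h : ℝ := (M : ℝ) / 2 with hh
  set A₁ : ℝ → ℝ := fun f => (t ^ 2 / (t ^ 2 + (s * f) ^ 2)) ^ 2 with hA₁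
  set A₂ : ℝ → ℝ := fun f => (s * f / (t ^ 2 + (s * f) ^ 2)) ^ 2 with hA₂
  have hden : ∀ f, 0 < t ^ 2 + (s * f) ^ 2 := fun f => by positivity
  have hr : (fun f => p f * ((t ^ 2 - (s * f) ^ 2) / (t ^ 2 + (s * f) ^ 2))) =
      fun f => p f * A₁ f - q f * A₂ f := by
    funext f
    have := (hden f).ne'
    simp only [hA₁, hA₂, H.eq_mul]
    field_simp
    ring
  have heven : ∀ f, p (-f) * A₁ (-f) - q (-f) * A₂ (-f) = p f * A₁ f - q f * A₂ f := by
    intro f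
    simp only [hA₁, hA₂, H.even, H.even_q, mul_neg, neg_sq, neg_div]
  have hbp : BoundedVariationOn p (Set.Icc 0 h) :=
    H.bv_p.mono (Set.Icc_subset_Icc_left (by linarith))
  have hbq : BoundedVariationOn q (Set.Icc 0 h) :=
    H.bv_q.mono (Set.Icc_subset_Icc_left (by linarith))
  -- the weight of `p` decreases away from the center
  have hp := intervalVar_mul_antitone_le (A := A₁) hM hbp (by
    intro x hx y hy hxy
    have := hden x
    have := mul_nonneg hs.le hx.1
    simp only [hA₁]
    gcongr) (by positivity)
  have hA0 : A₁ 0 = 1 := by simp only [hA₁]; field_simp; simp; ring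
  rw [hA0, one_mul] at hp
  -- the weight of `q` increases up to `t / s` and decreases beyond
  set c := min (t / s) h with hc
  have hc0 : 0 ≤ c := le_min (by positivity) hM
  have hch : c ≤ h := min_le_right _ _
  have hmono : ∀ x y, 0 ≤ x → x ≤ y → s * x * (s * y) ≤ t ^ 2 →
      s * x / (t ^ 2 + (s * x) ^ 2) ≤ s * y / (t ^ 2 + (s * y) ^ 2) := by
    intro x y hx hxy hle
    rw [div_le_div_iff₀ (hden x) (hden y)]
    have := mul_nonneg (mul_nonneg hs.le (sub_nonneg.mpr hxy)) (sub_nonneg.mpr hle)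
    nlinarith
  have hanti : ∀ x y, x ≤ y → t ^ 2 ≤ s * x * (s * y) →
      s * y / (t ^ 2 + (s * y) ^ 2) ≤ s * x / (t ^ 2 + (s * x) ^ 2) := by
    intro x y hxy hle
    rw [div_le_div_iff₀ (hden y) (hden x)]
    have := mul_nonneg (mul_nonneg hs.le (sub_nonneg.mpr hxy)) (sub_nonneg.mpr hle)
    nlinarith
  have hq₁ := intervalVar_mul_monotone_le (A := A₂) hc0 (hbq.mono (Set.Icc_subset_Icc_right hch)) (by
    intro x hx y hy hxy
    have h1 : y ≤ t / s := hy.2.trans (min_le_left _ _)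
    rw [le_div_iff₀ hs] at h1
    have h2 := mul_nonneg hs.le hx.1
    have h3 := mul_le_mul_of_nonneg_left hxy hs.le
    have h4 : s * x * (s * y) ≤ t ^ 2 := by nlinarith
    have := hmono x y hx.1 hxy h4
    have := hden x
    simp only [hA₂]
    gcongr) (by positivity)
  have hq₂ := intervalVar_mul_antitone_le (A := A₂) hch (hbq.mono (Set.Icc_subset_Icc_left hc0)) (by
    intro x hx y hy hxy
    have h1 : t / s ≤ x ∨ x = y := by
      rcases min_choice (t / s) h with h2 | h2
      · left; rw [← h2]; exact hx.1
      · right; rw [hc, h2] at hx; linarith [hx.1, hy.2]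
    rcases h1 with h1 | h1
    · rw [div_le_iff₀ hs] at h1
      have h3 := mul_le_mul_of_nonneg_left hxy hs.le
      have h4 : t ^ 2 ≤ s * x * (s * y) := by nlinarith
      have := hanti x y hxy h4
      have := hden y
      have : 0 ≤ y := (hc0.trans hx.1).trans hxy
      simp only [hA₂]
      gcongr
    · rw [h1]) (by positivity)
  have hA2c : A₂ c ≤ 1 / (4 * t ^ 2) := by
    have h1 := abs_weightQ_le (s := s) ht c
    rw [weightQ] at h1
    simp only [hA₂]
    rw [← sq_abs]
    calc |s * c / (t ^ 2 + (s * c) ^ 2)| ^ 2 ≤ (1 / (2 * t)) ^ 2 := by gcongr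
      _ = _ := by field_simp; norm_num
  have hbq2 : BoundedVariationOn (fun f => q f * A₂ f) (Set.Icc 0 h) := by
    have h1 := eVariationOn.Icc_add_Icc (fun f => q f * A₂ f) (s := Set.univ) hc0 hch
      (Set.mem_univ _)
    simp only [Set.univ_inter] at h1
    rw [BoundedVariationOn, ← h1]
    exact ENNReal.add_ne_top.mpr ⟨hq₁.1, hq₂.1⟩
  have hsub := intervalVar_sub_le hp.1 hbq2
  have hbv := boundedVariationOn_even heven hM hsub.1
  rw [hr]
  refine ⟨hbv, ?_⟩
  rw [extVar_even heven hM hbv]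
  have h1 := intervalVar_add hc0 hch hbq2
  have h2 := intervalVar_add hc0 hch hbq
  have h3 : |p h * A₁ h - q h * A₂ h| ≤ |p h| * A₁ h + |q h| * A₂ h := by
    refine (abs_sub _ _).trans ?_
    rw [abs_mul, abs_mul, abs_of_nonneg (by positivity : 0 ≤ A₁ h),
      abs_of_nonneg (by positivity : 0 ≤ A₂ h)]
  have h4 : q 0 = 0 := by rw [H.eq_mul]; simp
  have hq₁' := hq₁.2
  rw [h4, abs_zero, zero_mul, add_zero, add_zero] at hq₁'
  have hpe := extVar_even H.even hM H.bv_p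
  have hqe := extVar_even H.even_q hM H.bv_q
  have h5 := H.extVar_p
  have h6 := H.extVar_q
  have h7 : A₂ c * (intervalVar q 0 h + |q h|) ≤ 1 / (4 * t ^ 2) * (ρ / 2) := by
    refine mul_le_mul hA2c (by linarith) (add_nonneg intervalVar_nonneg (abs_nonneg _))
      (by positivity)
  have h8 : A₂ c * (intervalVar q 0 h + |q h|) =
      A₂ c * intervalVar q 0 c + A₂ c * (intervalVar q c h + |q h|) := by rw [← h2]; ring
  nlinarith [hp.2, hq₂.2, hsub.2]

section forms
variable {ι : Type*} [Fintype ι] [DecidableEq ι] {τ : ι → ℝ} {Δ : ℝ}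

/-- The energy of a combination of pulses and of their derivatives, up to normalization: with
`F_b(f) = ∑ b_k e^{-2πiτ_k f}`, the sum of `p |F_b + i s f F_c|²` over the nodes. -/
noncomputable def _root_.PulseLocation.energyForm (M : ℕ) (p q : ℝ → ℝ) (s : ℝ) (τ : ι → ℝ)
    (b c : ι → ℝ) : ℝ :=
  ∑ n ∈ Finset.range (M + 1), (p (node M n) * cosSum τ (node M n) b b +
    q (node M n) * cosSum τ (node M n) c c -
      2 * (s * node M n * p (node M n)) * sinSum τ (node M n) b c)

/-- The form is compared with its continuous counterpart `‖b‖² + θ ‖c‖²`. The cross term is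
split among `p` and `q`, which leaves a slow term. -/
lemma form_ge (H : FlatPair M p q s ρ) (h : Separated τ Δ) (hΔ : 0 < Δ) {t : ℝ} (ht : 0 < t)
    (θ : ℝ) (b c : ι → ℝ) {B₁ B₂ R : ℝ}
    (hB₁ : ∀ μ x, |μ - x| ≤ 1 / 2 →
      |1 * (sinForm τ μ b + (μ - x) * ∑ k, b k ^ 2) + 2 * weightP s t x * cosForm τ μ b c| ≤ B₁)
    (hB₂ : ∀ μ x, |μ - x| ≤ 1 / 2 →
      |θ * (sinForm τ μ c + (μ - x) * ∑ k, c k ^ 2) + 2 * weightQ s t x * cosForm τ μ b c| ≤ B₂)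
    (hR : ∀ f, |sinForm₂ τ f b c| ≤ R) :
    ∑ k, b k ^ 2 + θ * ∑ k, c k ^ 2 - (B₁ + B₂) * ρ - 2 * s * R * (ρ * (1 + 1 / (4 * t ^ 2))) ≤
      ∑ n ∈ Finset.range (M + 1), (p (node M n) * cosSum τ (node M n) b b +
        θ * (q (node M n) * cosSum τ (node M n) c c) -
          2 * (s * node M n * p (node M n)) * sinSum τ (node M n) b c) := by
  have hs := H.s_pos
  have h1 := abs_sum_form_sub_le h hΔ M H.bv_p H.cont (hasDerivAt_weightP (s := s) ht)
    ((continuous_weight_deriv ht).const_mul _) 1 b b c hB₁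
  have h2 := abs_sum_form_sub_le h hΔ M H.bv_q H.cont_q (hasDerivAt_weightQ (s := s) ht)
    (continuous_weight_deriv ht) θ c b c hB₂
  obtain ⟨hrbv, hrvar⟩ := H.extVar_slow_le ht
  have hden : ∀ f, 0 < t ^ 2 + (s * f) ^ 2 := fun f => by positivity
  have hrc : Continuous fun f => p f * ((t ^ 2 - (s * f) ^ 2) / (t ^ 2 + (s * f) ^ 2)) :=
    H.cont.mul (Continuous.div (by fun_prop) (by fun_prop) fun f => (hden f).ne')
  have h3 := abs_sum_integral_cosForm_le h hΔ M hrbv hrc b c hR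
  have hB₁0 : 0 ≤ B₁ := (abs_nonneg _).trans (hB₁ 0 0 (by simp))
  have hB₂0 : 0 ≤ B₂ := (abs_nonneg _).trans (hB₂ 0 0 (by simp))
  have hR0 : 0 ≤ R := (abs_nonneg _).trans (hR 0)
  rw [H.integral_p] at h1
  rw [H.integral_q] at h2
  have h1' := (abs_le.mp (h1.trans (mul_le_mul_of_nonneg_left H.extVar_p hB₁0))).1
  have h2' := (abs_le.mp (h2.trans (mul_le_mul_of_nonneg_left H.extVar_q hB₂0))).1
  have h3' := (abs_le.mp (h3.trans (mul_le_mul_of_nonneg_left hrvar hR0))).2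
  have hslow : (∑ n ∈ Finset.range M, ∫ x in (node M n)..(node M (n + 1)),
        (p x * (t ^ 2 * (s * (t ^ 2 - (s * x) ^ 2) / (t ^ 2 + (s * x) ^ 2) ^ 2))) *
          cosForm τ (cellMid M (n + 1)) b c) +
      (∑ n ∈ Finset.range M, ∫ x in (node M n)..(node M (n + 1)),
        (q x * (s * (t ^ 2 - (s * x) ^ 2) / (t ^ 2 + (s * x) ^ 2) ^ 2)) *
          cosForm τ (cellMid M (n + 1)) b c) =
      s * ∑ n ∈ Finset.range M, ∫ x in (node M n)..(node M (n + 1)),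
        (p x * ((t ^ 2 - (s * x) ^ 2) / (t ^ 2 + (s * x) ^ 2))) *
          cosForm τ (cellMid M (n + 1)) b c := by
    rw [← Finset.sum_add_distrib, Finset.mul_sum]
    refine Finset.sum_congr rfl fun n _ => ?_
    have hcw := continuous_weight_deriv (s := s) ht
    rw [← intervalIntegral.integral_add, ← intervalIntegral.integral_const_mul]
    · refine intervalIntegral.integral_congr fun x _ => ?_
      have := (hden x).ne'
      simp only [H.eq_mul]
      field_simp
    · exact ((H.cont.mul (hcw.const_mul _)).mul_const _).intervalIntegrable _ _
    · exact ((H.cont_q.mul hcw).mul_const _).intervalIntegrable _ _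
  have hsum : (∑ n ∈ Finset.range (M + 1), p (node M n) *
        (1 * cosSum τ (node M n) b b - 2 * weightP s t (node M n) * sinSum τ (node M n) b c)) +
      (∑ n ∈ Finset.range (M + 1), q (node M n) *
        (θ * cosSum τ (node M n) c c - 2 * weightQ s t (node M n) * sinSum τ (node M n) b c)) =
      ∑ n ∈ Finset.range (M + 1), (p (node M n) * cosSum τ (node M n) b b +
        θ * (q (node M n) * cosSum τ (node M n) c c) -
          2 * (s * node M n * p (node M n)) * sinSum τ (node M n) b c) := by
    rw [← Finset.sum_add_distrib]
    refine Finset.sum_congr rfl fun n _ => ?_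
    have := (hden (node M n)).ne'
    simp only [weightP, weightQ, H.eq_mul]
    field_simp
    ring
  have h4 := mul_le_mul_of_nonneg_left h3' hs.le
  rw [← hsum]
  nlinarith

/-- Interpolation between the quadratic bounds of the form at `(b, r c)` and `(r b, -c)`, where
`r = √2 - 1` is the tangent of `π / 8`. -/
lemma abs_sinForm_add_cosForm_le (h : Separated τ Δ) (hΔ : 0 < Δ) (hΔ1 : Δ ≤ 1) (b c : ι → ℝ)
    {μ x η : ℝ} (hx : |μ - x| ≤ 1 / 2) (hη : |2 * η| ≤ 1) :
    |sinForm τ μ b + (μ - x) * ∑ k, b k ^ 2 + 2 * η * cosForm τ μ b c| ≤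
      √2 / (8 * Δ) * (3 * ∑ k, b k ^ 2 + ∑ k, c k ^ 2) := by
  set β := ∑ k, b k ^ 2 with hβ
  set γ := ∑ k, c k ^ 2 with hγ
  have hβ0 : 0 ≤ β := by positivity
  have hγ0 : 0 ≤ γ := by positivity
  have hquad : ∀ y z : ℝ, |y ^ 2 * (sinForm τ μ b + (μ - x) * β) + 2 * (y * z * cosForm τ μ b c) +
      z ^ 2 * (sinForm τ μ c + (μ - x) * γ)| ≤ 1 / (2 * Δ) * (y ^ 2 * β + z ^ 2 * γ) := by
    intro y z
    have h1 := abs_hilbert_form_le h hΔ hΔ1 μ (y • b) (z • c)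
    rw [sinForm_smul, sinForm_smul, cosForm_smul_left, cosForm_smul_right] at h1
    simp only [Pi.smul_apply, smul_eq_mul, mul_pow, ← Finset.mul_sum] at h1
    rw [← hβ, ← hγ] at h1
    have hyz : 0 ≤ y ^ 2 * β + z ^ 2 * γ := by positivity
    have h2 : |(μ - x) * (y ^ 2 * β + z ^ 2 * γ)| ≤ 1 / 2 * (y ^ 2 * β + z ^ 2 * γ) := by
      rw [abs_mul, abs_of_nonneg hyz]
      gcongr
    have e : y ^ 2 * (sinForm τ μ b + (μ - x) * β) + 2 * (y * z * cosForm τ μ b c) +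
        z ^ 2 * (sinForm τ μ c + (μ - x) * γ) = (y ^ 2 * sinForm τ μ b +
        2 * (y * (z * cosForm τ μ b c)) + z ^ 2 * sinForm τ μ c) +
          (μ - x) * (y ^ 2 * β + z ^ 2 * γ) := by ring
    rw [e]
    refine (abs_add_le _ _).trans ((add_le_add h1 h2).trans (le_of_eq ?_))
    field_simp
    ring
  obtain ⟨r, hr⟩ : ∃ r, r = √2 - 1 := ⟨_, rfl⟩
  have h2 : √2 * √2 = 2 := Real.mul_self_sqrt (by norm_num)
  have hr2 : r ^ 2 = 1 - 2 * r := by rw [hr]; nlinarith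
  have hrpos : 2 / 5 < r := by
    rw [hr]
    have : 7 / 5 < √2 := Real.lt_sqrt_of_sq_lt (by norm_num)
    linarith
  have hs2 : √2 = r + 1 := by rw [hr]; ring
  set A := sinForm τ μ b + (μ - x) * β
  set C := sinForm τ μ c + (μ - x) * γ
  set X := cosForm τ μ b c
  have hcomb : ∀ σ : ℝ, σ ^ 2 = 1 → |A + σ * X| ≤ √2 / (8 * Δ) * (3 * β + γ) := by
    intro σ hσ
    have h3 := hquad 1 (σ * r)
    have h4 := hquad r (-σ)
    -- `1 - r⁴ = 12 r - 4`
    have e1 : (12 * r - 4) * (A + σ * X) =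
        (1 ^ 2 * A + 2 * (1 * (σ * r) * X) + (σ * r) ^ 2 * C) -
        r ^ 2 * (r ^ 2 * A + 2 * (r * -σ * X) + (-σ) ^ 2 * C) := by
      have h5 : r ^ 4 = 5 - 12 * r := by
        have : r ^ 4 = (r ^ 2) ^ 2 := by ring
        rw [this, hr2]; nlinarith
      have h6 : r ^ 3 = 5 * r - 2 := by
        have : r ^ 3 = r * r ^ 2 := by ring
        rw [this, hr2]; nlinarith
      linear_combination (A : ℝ) * h5 - 2 * σ * X * h6
    have hpos : 0 < 12 * r - 4 := by linarith
    have h5 : (12 * r - 4) * |A + σ * X| ≤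
        1 / (2 * Δ) * (1 ^ 2 * β + (σ * r) ^ 2 * γ) +
          r ^ 2 * (1 / (2 * Δ) * (r ^ 2 * β + (-σ) ^ 2 * γ)) := by
      have e0 : (12 * r - 4) * |A + σ * X| = |(12 * r - 4) * (A + σ * X)| := by
        rw [abs_mul, abs_of_pos hpos]
      rw [e0, e1]
      refine (abs_sub _ _).trans (add_le_add h3 ?_)
      rw [abs_mul, abs_of_nonneg (sq_nonneg r)]
      gcongr
    have h6 : 1 / (2 * Δ) * (1 ^ 2 * β + (σ * r) ^ 2 * γ) +
          r ^ 2 * (1 / (2 * Δ) * (r ^ 2 * β + (-σ) ^ 2 * γ)) =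
        (12 * r - 4) * (√2 / (8 * Δ) * (3 * β + γ)) := by
      have h7 : r ^ 4 = 5 - 12 * r := by
        have : r ^ 4 = (r ^ 2) ^ 2 := by ring
        rw [this, hr2]; nlinarith
      rw [hs2]
      field_simp
      rw [hσ]
      have h8 : r ^ 2 * r ^ 2 = 5 - 12 * r := by rw [← h7]; ring
      linear_combination (4 * γ - 36 * β - 36 * β - 12 * γ) * hr2 + 8 * β * h8
    rw [h6] at h5
    exact le_of_mul_le_mul_left h5 hpos
  have h3 := hcomb 1 (by norm_num)
  have h4 := hcomb (-1) (by norm_num)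
  rw [one_mul] at h3
  rw [neg_one_mul, ← sub_eq_add_neg] at h4
  rw [abs_le] at *
  constructor <;> nlinarith [hη.1, hη.2, h3.1, h3.2, h4.1, h4.2]

/-- Lower bound for the energy form on all vectors. The first loss is the size of the kernels,
for the parameter `t = 1` of the splitting; the second comes from the slow term. -/
lemma energyForm_ge (H : FlatPair M p q s ρ) (h : Separated τ Δ) (hΔ : 0 < Δ) (hΔ1 : Δ ≤ 1)
    (b c : ι → ℝ) :
    (1 - √2 / 2 * (ρ / Δ) - 0.12975 * (ρ / Δ) ^ 2) * (∑ k, b k ^ 2 + ∑ k, c k ^ 2) ≤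
      energyForm M p q s τ b c := by
  have hρ := H.rho_nonneg
  have hsb := H.s_le
  set β := ∑ k, b k ^ 2 with hβ
  set γ := ∑ k, c k ^ 2 with hγ
  have hβγ : 0 ≤ β + γ := by positivity
  have hx : ∀ f, |2 * weightP s 1 f| ≤ 1 := fun f => by
    have := abs_weightP_le (s := s) one_pos f
    rw [abs_mul, abs_two]; linarith
  have hy : ∀ f, |2 * weightQ s 1 f| ≤ 1 := fun f => by
    have := abs_weightQ_le (s := s) one_pos f
    rw [abs_mul, abs_two]; linarith
  have key := H.form_ge h hΔ one_pos 1 b c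
    (fun μ x hμ => by
      rw [one_mul]
      exact abs_sinForm_add_cosForm_le h hΔ hΔ1 b c hμ (hx x))
    (fun μ x hμ => by
      have := abs_sinForm_add_cosForm_le h hΔ hΔ1 c b (η := -weightQ s 1 x) hμ
        (by rw [mul_neg, abs_neg]; exact hy x)
      rw [cosForm_swap] at this
      rw [one_mul]
      refine le_trans (le_of_eq ?_) this
      congr 1
      ring)
    (abs_sinForm₂_le h hΔ hΔ1 · b c)
  rw [← hβ, ← hγ] at key
  have e : ∑ n ∈ Finset.range (M + 1), (p (node M n) * cosSum τ (node M n) b b +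
        1 * (q (node M n) * cosSum τ (node M n) c c) -
          2 * (s * node M n * p (node M n)) * sinSum τ (node M n) b c) =
      energyForm M p q s τ b c := by
    simp only [one_mul]; rfl
  rw [e] at key
  refine le_trans ?_ key
  have h1 : (√2 / (8 * Δ) * (3 * β + γ) + √2 / (8 * Δ) * (3 * γ + β)) * ρ =
      √2 / 2 * (ρ / Δ) * (β + γ) := by
    field_simp; ring
  rw [h1]
  have h2 : 2 * s * (((Δ ^ 2)⁻¹ - 1) / 24 * (β + γ)) * (ρ * (1 + 1 / (4 * 1 ^ 2))) ≤
      0.12975 * (ρ / Δ) ^ 2 * (β + γ) := by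
    have h3 : ((Δ ^ 2)⁻¹ - 1) / 24 * (β + γ) ≤ (Δ ^ 2)⁻¹ / 24 * (β + γ) := by
      gcongr; linarith
    calc 2 * s * (((Δ ^ 2)⁻¹ - 1) / 24 * (β + γ)) * (ρ * (1 + 1 / (4 * 1 ^ 2)))
        ≤ 2 * s * ((Δ ^ 2)⁻¹ / 24 * (β + γ)) * (ρ * (1 + 1 / (4 * 1 ^ 2))) := by
          have := H.s_pos; gcongr
      _ ≤ 2 * (1.2456 * ρ) * ((Δ ^ 2)⁻¹ / 24 * (β + γ)) * (ρ * (1 + 1 / (4 * 1 ^ 2))) := by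
          gcongr
      _ = _ := by field_simp; norm_num; ring
  linarith

end forms
end FlatPair

/-! ### Sampling inequalities and coordinate vectors -/

namespace FlatPair
variable {M : ℕ} {p q : ℝ → ℝ} {s ρ : ℝ}

/-- A sampled density has nearly unit mass. -/
lemma abs_sum_q_sub_one_le (H : FlatPair M p q s ρ) :
    |∑ n ∈ Finset.range (M + 1), q (node M n) - 1| ≤ ρ / 2 := by
  have h : Separated (fun _ : Unit => (0 : ℝ)) 1 := fun k l hkl => absurd rfl hkl
  have key := abs_sum_form_sub_le h one_pos M H.bv_q H.cont_q (η := fun _ => 0) (η' := fun _ => 0)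
    (fun x => hasDerivAt_const x 0) continuous_const 1 (fun _ : Unit => (1 : ℝ)) 0 0 (B := 1 / 2)
    (fun μ x hx => by simpa [sinForm] using hx)
  rw [H.integral_q] at key
  simp [cosSum] at key
  linarith [H.extVar_q]

section forms
variable {ι : Type*} [Fintype ι] [DecidableEq ι] {τ : ι → ℝ} {Δ : ℝ}

/-- Sampling inequality: exponential sums are controlled by the separation of their frequencies. -/
lemma abs_sum_p_cosSum_sub_le (H : FlatPair M p q s ρ) (h : Separated τ Δ) (hΔ : 0 < Δ)
    (hΔ1 : Δ ≤ 1) (b : ι → ℝ) :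
    |∑ n ∈ Finset.range (M + 1), p (node M n) * cosSum τ (node M n) b b - ∑ k, b k ^ 2| ≤
      1 / 2 * (ρ / Δ) * ∑ k, b k ^ 2 := by
  have key := abs_sum_form_sub_le h hΔ M H.bv_p H.cont (η := fun _ => 0) (η' := fun _ => 0)
    (fun x => hasDerivAt_const x 0) continuous_const 1 b 0 0 (B := 1 / (2 * Δ) * ∑ k, b k ^ 2)
    (fun μ x hx => by
      have h1 := abs_hilbert_form_le h hΔ hΔ1 μ b 0
      have h2 : sinForm τ μ (0 : ι → ℝ) = 0 := by simp [sinForm]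
      have h3 : cosForm τ μ b (0 : ι → ℝ) = 0 := by simp [cosForm]
      rw [h2, h3] at h1
      simp only [mul_zero, add_zero, Pi.zero_apply, ne_eq, OfNat.ofNat_ne_zero, not_false_eq_true,
        zero_pow, Finset.sum_const_zero] at h1
      have hb : 0 ≤ ∑ k, b k ^ 2 := by positivity
      have h4 : |(μ - x) * ∑ k, b k ^ 2| ≤ 1 / 2 * ∑ k, b k ^ 2 := by
        rw [abs_mul, abs_of_nonneg hb]
        gcongr
      simp only [one_mul, mul_zero, zero_mul, add_zero]
      refine (abs_add_le _ _).trans ((add_le_add h1 h4).trans (le_of_eq ?_))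
      field_simp
      ring)
  rw [H.integral_p] at key
  simp only [one_mul, mul_zero, zero_mul, sub_zero, mul_one, intervalIntegral.integral_zero,
    Finset.sum_const_zero, add_zero] at key
  refine key.trans ?_
  have hb : 0 ≤ ∑ k, b k ^ 2 := by positivity
  calc _ ≤ 1 / (2 * Δ) * (∑ k, b k ^ 2) * ρ := mul_le_mul_of_nonneg_left H.extVar_p (by positivity)
    _ = _ := by field_simp

/-- Sampling inequality for `q` from above. The discrete mass of `q` is kept, and the diagonal
terms of the kernels do not contribute, which saves the factor `1 - Δ`. -/
lemma sum_q_cosSum_le (H : FlatPair M p q s ρ) (h : Separated τ Δ) (hΔ : 0 < Δ)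
    (hΔ1 : Δ ≤ 1) (c : ι → ℝ) :
    ∑ n ∈ Finset.range (M + 1), q (node M n) * cosSum τ (node M n) c c ≤
      (∑ n ∈ Finset.range (M + 1), q (node M n) + 1 / 2 * (ρ / Δ) * (1 - Δ)) * ∑ k, c k ^ 2 := by
  have hc : 0 ≤ ∑ k, c k ^ 2 := by positivity
  have hinv : 0 ≤ Δ⁻¹ - 1 := by
    rw [sub_nonneg]; exact (one_le_inv₀ hΔ).mpr hΔ1
  have key := abs_sum_jump_add_integral_le' M H.bv_q H.cont_q
    (k := fun n _ => sinForm τ (cellMid M n) c) (k' := fun _ _ => 0)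
    (B := 1 / 2 * (Δ⁻¹ - 1) * ∑ k, c k ^ 2)
    (fun n x => hasDerivAt_const x _) (fun n => continuous_const)
    (fun n x _ => by
      have h1 := abs_hilbert_form_le h hΔ hΔ1 (cellMid M n) c 0
      have h2 : sinForm τ (cellMid M n) (0 : ι → ℝ) = 0 := by simp [sinForm]
      have h3 : cosForm τ (cellMid M n) c (0 : ι → ℝ) = 0 := by simp [cosForm]
      rw [h2, h3] at h1
      simpa using h1)
  have h1 : ∀ n, sinForm τ (cellMid M (n + 1)) c - sinForm τ (cellMid M n) c =
      cosSum τ (node M n) c c - ∑ k, c k ^ 2 := by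
    intro n
    rw [cellMid_succ, cellMid]
    exact sinForm_add_half_sub h hΔ _ c
  simp only [h1, mul_zero, intervalIntegral.integral_zero, Finset.sum_const_zero, add_zero, mul_sub,
    Finset.sum_sub_distrib, ← Finset.sum_mul] at key
  have h2 := (abs_le.mp key).2
  have h3 : 1 / 2 * (Δ⁻¹ - 1) * (∑ k, c k ^ 2) * extVar q (-((M : ℝ) / 2)) ((M : ℝ) / 2) ≤
      1 / 2 * (Δ⁻¹ - 1) * (∑ k, c k ^ 2) * ρ :=
    mul_le_mul_of_nonneg_left H.extVar_q (by positivity)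
  have h4 : 1 / 2 * (Δ⁻¹ - 1) * (∑ k, c k ^ 2) * ρ = 1 / 2 * (ρ / Δ) * (1 - Δ) * ∑ k, c k ^ 2 := by
    field_simp
  rw [add_mul]
  linarith

/-- Lower bound for the form at a coordinate vector `c`, sharper than for general `c` since the
diagonal terms of the kernels drop out. -/
lemma energyForm_single_ge (H : FlatPair M p q s ρ) (h : Separated τ Δ) (hΔ : 0 < Δ)
    (hΔ1 : Δ ≤ 1 / 2) (hρ : 0 < ρ) (hx : ρ / Δ < 2) (b : ι → ℝ) (k : ι) :
    ∑ n ∈ Finset.range (M + 1), q (node M n) -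
      ((ρ / Δ) ^ 3 / 8 * (1 - Δ) + (1 - Δ ^ 2) / 48 *
        (1 + 1.2456 * ((ρ / Δ) ^ 2 + 1 / 4) / (3 - 4 * Δ ^ 2)) ^ 2 / (1 - ρ / Δ / 2)) ≤
      energyForm M p q s τ b (Pi.single k 1) := by
  have hsb := H.s_le
  have hs := H.s_pos
  obtain ⟨x, hxdef⟩ : ∃ x, x = ρ / Δ := ⟨_, rfl⟩
  have hρx : ρ = x * Δ := by rw [hxdef]; field_simp
  have hx0 : 0 < x := by rw [hxdef]; positivity
  rw [← hxdef] at hx ⊢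
  set e : ι → ℝ := Pi.single k 1 with he
  have hsin : ∀ f, sinForm τ f e = 0 := by
    intro f
    rw [sinForm]
    refine Finset.sum_eq_zero fun i _ => Finset.sum_eq_zero fun j _ => ?_
    by_cases hij : i = j
    · subst hij; simp
    · by_cases hi : i = k
      · have : e j = 0 := by rw [he, Pi.single_eq_of_ne]; rintro rfl; exact hij hi
        rw [this]; ring
      · have : e i = 0 := by rw [he, Pi.single_eq_of_ne hi]
        rw [this]; ring
  have hcos : ∀ f, cosSum τ f e e = 1 := by
    intro f
    rw [cosSum, Finset.sum_eq_single k, Finset.sum_eq_single k]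
    · simp [he]
    · intro j _ hj; simp [he, hj]
    · simp
    · intro i _ hi; simp [he, hi]
    · simp
  have hsq : ∀ r : ℝ, ∑ i, (r • e) i ^ 2 = r ^ 2 := by
    intro r
    rw [Finset.sum_eq_single k]
    · simp [he]
    · intro i _ hi; simp [he, hi]
    · simp
  set β := ∑ i, b i ^ 2 with hβ
  have hβ0 : 0 ≤ β := by positivity
  have hinv : 0 ≤ Δ⁻¹ - 1 := by
    rw [sub_nonneg]; exact (one_le_inv₀ hΔ).mpr (by linarith)
  have h12 : 0 ≤ (1 - Δ ^ 2) / 12 := by nlinarith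
  set y := √((1 - Δ ^ 2) / 12) with hy
  have hy2 : y ^ 2 = (1 - Δ ^ 2) / 12 := Real.sq_sqrt h12
  have hy0 : 0 ≤ y := Real.sqrt_nonneg _
  have hu : 0 < 3 - 4 * Δ ^ 2 := by nlinarith
  have hy₁ : √(((Δ ^ 2)⁻¹ - 1) / 12) = y / Δ := by
    rw [← Real.sqrt_sq (show 0 ≤ y / Δ by positivity)]
    congr 1
    rw [div_pow, hy2]; field_simp
  have hy₂ : √(((Δ ^ 2)⁻¹ - 1) / 48 * ((3 * Δ - 4 * Δ ^ 3) ^ 2)⁻¹) =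
      y / (2 * Δ ^ 2 * (3 - 4 * Δ ^ 2)) := by
    rw [← Real.sqrt_sq (show 0 ≤ y / (2 * Δ ^ 2 * (3 - 4 * Δ ^ 2)) by positivity)]
    congr 1
    have h1 : 3 * Δ - 4 * Δ ^ 3 = Δ * (3 - 4 * Δ ^ 2) := by ring
    rw [div_pow, hy2, h1]
    generalize 3 - 4 * Δ ^ 2 = u at hu
    field_simp
    ring
  have key := H.form_ge h hΔ hx0 0 b e (B₁ := β / (2 * Δ) + 1 / 2 * (Δ⁻¹ - 1) * (x / 2) ^ 2)
    (B₂ := 1 / x * (√β * (y / Δ)))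
    (fun μ z hz => by
      have h1 := abs_hilbert_form_le h hΔ (by linarith) μ b (weightP s x z • e)
      rw [sinForm_smul, hsin, cosForm_smul_right, hsq, ← hβ] at h1
      have h4 : |(μ - z) * β| ≤ 1 / 2 * β := by
        rw [abs_mul, abs_of_nonneg hβ0]
        gcongr
      have h5 : weightP s x z ^ 2 ≤ (x / 2) ^ 2 := by
        rw [← sq_abs]
        exact pow_le_pow_left₀ (abs_nonneg _) (abs_weightP_le hx0 z) 2
      have h6 : 1 / 2 * (Δ⁻¹ - 1) * weightP s x z ^ 2 ≤ 1 / 2 * (Δ⁻¹ - 1) * (x / 2) ^ 2 := by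
        gcongr
      have e1 : 1 * (sinForm τ μ b + (μ - z) * β) + 2 * weightP s x z * cosForm τ μ b e =
          (sinForm τ μ b + 2 * (weightP s x z * cosForm τ μ b e) + weightP s x z ^ 2 * 0) +
            (μ - z) * β := by ring
      rw [e1]
      refine (abs_add_le _ _).trans ((add_le_add h1 h4).trans ?_)
      have e2 : β / (2 * Δ) = 1 / 2 * (Δ⁻¹ - 1) * β + 1 / 2 * β := by field_simp; ring
      rw [e2]
      linarith)
    (fun μ z hz => by
      have h1 := abs_cosForm_single_le h hΔ (by linarith) μ b k
      rw [← he, ← hβ, hy₁] at h1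
      have h2 := abs_weightQ_le (s := s) hx0 z
      rw [zero_mul, zero_add, abs_mul, abs_mul, abs_two]
      refine mul_le_mul ?_ h1 (abs_nonneg _) (by positivity)
      calc 2 * |weightQ s x z| ≤ 2 * (1 / (2 * x)) := by linarith
        _ = 1 / x := by field_simp)
    (abs_sinForm₂_single_le h hΔ hΔ1 · b k)
  rw [hy₂, ← hβ] at key
  have e1 : energyForm M p q s τ b e = ∑ n ∈ Finset.range (M + 1), q (node M n) +
      ∑ n ∈ Finset.range (M + 1), (p (node M n) * cosSum τ (node M n) b b +
        0 * (q (node M n) * cosSum τ (node M n) e e) -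
          2 * (s * node M n * p (node M n)) * sinSum τ (node M n) b e) := by
    rw [energyForm, ← Finset.sum_add_distrib]
    refine Finset.sum_congr rfl fun n _ => ?_
    rw [hcos]; ring
  rw [e1]
  -- the bound is a quadratic polynomial in the norm of `b`
  set w := √β with hw
  have hw2 : w ^ 2 = β := Real.sq_sqrt hβ0
  have hw0 : 0 ≤ w := Real.sqrt_nonneg _
  set T := 1 + 1.2456 * (x ^ 2 + 1 / 4) / (3 - 4 * Δ ^ 2) with hT
  have hv : 0 < 1 - x / 2 := by linarith
  have hslow : 2 * s * (w * (y / (2 * Δ ^ 2 * (3 - 4 * Δ ^ 2)))) * (ρ * (1 + 1 / (4 * x ^ 2))) ≤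
      w * y * (T - 1) := by
    calc _ ≤ 2 * (1.2456 * ρ) * (w * (y / (2 * Δ ^ 2 * (3 - 4 * Δ ^ 2)))) *
          (ρ * (1 + 1 / (4 * x ^ 2))) := by gcongr
      _ = w * y * (T - 1) := by
        rw [hT, hρx]
        generalize 3 - 4 * Δ ^ 2 = u at hu
        field_simp
        ring
  have hlin : (β / (2 * Δ) + 1 / 2 * (Δ⁻¹ - 1) * (x / 2) ^ 2 + 1 / x * (w * (y / Δ))) * ρ =
      x / 2 * w ^ 2 + x ^ 3 / 8 * (1 - Δ) + w * y := by
    rw [hρx, hw2]; field_simp; ring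
  have hquad : -((1 - Δ ^ 2) / 48 * T ^ 2 / (1 - x / 2)) ≤ (1 - x / 2) * w ^ 2 - w * y * T := by
    have h1 : (1 - Δ ^ 2) / 48 = y ^ 2 / 4 := by rw [hy2]; ring
    rw [h1, neg_le_iff_add_nonneg]
    have h2 : (1 - x / 2) * w ^ 2 - w * y * T + y ^ 2 / 4 * T ^ 2 / (1 - x / 2) =
        ((1 - x / 2) * w - y * T / 2) ^ 2 / (1 - x / 2) := by
      generalize 1 - x / 2 = v at hv
      field_simp
      ring
    rw [h2]
    positivity
  rw [hlin] at key
  rw [← hw2] at key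
  linarith

end forms
end FlatPair

/-! ### Complex amplitudes -/

section complexForms
variable {ι : Type*} [Fintype ι] {τ : ι → ℝ}

lemma sinSum_swap (f : ℝ) (b c : ι → ℝ) : sinSum τ f c b = -sinSum τ f b c := by
  simp only [sinSum]
  rw [Finset.sum_comm, ← Finset.sum_neg_distrib]
  refine Finset.sum_congr rfl fun k _ => ?_
  rw [← Finset.sum_neg_distrib]
  refine Finset.sum_congr rfl fun l _ => ?_
  have e1 : 2 * Real.pi * (τ l - τ k) * f = -(2 * Real.pi * (τ k - τ l) * f) := by ring
  rw [e1, Real.sin_neg]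
  ring

lemma sinSum_neg (f : ℝ) (b c : ι → ℝ) : sinSum τ (-f) b c = -sinSum τ f b c := by
  simp only [sinSum, ← Finset.sum_neg_distrib]
  refine Finset.sum_congr rfl fun k _ => Finset.sum_congr rfl fun l _ => ?_
  rw [mul_neg, Real.sin_neg]
  ring

lemma cosSum_neg (f : ℝ) (b c : ι → ℝ) : cosSum τ (-f) b c = cosSum τ f b c := by
  simp only [cosSum]
  refine Finset.sum_congr rfl fun k _ => Finset.sum_congr rfl fun l _ => ?_
  rw [mul_neg, Real.cos_neg]

lemma cosSum_add_mul (f r : ℝ) (b c : ι → ℝ) :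
    cosSum τ f (fun k => b k + r * c k) (fun k => b k + r * c k) =
      cosSum τ f b b + r * (cosSum τ f b c + cosSum τ f c b) + r ^ 2 * cosSum τ f c c := by
  simp only [cosSum, ← Finset.sum_add_distrib, Finset.mul_sum]
  refine Finset.sum_congr rfl fun k _ => Finset.sum_congr rfl fun l _ => ?_
  ring

lemma sinSum_add_mul (f r t : ℝ) (b c v w : ι → ℝ) :
    sinSum τ f (fun k => b k + r * c k) (fun k => v k + t * w k) =
      sinSum τ f b v + t * sinSum τ f b w + r * sinSum τ f c v + r * t * sinSum τ f c w := by
  simp only [sinSum, ← Finset.sum_add_distrib, Finset.mul_sum]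
  refine Finset.sum_congr rfl fun k _ => Finset.sum_congr rfl fun l _ => ?_
  ring

lemma norm_expSum_sq (f : ℝ) (z : ι → ℂ) :
    ‖∑ k, z k * Complex.exp (-(2 * Real.pi * τ k * f : ℝ) * Complex.I)‖ ^ 2 =
      cosSum τ f (fun k => (z k).re) (fun k => (z k).re) +
        cosSum τ f (fun k => (z k).im) (fun k => (z k).im) -
        2 * sinSum τ f (fun k => (z k).re) (fun k => (z k).im) := by
  have h1 : ((‖∑ k, z k * Complex.exp (-(2 * Real.pi * τ k * f : ℝ) * Complex.I)‖ ^ 2 : ℝ) : ℂ) =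
      ∑ k, ∑ l, starRingEnd ℂ (z k) * z l *
        Complex.exp ((2 * Real.pi * (τ k - τ l) * f : ℝ) * Complex.I) := by
    rw [← Complex.normSq_eq_norm_sq, ← Complex.mul_conj, mul_comm, map_sum, Finset.sum_mul_sum]
    refine Finset.sum_congr rfl fun k _ => Finset.sum_congr rfl fun l _ => ?_
    rw [map_mul, ← Complex.exp_conj, map_mul, Complex.conj_I, map_neg, Complex.conj_ofReal,
      mul_mul_mul_comm, ← Complex.exp_add]
    congr 2
    push_cast
    ring
  have h2 := congrArg Complex.re h1
  rw [Complex.ofReal_re] at h2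
  have h3 : 2 * sinSum τ f (fun k => (z k).re) (fun k => (z k).im) =
      sinSum τ f (fun k => (z k).re) (fun k => (z k).im) -
        sinSum τ f (fun k => (z k).im) (fun k => (z k).re) := by
    rw [sinSum_swap f (fun k => (z k).re) (fun k => (z k).im)]; ring
  rw [h2, h3]
  simp only [Complex.re_sum, cosSum, sinSum, ← Finset.sum_add_distrib, ← Finset.sum_sub_distrib]
  refine Finset.sum_congr rfl fun k _ => Finset.sum_congr rfl fun l _ => ?_
  rw [Complex.exp_mul_I, ← Complex.ofReal_cos, ← Complex.ofReal_sin]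
  simp only [Complex.mul_re, Complex.add_re, Complex.ofReal_re, Complex.I_re,
        Complex.I_im, Complex.ofReal_im, Complex.mul_im, Complex.add_im, Complex.conj_re,
        Complex.conj_im]
  ring

/-- The energy form for complex amplitudes: the sum of `p |F_b + i s f F_c|²` over the nodes, where
`F_b(f) = ∑ b_k e^{-2πiτ_k f}`. -/
noncomputable def energyFormC (M : ℕ) (p : ℝ → ℝ) (s : ℝ) (τ : ι → ℝ) (b c : ι → ℂ) : ℝ :=
  ∑ n ∈ Finset.range (M + 1), p (node M n) *
    ‖∑ k, (b k + Complex.I * (s * node M n : ℝ) * c k) *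
      Complex.exp (-(2 * Real.pi * τ k * node M n : ℝ) * Complex.I)‖ ^ 2

lemma node_reflect {M n : ℕ} (hn : n ≤ M) : node M (M - n) = -node M n := by
  simp only [node]; rw [Nat.cast_sub hn]; ring

lemma sum_node_odd (M : ℕ) (F : ℝ → ℝ) (hF : ∀ f, F (-f) = -F f) :
    ∑ n ∈ Finset.range (M + 1), F (node M n) = 0 := by
  have h1 := Finset.sum_range_reflect (fun n => F (node M n)) (M + 1)
  have h2 : ∑ n ∈ Finset.range (M + 1), F (node M (M + 1 - 1 - n)) =
      -∑ n ∈ Finset.range (M + 1), F (node M n) := by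
    rw [← Finset.sum_neg_distrib]
    refine Finset.sum_congr rfl fun n hn => ?_
    rw [Nat.add_sub_cancel, node_reflect (Nat.lt_succ_iff.mp (Finset.mem_range.mp hn)), hF]
  linarith

/-- By the symmetry of the spectrum, the real and the imaginary parts of the amplitudes do not
interact. -/
lemma FlatPair.energyFormC_eq {M : ℕ} {p q : ℝ → ℝ} {s ρ : ℝ} (H : FlatPair M p q s ρ)
    (b c : ι → ℂ) :
    energyFormC M p s τ b c =
      energyForm M p q s τ (fun k => (b k).re) (fun k => (c k).re) +
        energyForm M p q s τ (fun k => (b k).im) (fun k => (c k).im) := by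
  set b₁ : ι → ℝ := fun k => (b k).re with hb₁
  set b₂ : ι → ℝ := fun k => (b k).im with hb₂
  set c₁ : ι → ℝ := fun k => (c k).re with hc₁
  set c₂ : ι → ℝ := fun k => (c k).im with hc₂
  set O : ℝ → ℝ := fun f => p f * ((s * f) * (-(cosSum τ f b₁ c₂ + cosSum τ f c₂ b₁) +
    (cosSum τ f b₂ c₁ + cosSum τ f c₁ b₂)) - 2 * sinSum τ f b₁ b₂ +
      2 * (s * f) ^ 2 * sinSum τ f c₂ c₁) with hO
  have hodd := sum_node_odd M O (fun f => by
    simp only [hO, cosSum_neg, sinSum_neg, H.even]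
    ring)
  have hterm : ∀ n, p (node M n) * ‖∑ k, (b k + Complex.I * (s * node M n : ℝ) * c k) *
      Complex.exp (-(2 * Real.pi * τ k * node M n : ℝ) * Complex.I)‖ ^ 2 =
      (p (node M n) * cosSum τ (node M n) b₁ b₁ + q (node M n) * cosSum τ (node M n) c₁ c₁ -
        2 * (s * node M n * p (node M n)) * sinSum τ (node M n) b₁ c₁) +
      (p (node M n) * cosSum τ (node M n) b₂ b₂ + q (node M n) * cosSum τ (node M n) c₂ c₂ -
        2 * (s * node M n * p (node M n)) * sinSum τ (node M n) b₂ c₂) + O (node M n) := by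
    intro n
    have hre : (fun k => (b k + Complex.I * (s * node M n : ℝ) * c k).re) =
        fun k => b₁ k + -(s * node M n) * c₂ k := by
      funext k
      simp [hb₁, hc₂, -Complex.ofReal_mul]
    have him : (fun k => (b k + Complex.I * (s * node M n : ℝ) * c k).im) =
        fun k => b₂ k + (s * node M n) * c₁ k := by
      funext k
      simp [hb₂, hc₁, -Complex.ofReal_mul]
    rw [norm_expSum_sq, hre, him, cosSum_add_mul, cosSum_add_mul, sinSum_add_mul,
      sinSum_swap (node M n) b₂ c₂, hO, H.eq_mul]
    ring
  rw [energyFormC, Finset.sum_congr rfl fun n _ => hterm n, Finset.sum_add_distrib, hodd,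
    Finset.sum_add_distrib, add_zero]
  rfl

lemma energyFormC_real_mul (M : ℕ) (p : ℝ → ℝ) (s a : ℝ) (b c : ι → ℂ) :
    energyFormC M p s τ (fun k => a * b k) (fun k => a * c k) =
      a ^ 2 * energyFormC M p s τ b c := by
  rw [energyFormC, energyFormC, Finset.mul_sum]
  refine Finset.sum_congr rfl fun n _ => ?_
  have h1 : ∑ k, ((a : ℂ) * b k + Complex.I * (s * node M n : ℝ) * (a * c k)) *
      Complex.exp (-(2 * Real.pi * τ k * node M n : ℝ) * Complex.I) =
      a * ∑ k, (b k + Complex.I * (s * node M n : ℝ) * c k) *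
      Complex.exp (-(2 * Real.pi * τ k * node M n : ℝ) * Complex.I) := by
    rw [Finset.mul_sum]
    exact Finset.sum_congr rfl fun k _ => by ring
  rw [h1, norm_mul, Complex.norm_real, mul_pow, Real.norm_eq_abs, sq_abs]
  ring

lemma sum_norm_sq_eq (b : ι → ℂ) :
    ∑ k, ‖b k‖ ^ 2 = ∑ k, (b k).re ^ 2 + ∑ k, (b k).im ^ 2 := by
  rw [← Finset.sum_add_distrib]
  refine Finset.sum_congr rfl fun k _ => ?_
  rw [← Complex.normSq_eq_norm_sq, Complex.normSq_apply]
  ring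

end complexForms

namespace FlatPair
variable {M : ℕ} {p q : ℝ → ℝ} {s ρ : ℝ} {ι : Type*} [Fintype ι] [DecidableEq ι] {τ : ι → ℝ}
  {Δ : ℝ}

lemma energyForm_zero_right (b : ι → ℝ) : energyForm M p q s τ b 0 =
    ∑ n ∈ Finset.range (M + 1), p (node M n) * cosSum τ (node M n) b b := by
  simp [energyForm, cosSum, sinSum]

lemma energyForm_zero_left (c : ι → ℝ) : energyForm M p q s τ 0 c =
    ∑ n ∈ Finset.range (M + 1), q (node M n) * cosSum τ (node M n) c c := by
  simp [energyForm, cosSum, sinSum]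

lemma energyFormC_ge (H : FlatPair M p q s ρ) (h : Separated τ Δ) (hΔ : 0 < Δ) (hΔ1 : Δ ≤ 1)
    (b c : ι → ℂ) :
    (1 - √2 / 2 * (ρ / Δ) - 0.12975 * (ρ / Δ) ^ 2) * (∑ k, ‖b k‖ ^ 2 + ∑ k, ‖c k‖ ^ 2) ≤
      energyFormC M p s τ b c := by
  have h1 := H.energyForm_ge h hΔ hΔ1 (fun k => (b k).re) (fun k => (c k).re)
  have h2 := H.energyForm_ge h hΔ hΔ1 (fun k => (b k).im) (fun k => (c k).im)
  rw [H.energyFormC_eq, sum_norm_sq_eq, sum_norm_sq_eq]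
  linarith

lemma abs_energyFormC_zero_right_sub_le (H : FlatPair M p q s ρ) (h : Separated τ Δ) (hΔ : 0 < Δ)
    (hΔ1 : Δ ≤ 1) (b : ι → ℂ) :
    |energyFormC M p s τ b 0 - ∑ k, ‖b k‖ ^ 2| ≤ 1 / 2 * (ρ / Δ) * ∑ k, ‖b k‖ ^ 2 := by
  have h1 := H.abs_sum_p_cosSum_sub_le h hΔ hΔ1 (fun k => (b k).re)
  have h2 := H.abs_sum_p_cosSum_sub_le h hΔ hΔ1 (fun k => (b k).im)
  rw [← energyForm_zero_right (q := q) (s := s)] at h1 h2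
  have e : energyFormC M p s τ b 0 = energyForm M p q s τ (fun k => (b k).re) 0 +
      energyForm M p q s τ (fun k => (b k).im) 0 := H.energyFormC_eq b 0
  rw [e, sum_norm_sq_eq]
  rw [abs_le] at *
  constructor <;> linarith [h1.1, h1.2, h2.1, h2.2]

lemma energyFormC_zero_left_le (H : FlatPair M p q s ρ) (h : Separated τ Δ) (hΔ : 0 < Δ)
    (hΔ1 : Δ ≤ 1) (c : ι → ℂ) :
    energyFormC M p s τ 0 c ≤
      (∑ n ∈ Finset.range (M + 1), q (node M n) + 1 / 2 * (ρ / Δ) * (1 - Δ)) *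
        ∑ k, ‖c k‖ ^ 2 := by
  have h1 := H.sum_q_cosSum_le h hΔ hΔ1 (fun k => (c k).re)
  have h2 := H.sum_q_cosSum_le h hΔ hΔ1 (fun k => (c k).im)
  rw [← energyForm_zero_left (p := p) (s := s)] at h1 h2
  have e : energyFormC M p s τ 0 c = energyForm M p q s τ 0 (fun k => (c k).re) +
      energyForm M p q s τ 0 (fun k => (c k).im) := H.energyFormC_eq 0 c
  rw [e, sum_norm_sq_eq, mul_add]
  exact add_le_add h1 h2

lemma energyFormC_single_ge (H : FlatPair M p q s ρ) (h : Separated τ Δ) (hΔ : 0 < Δ)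
    (hΔ1 : Δ ≤ 1 / 2) (hρ : 0 < ρ) (hx : ρ / Δ < 2) (b : ι → ℂ) (k : ι) :
    ∑ n ∈ Finset.range (M + 1), q (node M n) -
      ((ρ / Δ) ^ 3 / 8 * (1 - Δ) + (1 - Δ ^ 2) / 48 *
        (1 + 1.2456 * ((ρ / Δ) ^ 2 + 1 / 4) / (3 - 4 * Δ ^ 2)) ^ 2 / (1 - ρ / Δ / 2)) ≤
      energyFormC M p s τ b (Pi.single k 1) := by
  have h1 := H.energyForm_single_ge h hΔ hΔ1 hρ hx (fun k => (b k).re) k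
  have h2 := H.abs_sum_p_cosSum_sub_le h hΔ (by linarith) (fun k => (b k).im)
  rw [← energyForm_zero_right (q := q) (s := s)] at h2
  have hre : (fun i => ((Pi.single k 1 : ι → ℂ) i).re) = Pi.single k 1 := by
    funext i; by_cases hi : i = k
    · subst hi; simp
    · simp [hi]
  have him : (fun i => ((Pi.single k 1 : ι → ℂ) i).im) = 0 := by
    funext i; by_cases hi : i = k
    · subst hi; simp
    · simp [hi]
  rw [H.energyFormC_eq, hre, him]
  have h3 : 0 ≤ ∑ k, (b k).im ^ 2 := by positivity
  have h4 := (abs_le.mp h2).1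
  have h5 : 0 ≤ (1 - 1 / 2 * (ρ / Δ)) * ∑ k, (b k).im ^ 2 := mul_nonneg (by linarith) h3
  linarith

/-- A single pulse: the amplitude and the location do not interact, by symmetry. -/
lemma energyFormC_ge_of_subsingleton [Subsingleton ι] (H : FlatPair M p q s ρ) (hΔ : 0 < Δ)
    (hΔ1 : Δ ≤ 1) (b c : ι → ℂ) :
    (1 - 1 / 2 * (ρ / Δ)) * (∑ k, ‖b k‖ ^ 2 + ∑ k, ‖c k‖ ^ 2) ≤ energyFormC M p s τ b c := by
  have h : Separated τ Δ := fun k l hkl => absurd (Subsingleton.elim k l) hkl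
  have hd := (abs_le.mp H.abs_sum_q_sub_one_le).1
  have hρ : ρ ≤ ρ / Δ := le_div_self H.rho_nonneg hΔ hΔ1
  have key : ∀ b c : ι → ℝ, (1 - 1 / 2 * (ρ / Δ)) * (∑ k, b k ^ 2 + ∑ k, c k ^ 2) ≤
      energyForm M p q s τ b c := by
    intro b c
    have h1 := (abs_le.mp (H.abs_sum_p_cosSum_sub_le h hΔ hΔ1 b)).1
    have hcos : ∀ f, cosSum τ f c c = ∑ k, c k ^ 2 := by
      intro f
      refine Finset.sum_congr rfl fun k _ => ?_
      rw [Finset.sum_eq_single k (fun l _ hl => absurd (Subsingleton.elim l k) hl) (by simp)]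
      simp [sq]
    have hsin : ∀ f, sinSum τ f b c = 0 := by
      intro f
      refine Finset.sum_eq_zero fun k _ => Finset.sum_eq_zero fun l _ => ?_
      simp [Subsingleton.elim k l]
    have e : energyForm M p q s τ b c =
        ∑ n ∈ Finset.range (M + 1), p (node M n) * cosSum τ (node M n) b b +
          (∑ n ∈ Finset.range (M + 1), q (node M n)) * ∑ k, c k ^ 2 := by
      rw [Finset.sum_mul, ← Finset.sum_add_distrib]
      refine Finset.sum_congr rfl fun n _ => ?_
      rw [hcos, hsin]; ring
    have h2 : (1 - 1 / 2 * (ρ / Δ)) * ∑ k, c k ^ 2 ≤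
        (∑ n ∈ Finset.range (M + 1), q (node M n)) * ∑ k, c k ^ 2 :=
      mul_le_mul_of_nonneg_right (by linarith) (by positivity)
    rw [e]
    linarith
  rw [H.energyFormC_eq, sum_norm_sq_eq, sum_norm_sq_eq]
  linarith [key (fun k => (b k).re) (fun k => (c k).re),
    key (fun k => (b k).im) (fun k => (c k).im)]

end FlatPair

/-! ### Coercivity of the linearized model -/

section schur
variable {ι κ : Type*} [Fintype ι] [Fintype κ] [DecidableEq ι]

lemma norm_adjoint_apply_sq_le {E F : Type*} [NormedAddCommGroup E] [InnerProductSpace ℂ E]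
    [CompleteSpace E] [NormedAddCommGroup F] [InnerProductSpace ℂ F] [CompleteSpace F]
    (V : E →L[ℂ] F) {β : ℝ} (hβ : 0 ≤ β) (hV : ∀ c, ‖V c‖ ^ 2 ≤ β * ‖c‖ ^ 2) (y : F) :
    ‖ContinuousLinearMap.adjoint V y‖ ^ 2 ≤ β * ‖y‖ ^ 2 := by
  have h1 : ‖V‖ ≤ √β := V.opNorm_le_bound (Real.sqrt_nonneg _) fun c => by
    rw [← Real.sqrt_sq (norm_nonneg c), ← Real.sqrt_mul hβ]
    exact Real.le_sqrt_of_sq_le (hV c)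
  have h2 : ‖ContinuousLinearMap.adjoint V y‖ ≤ √β * ‖y‖ := by
    refine (ContinuousLinearMap.le_opNorm _ _).trans ?_
    rw [LinearIsometryEquiv.norm_map]
    gcongr
  calc _ ≤ (√β * ‖y‖) ^ 2 := by gcongr
    _ = _ := by rw [mul_pow, Real.sq_sqrt hβ]

/-- If `‖V‖² ≤ β`, then `β - V†V` is small at every vector whose norm `V` nearly multiplies by
`√β`. -/
lemma norm_mul_sub_adjoint_sq_le {E F : Type*} [NormedAddCommGroup E] [InnerProductSpace ℂ E]
    [CompleteSpace E] [NormedAddCommGroup F] [InnerProductSpace ℂ F] [CompleteSpace F]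
    (V : E →L[ℂ] F) {β : ℝ} (hβ : 0 ≤ β) (hV : ∀ c, ‖V c‖ ^ 2 ≤ β * ‖c‖ ^ 2) (c : E) :
    ‖(β : ℂ) • c - ContinuousLinearMap.adjoint V (V c)‖ ^ 2 ≤
      β * (β * ‖c‖ ^ 2 - ‖V c‖ ^ 2) := by
  have h1 := norm_adjoint_apply_sq_le V hβ hV (V c)
  rw [@norm_sub_sq ℂ, norm_smul, Complex.norm_real, Real.norm_of_nonneg hβ, inner_smul_left,
    ContinuousLinearMap.adjoint_inner_right, inner_self_eq_norm_sq_to_K]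
  have h2 : RCLike.re ((starRingEnd ℂ) (β : ℂ) * ((‖V c‖ : ℂ)) ^ 2) = β * ‖V c‖ ^ 2 := by
    rw [Complex.conj_ofReal]
    norm_cast
  erw [h2]
  nlinarith

lemma sum_mul_mul_le_sum_sq_mul {w : ι → ι → ℝ} (hw : ∀ k j, 0 ≤ w k j)
    (hsymm : ∀ k j, w k j = w j k) (δ : ι → ℝ) :
    ∑ k, ∑ j, |δ k| * |δ j| * w k j ≤ ∑ k, δ k ^ 2 * ∑ j, w k j := by
  have h1 : ∑ k, ∑ j, |δ k| * |δ j| * w k j ≤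
      ∑ k, ∑ j, (1 / 2 * (δ k ^ 2 * w k j) + 1 / 2 * (δ j ^ 2 * w j k)) := by
    refine Finset.sum_le_sum fun k _ => Finset.sum_le_sum fun j _ => ?_
    rw [hsymm j k, ← sq_abs (δ k), ← sq_abs (δ j)]
    nlinarith [mul_nonneg (sq_nonneg (|δ k| - |δ j|)) (hw k j)]
  refine h1.trans (le_of_eq ?_)
  simp only [Finset.sum_add_distrib, ← Finset.mul_sum]
  rw [Finset.sum_comm (f := fun k j => δ j ^ 2 * w j k)]
  simp only [← Finset.mul_sum]
  ring

/-- Coercivity of the map `δ ↦ V diag(δ) X`, for real `δ`, when `V†V` is close to a multiple of the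
identity: the off-diagonal part is estimated by Schur's test against the Gram matrix of `X`. -/
lemma sum_norm_sq_ge_of_diag {F : Type*} [NormedAddCommGroup F] [InnerProductSpace ℂ F]
    [CompleteSpace F] (V : EuclideanSpace ℂ ι →L[ℂ] F) (X : Matrix ι κ ℂ) {β e m C : ℝ}
    (hβ : 0 ≤ β) (he : 0 ≤ e) (hV : ∀ c, ‖V c‖ ^ 2 ≤ β * ‖c‖ ^ 2)
    (hdiag : ∀ k, (1 - e ^ 2) * β ≤ ‖V (EuclideanSpace.single k 1)‖ ^ 2)
    (hm : ∀ k, m ≤ ∑ l, ‖X k l‖ ^ 2) (hY : ∀ k, √(∑ j, ‖(X * Xᴴ) j k‖ ^ 2) ≤ C) (δ : ι → ℝ) :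
    β * (m - e * C) * ∑ k, δ k ^ 2 ≤
      ∑ l, ‖V (WithLp.toLp 2 fun k => (δ k : ℂ) * X k l)‖ ^ 2 := by
  set W : EuclideanSpace ℂ ι →L[ℂ] EuclideanSpace ℂ ι :=
    (β : ℂ) • ContinuousLinearMap.id ℂ _ - (ContinuousLinearMap.adjoint V).comp V with hW
  have hWapp : ∀ c, W c = (β : ℂ) • c - ContinuousLinearMap.adjoint V (V c) := fun c => rfl
  set B : ι → ι → ℂ := fun k j => inner ℂ (EuclideanSpace.single k (1 : ℂ))
    (W (EuclideanSpace.single j 1)) with hB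
  have hBcoord : ∀ k j, B k j = W (EuclideanSpace.single j 1) k := by
    intro k j
    rw [hB]
    simp only [EuclideanSpace.inner_single_left, map_one, one_mul]
  have hBsymm : ∀ k j, B k j = starRingEnd ℂ (B j k) := by
    intro k j
    simp only [hB, hWapp, inner_sub_right, inner_smul_right,
      ContinuousLinearMap.adjoint_inner_right]
    rw [map_sub, map_mul, inner_conj_symm, inner_conj_symm, Complex.conj_ofReal]
  have hBcol : ∀ k, ∑ j, ‖B k j‖ ^ 2 ≤ (e * β) ^ 2 := by
    intro k
    have h1 : ∑ j, ‖B k j‖ ^ 2 = ‖W (EuclideanSpace.single k 1)‖ ^ 2 := by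
      rw [EuclideanSpace.norm_sq_eq]
      refine Finset.sum_congr rfl fun j _ => ?_
      rw [hBsymm, RCLike.norm_conj, hBcoord]
    rw [h1, hWapp]
    refine (norm_mul_sub_adjoint_sq_le V hβ hV _).trans ?_
    rw [PiLp.norm_single, norm_one]
    nlinarith [hdiag k]
  -- the quadratic form of `W`
  have hquad : ∀ c : EuclideanSpace ℂ ι, ((β * ‖c‖ ^ 2 - ‖V c‖ ^ 2 : ℝ) : ℂ) =
      ∑ k, ∑ j, starRingEnd ℂ (c k) * c j * B k j := by
    intro c
    have h1 : ((β * ‖c‖ ^ 2 - ‖V c‖ ^ 2 : ℝ) : ℂ) = inner ℂ c (W c) := by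
      rw [hWapp, inner_sub_right, inner_smul_right, ContinuousLinearMap.adjoint_inner_right,
        inner_self_eq_norm_sq_to_K, inner_self_eq_norm_sq_to_K]
      push_cast
      rfl
    have h2 : c = ∑ j, c j • EuclideanSpace.single j (1 : ℂ) := by
      ext i
      simp [Finset.sum_apply, Pi.single_apply]
    rw [h1]
    conv_lhs => rw [h2]
    rw [sum_inner, map_sum]
    refine Finset.sum_congr rfl fun k _ => ?_
    rw [inner_sum]
    refine Finset.sum_congr rfl fun j _ => ?_
    rw [inner_smul_left, map_smul, inner_smul_right, hB]
    ring
  set c : κ → EuclideanSpace ℂ ι := fun l => WithLp.toLp 2 fun k => (δ k : ℂ) * X k l with hc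
  have hY' : ∀ k j, (X * Xᴴ) j k = ∑ l, starRingEnd ℂ (X k l) * X j l := by
    intro k j
    simp only [Matrix.mul_apply, Matrix.conjTranspose_apply, RCLike.star_def]
    exact Finset.sum_congr rfl fun l _ => mul_comm _ _
  have hYsymm : ∀ k j, ‖(X * Xᴴ) j k‖ = ‖(X * Xᴴ) k j‖ := by
    intro k j
    rw [hY', hY', ← RCLike.norm_conj, map_sum]
    congr 1
    refine Finset.sum_congr rfl fun l _ => ?_
    rw [map_mul, RCLike.conj_conj, mul_comm]
  have hsum : ((∑ l, (β * ‖c l‖ ^ 2 - ‖V (c l)‖ ^ 2) : ℝ) : ℂ) =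
      ∑ k, ∑ j, ((δ k * δ j : ℝ) : ℂ) * (B k j * (X * Xᴴ) j k) := by
    rw [Complex.ofReal_sum]
    simp only [hquad]
    rw [Finset.sum_comm]
    refine Finset.sum_congr rfl fun k _ => ?_
    rw [Finset.sum_comm]
    refine Finset.sum_congr rfl fun j _ => ?_
    rw [hY', Finset.mul_sum, Finset.mul_sum]
    refine Finset.sum_congr rfl fun l _ => ?_
    simp only [hc, map_mul, Complex.conj_ofReal]
    push_cast
    ring
  have hle : ∑ l, (β * ‖c l‖ ^ 2 - ‖V (c l)‖ ^ 2) ≤ e * β * C * ∑ k, δ k ^ 2 := by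
    calc ∑ l, (β * ‖c l‖ ^ 2 - ‖V (c l)‖ ^ 2)
        ≤ ‖((∑ l, (β * ‖c l‖ ^ 2 - ‖V (c l)‖ ^ 2) : ℝ) : ℂ)‖ := by
          rw [Complex.norm_real]; exact le_abs_self _
      _ ≤ ∑ k, ∑ j, |δ k| * |δ j| * (‖B k j‖ * ‖(X * Xᴴ) j k‖) := by
          rw [hsum]
          refine (norm_sum_le _ _).trans (Finset.sum_le_sum fun k _ => ?_)
          refine (norm_sum_le _ _).trans (Finset.sum_le_sum fun j _ => ?_)
          rw [norm_mul, norm_mul, Complex.norm_real, Real.norm_eq_abs, abs_mul]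
      _ ≤ ∑ k, δ k ^ 2 * ∑ j, ‖B k j‖ * ‖(X * Xᴴ) j k‖ :=
          sum_mul_mul_le_sum_sq_mul (fun _ _ => by positivity)
            (fun k j => by rw [hYsymm, hBsymm, RCLike.norm_conj]) δ
      _ ≤ ∑ k, δ k ^ 2 * (e * β * C) := by
          refine Finset.sum_le_sum fun k _ => mul_le_mul_of_nonneg_left ?_ (sq_nonneg _)
          refine (Real.sum_mul_le_sqrt_mul_sqrt _ _ _).trans ?_
          refine mul_le_mul ?_ (hY k) (Real.sqrt_nonneg _) (by positivity)
          exact Real.sqrt_le_iff.mpr ⟨by positivity, hBcol k⟩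
      _ = e * β * C * ∑ k, δ k ^ 2 := by rw [← Finset.sum_mul, mul_comm]
  have hlow : m * ∑ k, δ k ^ 2 ≤ ∑ l, ‖c l‖ ^ 2 := by
    simp only [hc, EuclideanSpace.norm_sq_eq, norm_mul, mul_pow, Complex.norm_real,
      Real.norm_eq_abs, sq_abs]
    rw [Finset.sum_comm, Finset.mul_sum]
    refine Finset.sum_le_sum fun k _ => ?_
    rw [← Finset.mul_sum, mul_comm]
    exact mul_le_mul_of_nonneg_left (hm k) (sq_nonneg _)
  rw [Finset.sum_sub_distrib, ← Finset.mul_sum] at hle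
  nlinarith [mul_le_mul_of_nonneg_left hlow hβ]

end schur

lemma Separated.le_half {ι : Type*} {τ : ι → ℝ} {Δ : ℝ} (h : Separated τ Δ) {k l : ι}
    (hkl : k ≠ l) : Δ ≤ 1 / 2 := by
  have h1 := h k l hkl (-round (τ k - τ l))
  push_cast at h1
  rw [← sub_eq_add_neg] at h1
  exact h1.trans (abs_sub_round _)

section projected
variable {E F : Type*} [NormedAddCommGroup E] [InnerProductSpace ℂ E] [FiniteDimensional ℂ E]
  [NormedAddCommGroup F] [InnerProductSpace ℂ F]

/-- The component of `D c` orthogonal to the range of `A`. -/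
noncomputable def orthogonalPart (A D : E →ₗ[ℂ] F) : E →L[ℂ] F :=
  (LinearMap.range A)ᗮ.starProjection ∘L D.toContinuousLinearMap

lemma exists_orthogonalPart_eq (A D : E →ₗ[ℂ] F) (c : E) :
    ∃ b, orthogonalPart A D c = -(A b - D c) := by
  obtain ⟨b, hb⟩ := (LinearMap.range A).starProjection_apply_mem (D c)
  refine ⟨b, ?_⟩
  rw [hb]
  change (LinearMap.range A)ᗮ.starProjection (D c) = _
  rw [Submodule.starProjection_orthogonal_val]
  abel

lemma norm_orthogonalPart_le (A D : E →ₗ[ℂ] F) (c b : E) :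
    ‖orthogonalPart A D c‖ ≤ ‖D c + A b‖ := by
  have h : orthogonalPart A D c = (LinearMap.range A)ᗮ.starProjection (D c + A b) := by
    rw [map_add, Submodule.starProjection_orthogonal_apply_eq_zero (LinearMap.mem_range_self A b),
      add_zero]
    rfl
  rw [h]
  exact Submodule.norm_starProjection_apply_le _ _

end projected

namespace FlatPair
variable {M : ℕ} {p q : ℝ → ℝ} {s ρ : ℝ} {ι κ : Type*} [Fintype ι] [Fintype κ] [DecidableEq ι]
  {τ : ι → ℝ} {Δ : ℝ}

/-- A lower bound for the energy form on all vectors bounds the linearized model column by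
column. -/
lemma _root_.PulseLocation.sum_norm_orthogonalPart_sq_ge {F : Type*} [NormedAddCommGroup F]
    [InnerProductSpace ℂ F] {E₀ E₁ m r S x lam : ℝ} (hE₁ : 0 < E₁) (hm : 0 < m) (hr : 1 ≤ r)
    (hS : m ≤ S) (hx0 : 0 ≤ x) (hxr : 2 / 3 * x * r < 1) (X : Matrix ι κ ℂ)
    (hXm : ∀ k, m ≤ ∑ l, ‖X k l‖ ^ 2) (A D : EuclideanSpace ℂ ι →ₗ[ℂ] F)
    (hAD : ∀ b c, ‖A b - D c‖ ^ 2 =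
      energyFormC M p s τ (fun k => (√E₀ : ℂ) * b k) (fun k => (√E₁ : ℂ) * c k))
    (hlam : (1 - 2 / 3 * x) ^ 2 ≤ (1 + 2 / 3 * x) * lam)
    (hform : ∀ b c : ι → ℂ, lam * (∑ k, ‖b k‖ ^ 2 + ∑ k, ‖c k‖ ^ 2) ≤ energyFormC M p s τ b c)
    (δ : ι → ℝ) :
    E₁ * (m ^ 2 * (1 - 2 / 3 * x * r) ^ 2 / (S * (1 + 2 / 3 * x))) * ∑ k, δ k ^ 2 ≤
      ∑ l, ‖orthogonalPart A D (WithLp.toLp 2 fun k => (δ k : ℂ) * X k l)‖ ^ 2 := by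
  have hδ : 0 ≤ ∑ k, δ k ^ 2 := by positivity
  have hSpos : 0 < S := hm.trans_le hS
  set V := orthogonalPart A D with hV
  set c : κ → EuclideanSpace ℂ ι := fun l => WithLp.toLp 2 fun k => (δ k : ℂ) * X k l with hc
  have hlam0 : 0 ≤ lam := by
    by_contra hneg
    rw [not_le] at hneg
    nlinarith [sq_nonneg (1 - 2 / 3 * x)]
  have h1 : ∀ c : EuclideanSpace ℂ ι, E₁ * lam * ∑ k, ‖c k‖ ^ 2 ≤ ‖V c‖ ^ 2 := by
    intro c
    obtain ⟨b, hb⟩ := exists_orthogonalPart_eq A D c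
    rw [← hV] at hb
    rw [hb, norm_neg, hAD]
    refine le_trans ?_ (hform _ _)
    have h2 : ∑ k, ‖(√E₁ : ℂ) * c k‖ ^ 2 = E₁ * ∑ k, ‖c k‖ ^ 2 := by
      rw [Finset.mul_sum]
      refine Finset.sum_congr rfl fun k _ => ?_
      rw [norm_mul, mul_pow, Complex.norm_real, Real.norm_eq_abs, sq_abs, Real.sq_sqrt hE₁.le]
    have h3 : 0 ≤ lam * ∑ k, ‖(√E₀ : ℂ) * b k‖ ^ 2 := by positivity
    rw [h2]
    linarith
  have h2 : E₁ * lam * (m * ∑ k, δ k ^ 2) ≤ ∑ l, ‖V (c l)‖ ^ 2 := by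
    refine le_trans ?_ (Finset.sum_le_sum fun l _ => h1 (c l))
    rw [← Finset.mul_sum]
    refine mul_le_mul_of_nonneg_left ?_ (by positivity)
    simp only [hc, norm_mul, mul_pow, Complex.norm_real, Real.norm_eq_abs, sq_abs]
    rw [Finset.sum_comm, Finset.mul_sum]
    refine Finset.sum_le_sum fun k _ => ?_
    rw [← Finset.mul_sum, mul_comm]
    exact mul_le_mul_of_nonneg_left (hXm k) (sq_nonneg _)
  refine le_trans ?_ h2
  rw [mul_assoc E₁ lam, ← mul_assoc lam, ← mul_assoc E₁]
  refine mul_le_mul_of_nonneg_right (mul_le_mul_of_nonneg_left ?_ hE₁.le) hδ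
  rw [div_le_iff₀ (by positivity)]
  have h4 : (1 - 2 / 3 * x * r) ^ 2 ≤ (1 - 2 / 3 * x) ^ 2 :=
    pow_le_pow_left₀ (by linarith) (by nlinarith) 2
  have h5 : m * (1 - 2 / 3 * x * r) ^ 2 ≤ S * ((1 + 2 / 3 * x) * lam) :=
    mul_le_mul hS (h4.trans hlam) (sq_nonneg _) hSpos.le
  nlinarith

set_option maxHeartbeats 400000 in
/-- Coercivity of the linearized model `(δ, B) ↦ D diag(δ) X + A B`, whose quadratic form is the
energy form. For small `ρ/Δ`, and for a single pulse, the energy form bounds each column. For larger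
`ρ/Δ`, there are at least two pulses, so `Δ ≤ 1/2`, and the sharper bounds for coordinate vectors
are combined by Schur's test. -/
lemma coercive {F : Type*} [NormedAddCommGroup F] [InnerProductSpace ℂ F] [CompleteSpace F]
    (H : FlatPair M p q s ρ) (h : Separated τ Δ) (hΔ : 0 < Δ) (hΔ1 : Δ ≤ 1)
    {E₀ E₁ m r S : ℝ} (hE₁ : 0 < E₁) (hm : 0 < m) (hr : 1 ≤ r)
    (hS : m ≤ S) (hΔr : 2 / 3 * (ρ / Δ) * r < 1) (X : Matrix ι κ ℂ)
    (hXm : ∀ k, m ≤ ∑ l, ‖X k l‖ ^ 2) (hXr : ∀ k, √(∑ j, ‖(X * Xᴴ) j k‖ ^ 2) ≤ r * m)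
    (A D : EuclideanSpace ℂ ι →ₗ[ℂ] F)
    (hAD : ∀ b c, ‖A b - D c‖ ^ 2 =
      energyFormC M p s τ (fun k => (√E₀ : ℂ) * b k) (fun k => (√E₁ : ℂ) * c k))
    (δ : ι → ℝ) (B : κ → EuclideanSpace ℂ ι) :
    E₁ * (m ^ 2 * (1 - 2 / 3 * (ρ / Δ) * r) ^ 2 / (S * (1 + 2 / 3 * (ρ / Δ)))) * ∑ k, δ k ^ 2 ≤
      ∑ l, ‖D (WithLp.toLp 2 fun k => (δ k : ℂ) * X k l) + A (B l)‖ ^ 2 := by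
  have hρ := H.rho_nonneg
  obtain ⟨x, hxdef⟩ : ∃ x, x = ρ / Δ := ⟨_, rfl⟩
  have hρx : ρ = x * Δ := by rw [hxdef]; field_simp
  have hx0 : 0 ≤ x := by rw [hxdef]; positivity
  have hx15 : x < 1.5 := by rw [← hxdef] at hΔr; norm_num; nlinarith
  rw [← hxdef] at hΔr ⊢
  set V := orthogonalPart A D with hV
  set c : κ → EuclideanSpace ℂ ι := fun l => WithLp.toLp 2 fun k => (δ k : ℂ) * X k l with hc
  have hδ : 0 ≤ ∑ k, δ k ^ 2 := by positivity
  have hSpos : 0 < S := hm.trans_le hS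
  have hVle : ∑ l, ‖V (c l)‖ ^ 2 ≤ ∑ l, ‖D (c l) + A (B l)‖ ^ 2 :=
    Finset.sum_le_sum fun l _ =>
      pow_le_pow_left₀ (norm_nonneg _) (norm_orthogonalPart_le A D (c l) (B l)) 2
  refine le_trans ?_ hVle
  have hcol := fun lam => sum_norm_orthogonalPart_sq_ge (M := M) (p := p) (s := s) (τ := τ)
    (lam := lam) hE₁ hm hr hS hx0 hΔr X hXm A D hAD
  rcases le_or_gt x 1.12 with hx | hx
  · refine hcol _ (sq_one_sub_le_of_le hx0 hx) (fun b c => ?_) δ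
    have := H.energyFormC_ge h hΔ hΔ1 b c
    rwa [← hxdef] at this
  rcases subsingleton_or_nontrivial ι with hι | hι
  · refine hcol (1 - 1 / 2 * x) (by nlinarith [mul_nonneg hx0 (sub_nonneg.mpr hx15.le)])
      (fun b c => ?_) δ
    have := H.energyFormC_ge_of_subsingleton (τ := τ) hΔ hΔ1 b c
    rwa [← hxdef] at this
  clear hcol
  obtain ⟨k₀, l₀, hkl⟩ := exists_pair_ne ι
  have hΔ2 := h.le_half hkl
  have hρ0 : 0 < ρ := by rw [hρx]; nlinarith
  set d := ∑ n ∈ Finset.range (M + 1), q (node M n) with hd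
  have hd1 := (abs_le.mp H.abs_sum_q_sub_one_le).1
  rw [← hd] at hd1
  set b₀ := d + 1 / 2 * x * (1 - Δ) with hb₀
  have hb₀1 : 1 + x / 2 - x * Δ ≤ b₀ := by rw [hb₀]; linarith
  have hb₀2 : 1 ≤ b₀ := by nlinarith
  have hdef := diagonal_defect_le hx.le hx15 hΔ.le hΔ2
  have hupper : ∀ c, ‖V c‖ ^ 2 ≤ E₁ * b₀ * ‖c‖ ^ 2 := by
    intro c
    have h1 := norm_orthogonalPart_le A D c 0
    have h2 := H.energyFormC_zero_left_le h hΔ hΔ1 (fun k => (√E₁ : ℂ) * c k)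
    have h3 := hAD 0 c
    simp only [map_zero, zero_sub, norm_neg, WithLp.ofLp_zero, Pi.zero_apply, mul_zero] at h3
    rw [map_zero, add_zero] at h1
    have h4 : ∑ k, ‖(√E₁ : ℂ) * c k‖ ^ 2 = E₁ * ‖c‖ ^ 2 := by
      rw [EuclideanSpace.norm_sq_eq, Finset.mul_sum]
      refine Finset.sum_congr rfl fun k _ => ?_
      rw [norm_mul, mul_pow, Complex.norm_real, Real.norm_eq_abs, sq_abs, Real.sq_sqrt hE₁.le]
    rw [← hxdef, ← hd, ← hb₀, h4] at h2
    have h5 : ‖D c‖ ^ 2 ≤ b₀ * (E₁ * ‖c‖ ^ 2) := by rw [h3]; exact h2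
    calc ‖V c‖ ^ 2 ≤ ‖D c‖ ^ 2 := pow_le_pow_left₀ (norm_nonneg _) h1 2
      _ ≤ _ := h5.trans (le_of_eq (by ring))
  have hdiag : ∀ k, (1 - (2 / 3 * x) ^ 2) * (E₁ * b₀) ≤ ‖V (EuclideanSpace.single k 1)‖ ^ 2 := by
    intro k
    obtain ⟨b, hb⟩ := exists_orthogonalPart_eq A D (EuclideanSpace.single k 1)
    rw [← hV] at hb
    rw [hb, norm_neg, hAD]
    have hs0 : (√E₁ : ℂ) ≠ 0 := by
      rw [Complex.ofReal_ne_zero]; exact (Real.sqrt_pos.mpr hE₁).ne'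
    have h1 : (fun k => (√E₀ : ℂ) * b k) =
        fun k => (√E₁ : ℂ) * ((√E₀ : ℂ) / (√E₁ : ℂ) * b k) := by
      funext k; field_simp
    have h2 : (fun i => (√E₁ : ℂ) * (EuclideanSpace.single k (1 : ℂ) : EuclideanSpace ℂ ι) i) =
        fun i => (√E₁ : ℂ) * (Pi.single k 1 : ι → ℂ) i := by
      funext i; simp [Pi.single_apply]
    rw [h1, h2, energyFormC_real_mul, Real.sq_sqrt hE₁.le]
    have h3 := H.energyFormC_single_ge h hΔ hΔ2 hρ0 (by rw [← hxdef]; norm_num at hx15; linarith)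
      (fun k => (√E₀ : ℂ) / (√E₁ : ℂ) * b k) k
    rw [← hxdef, ← hd] at h3
    have h4 : (1 - (2 / 3 * x) ^ 2) * b₀ ≤ d - (x ^ 3 / 8 * (1 - Δ) + (1 - Δ ^ 2) / 48 *
      (1 + 1.2456 * (x ^ 2 + 1 / 4) / (3 - 4 * Δ ^ 2)) ^ 2 / (1 - x / 2)) := by
      have := mul_le_mul_of_nonneg_left hb₀1 (sq_nonneg (2 / 3 * x))
      linarith
    calc (1 - (2 / 3 * x) ^ 2) * (E₁ * b₀) = E₁ * ((1 - (2 / 3 * x) ^ 2) * b₀) := by ring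
      _ ≤ _ := mul_le_mul_of_nonneg_left (h4.trans h3) hE₁.le
  refine le_trans ?_ (sum_norm_sq_ge_of_diag V X (β := E₁ * b₀) (e := 2 / 3 * x) (m := m)
    (C := r * m) (by positivity) (by positivity) hupper hdiag hXm hXr δ)
  refine mul_le_mul_of_nonneg_right ?_ hδ
  rw [mul_assoc E₁ b₀]
  refine mul_le_mul_of_nonneg_left ?_ hE₁.le
  have hw : 0 < 1 - 2 / 3 * x * r := by linarith
  have hw1 : 1 - 2 / 3 * x * r ≤ 1 := by
    have : 0 ≤ 2 / 3 * x * r := by positivity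
    linarith
  rw [div_le_iff₀ (by positivity)]
  have h1 : m - 2 / 3 * x * (r * m) = m * (1 - 2 / 3 * x * r) := by ring
  rw [h1]
  generalize 1 - 2 / 3 * x * r = w at hw hw1
  calc m ^ 2 * w ^ 2 = (m * w) * (m * w) := by ring
    _ ≤ (m * w) * (S * 1) := by
      refine mul_le_mul_of_nonneg_left ?_ (by positivity)
      rw [mul_one]
      exact (mul_le_of_le_one_right hm.le hw1).trans hS
    _ ≤ (b₀ * (m * w)) * (S * (1 + 2 / 3 * x)) := by
      refine mul_le_mul ?_ ?_ (by positivity) (by positivity)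
      · exact le_mul_of_one_le_left (by positivity) hb₀2
      · exact mul_le_mul_of_nonneg_left (by linarith) hSpos.le

end FlatPair

/-! ### Differentiability of least squares estimates -/

section leastSquares
variable {P W : Type*} [NormedAddCommGroup P] [NormedSpace ℝ P] [FiniteDimensional ℝ P]
  [NormedAddCommGroup W] [InnerProductSpace ℝ W]

/-- A convergent family of least squares solutions of a model `F` with injective derivative `T` is
differentiable, and its derivative is the pseudoinverse `R` of `T`. No regularity of `F` beyond
differentiability at one point is needed: the solutions are compared with the linearized ones. -/
theorem hasFDerivAt_of_forall_norm_sub_le {F : P → W} {T : P →L[ℝ] W} {θ₀ : P}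
    (hF : HasFDerivAt F T θ₀) (hT : Function.Injective T) {θ : W → P}
    (hθ : Tendsto θ (𝓝 0) (𝓝 θ₀))
    (hmin : ∀ᶠ z in 𝓝 (0 : W), ∀ θ', ‖F (θ z) - F θ₀ - z‖ ≤ ‖F θ' - F θ₀ - z‖) (R : W →L[ℝ] P)
    (hR : ∀ z, T (R z) = (LinearMap.range (T : P →ₗ[ℝ] W)).starProjection z) :
    HasFDerivAt θ R 0 := by
  obtain ⟨C, hC, hanti⟩ := (T : P →ₗ[ℝ] W).exists_antilipschitzWith (LinearMap.ker_eq_bot.mpr hT)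
  have hCT : ∀ v, ‖v‖ ≤ C * ‖T v‖ := fun v => by
    have := hanti.le_mul_dist v 0
    simpa using this
  have hC0 : (0 : ℝ) < C := hC
  set h : W → P := fun z => θ z - θ₀ with hh
  set r₁ : W → W := fun z => F (θ z) - F θ₀ - T (h z) with hr₁
  set r₂ : W → W := fun z => F (θ₀ + R z) - F θ₀ - T (R z) with hr₂
  have ho₁ : r₁ =o[𝓝 0] h := hF.isLittleO.comp_tendsto hθ
  have htend : Tendsto (fun z => θ₀ + R z) (𝓝 0) (𝓝 θ₀) := by
    have : Continuous fun z => θ₀ + R z := by fun_prop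
    simpa using this.tendsto 0
  have ho₂ : r₂ =o[𝓝 0] (fun z : W => z) := by
    have h1 := hF.isLittleO.comp_tendsto htend
    have h2 : r₂ =o[𝓝 0] (fun z => R z) := by
      refine (h1.congr (fun z => ?_) (fun z => ?_))
      · simp [hr₂]
      · simp
    exact h2.trans_isBigO (R.isBigO_id _)
  set Q := (LinearMap.range (T : P →ₗ[ℝ] W)) with hQ
  have hproj : ∀ z, ‖T (R z) - z‖ ≤ ‖z‖ := by
    intro z
    rw [hR, norm_sub_rev, ← Submodule.starProjection_orthogonal_val]
    exact Submodule.norm_starProjection_apply_le _ _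
  have hpyth : ∀ z, ‖T (h z) - z‖ ^ 2 = ‖T (h z) - T (R z)‖ ^ 2 + ‖T (R z) - z‖ ^ 2 := by
    intro z
    have h1 : T (h z) - z = (T (h z) - T (R z)) + (T (R z) - z) := by abel
    rw [h1, sq, sq, sq]
    refine norm_add_sq_eq_norm_sq_add_norm_sq_real ?_
    have h2 := Submodule.starProjection_inner_eq_zero (K := Q) z (T (h z - R z))
      (LinearMap.mem_range_self (T : P →ₗ[ℝ] W) _)
    rw [← map_sub, real_inner_comm, hR, ← neg_sub z, inner_neg_left, h2, neg_zero]
  have hkey : ∀ᶠ z in 𝓝 (0 : W), ‖T (h z) - z‖ ≤ ‖T (R z) - z‖ + (‖r₁ z‖ + ‖r₂ z‖) := by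
    filter_upwards [hmin] with z hz
    have h1 := hz (θ₀ + R z)
    have e1 : F (θ z) - F θ₀ - z = T (h z) - z + r₁ z := by simp only [hr₁]; abel
    have e2 : F (θ₀ + R z) - F θ₀ - z = T (R z) - z + r₂ z := by simp only [hr₂]; abel
    rw [e1, e2] at h1
    have h2 : ‖T (h z) - z‖ ≤ ‖T (h z) - z + r₁ z‖ + ‖r₁ z‖ := by
      simpa using norm_sub_le (T (h z) - z + r₁ z) (r₁ z)
    have h3 := norm_add_le (T (R z) - z) (r₂ z)
    linarith
  have hO : h =O[𝓝 0] (fun z : W => z) := by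
    refine Asymptotics.IsBigO.of_bound (6 * C) ?_
    filter_upwards [hkey, ho₁.bound (show (0 : ℝ) < 1 / (2 * C) by positivity), ho₂.bound one_pos]
      with z h1 h2 h3
    have h4 := hCT (h z)
    have h5 : ‖T (h z)‖ ≤ ‖T (h z) - z‖ + ‖z‖ := by
      simpa using norm_add_le (T (h z) - z) z
    have h6 := hproj z
    have h7 : ‖T (h z)‖ ≤ 3 * ‖z‖ + 1 / (2 * C) * ‖h z‖ := by linarith
    have h8 : C * (1 / (2 * C) * ‖h z‖) = ‖h z‖ / 2 := by field_simp
    nlinarith [mul_le_mul_of_nonneg_left h7 hC0.le]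
  have ho : (fun z => ‖r₁ z‖ + ‖r₂ z‖) =o[𝓝 0] (fun z : W => z) :=
    (ho₁.trans_isBigO hO).norm_left.add ho₂.norm_left
  have hfinal : (fun z => h z - R z) =o[𝓝 0] (fun z : W => z) := by
    refine Asymptotics.IsLittleO.of_bound fun c hc => ?_
    have hη : 0 < min 1 ((c / C) ^ 2 / 3) := lt_min one_pos (by positivity)
    filter_upwards [hkey, ho.bound hη] with z h1 h2
    set ε := ‖r₁ z‖ + ‖r₂ z‖ with hε
    have hε0 : 0 ≤ ε := by positivity
    rw [Real.norm_of_nonneg hε0] at h2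
    have h3 := hproj z
    have h4 : ε ≤ ‖z‖ := h2.trans (mul_le_of_le_one_left (norm_nonneg _) (min_le_left _ _))
    have h5 : 3 * ε ≤ (c / C) ^ 2 * ‖z‖ := by
      have := mul_le_mul_of_nonneg_right (min_le_right 1 ((c / C) ^ 2 / 3)) (norm_nonneg z)
      linarith
    have h6 : ‖T (h z) - T (R z)‖ ^ 2 ≤ (c / C * ‖z‖) ^ 2 := by
      have h7 := pow_le_pow_left₀ (norm_nonneg _) h1 2
      rw [hpyth] at h7
      nlinarith [norm_nonneg z, norm_nonneg (T (R z) - z),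
        mul_le_mul_of_nonneg_right h5 (norm_nonneg z),
        mul_le_mul_of_nonneg_left h3 hε0, mul_le_mul_of_nonneg_left h4 hε0]
    have h7 := abs_le_of_sq_le_sq h6 (by positivity)
    have h8 := hCT (h z - R z)
    rw [map_sub] at h8
    calc ‖h z - R z‖ ≤ C * (c / C * ‖z‖) :=
          h8.trans (mul_le_mul_of_nonneg_left ((le_abs_self _).trans h7) hC0.le)
      _ = c * ‖z‖ := by field_simp
  have h0 : θ 0 = θ₀ := by
    have := (hfinal.bound one_pos).self_of_nhds
    simpa [hh, sub_eq_zero] using this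
  rw [hasFDerivAt_iff_isLittleO_nhds_zero]
  refine hfinal.congr (fun z => ?_) (fun z => rfl)
  simp [hh, h0]

end leastSquares

/-! ### The noiseless data as a function of locations and amplitudes -/

section model
variable {N K L : ℕ}

/-- The map `ι`, inverse to `iotaInv`. It is isometric for the Frobenius norm, while its domain
carries the supremum norm. -/
noncomputable def iotaCLM (N L : ℕ) :
    (Fin N → Fin L → ℂ) →L[ℝ] EuclideanSpace ℝ ((Fin N × Fin L) ⊕ (Fin N × Fin L)) :=
  LinearMap.toContinuousLinearMap
    { toFun := fun Y => WithLp.toLp 2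
        (Sum.elim (fun p => (Y p.1 p.2).re) (fun p => (Y p.1 p.2).im))
      map_add' := fun Y Y' => by
        ext p; rcases p with p | p <;> simp
      map_smul' := fun a Y => by
        ext p; rcases p with p | p <;> simp }

lemma iotaCLM_inl (Y : Fin N → Fin L → ℂ) (p : Fin N × Fin L) :
    iotaCLM N L Y (Sum.inl p) = (Y p.1 p.2).re := rfl

lemma iotaCLM_inr (Y : Fin N → Fin L → ℂ) (p : Fin N × Fin L) :
    iotaCLM N L Y (Sum.inr p) = (Y p.1 p.2).im := rfl

lemma iotaCLM_iotaInv (z : EuclideanSpace ℝ ((Fin N × Fin L) ⊕ (Fin N × Fin L))) :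
    iotaCLM N L (fun i l => iotaInv z i l) = z := by
  ext p
  rcases p with p | p
  · rw [iotaCLM_inl]; simp [iotaInv]
  · rw [iotaCLM_inr]; simp [iotaInv]

lemma norm_iotaCLM_sq (Y : Fin N → Fin L → ℂ) :
    ‖iotaCLM N L Y‖ ^ 2 = ∑ l, ‖WithLp.toLp 2 fun i => Y i l‖ ^ 2 := by
  simp only [EuclideanSpace.norm_sq_eq, Fintype.sum_sum_type, iotaCLM_inl, iotaCLM_inr,
    Fintype.sum_prod_type]
  rw [← Finset.sum_add_distrib, Finset.sum_comm (γ := Fin L)]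
  refine Finset.sum_congr rfl fun i _ => ?_
  rw [← Finset.sum_add_distrib]
  refine Finset.sum_congr rfl fun l _ => ?_
  rw [← Complex.normSq_eq_norm_sq, Complex.normSq_apply, Real.norm_eq_abs, Real.norm_eq_abs,
    sq_abs, sq_abs]
  ring

lemma continuous_iotaInv :
    Continuous (iotaInv : EuclideanSpace ℝ ((Fin N × Fin L) ⊕ (Fin N × Fin L)) → _) := by
  refine continuous_pi fun i => continuous_pi fun l => ?_
  simp only [iotaInv, Matrix.of_apply]
  fun_prop

lemma iotaInv_zero : (iotaInv 0 : Matrix (Fin N) (Fin L) ℂ) = 0 := by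
  ext i l; simp [iotaInv]

lemma toLp_mul_col {m : ℕ} (M : Matrix (Fin m) (Fin N) ℂ) (Y : Matrix (Fin N) (Fin L) ℂ)
    (l : Fin L) :
    (WithLp.toLp 2 fun i => (M * Y) i l) =
      Matrix.toEuclideanLin M (WithLp.toLp 2 fun i => Y i l) := by
  ext i
  simp [Matrix.toLpLin_apply, Matrix.mul_apply, Matrix.mulVec, dotProduct]

lemma G_mul_Phi_apply (g : ℝ → ℝ) (γ : EuclideanSpace ℝ (Fin K)) (i : Fin N) (k : Fin K) :
    (G g N * Phi N γ) i k = ghat g (freq N i) *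
      Complex.exp (-(2 * Real.pi * γ k * freq N i : ℝ) * Complex.I) := by
  rw [G, Matrix.diagonal_mul, Phi, Matrix.of_apply]

/-- The noiseless data as a function of locations and amplitudes. -/
noncomputable def signal (g : ℝ → ℝ) (N : ℕ) {K L : ℕ}
    (θ : EuclideanSpace ℝ (Fin K) × (Fin K → Fin L → ℂ)) : Fin N → Fin L → ℂ :=
  fun i l => (G g N * Phi N θ.1 * Matrix.of θ.2) i l

/-- The derivative of `G Φ_γ b` in the locations `γ` is `D diag(b)`, where `D` is this matrix. -/
noncomputable def derivPhi (g : ℝ → ℝ) (N : ℕ) {K : ℕ} (γ : EuclideanSpace ℝ (Fin K)) :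
    Matrix (Fin N) (Fin K) ℂ :=
  Matrix.of fun i k => -(2 * Real.pi * freq N i : ℝ) * Complex.I * (G g N * Phi N γ) i k

lemma signal_apply (g : ℝ → ℝ) (θ : EuclideanSpace ℝ (Fin K) × (Fin K → Fin L → ℂ)) (i : Fin N)
    (l : Fin L) : signal g N θ i l = ∑ k, ghat g (freq N i) *
      Complex.exp (-(2 * Real.pi * θ.1 k * freq N i : ℝ) * Complex.I) * θ.2 k l := by
  rw [signal, Matrix.mul_apply]
  exact Finset.sum_congr rfl fun k _ => by rw [G_mul_Phi_apply, Matrix.of_apply]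

lemma differentiable_signal (g : ℝ → ℝ) :
    Differentiable ℝ (signal g N : EuclideanSpace ℝ (Fin K) × (Fin K → Fin L → ℂ) → _) := by
  refine differentiable_pi.mpr fun i => differentiable_pi.mpr fun l => ?_
  simp only [signal_apply]
  fun_prop

/-- In the direction `(δ, B)` the derivative is `D diag(δ) X + G Φ_γ B`. -/
lemma fderiv_signal (g : ℝ → ℝ) (θ h : EuclideanSpace ℝ (Fin K) × (Fin K → Fin L → ℂ)) :
    fderiv ℝ (signal g N) θ h = fun i l =>
      (derivPhi g N θ.1 * (Matrix.of fun k l => (h.1 k : ℂ) * θ.2 k l) +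
        G g N * Phi N θ.1 * Matrix.of h.2) i l := by
  have h1 : HasDerivAt (fun t : ℝ => θ + t • h) h 0 := by
    simpa using ((hasDerivAt_id (0 : ℝ)).smul_const h).const_add θ
  have h2 : HasFDerivAt (signal g N) (fderiv ℝ (signal g N) θ) (θ + (0 : ℝ) • h) := by
    rw [zero_smul, add_zero]
    exact (differentiable_signal g θ).hasFDerivAt
  have h3 := h2.comp_hasDerivAt (0 : ℝ) h1
  refine h3.unique (hasDerivAt_pi.mpr fun i => hasDerivAt_pi.mpr fun l => ?_)
  have h4 : ∀ k, HasDerivAt (fun t : ℝ => ghat g (freq N i) *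
      Complex.exp (-(2 * Real.pi * (θ.1 k + t * h.1 k) * freq N i : ℝ) * Complex.I) *
        (θ.2 k l + t * h.2 k l))
      (-(2 * Real.pi * freq N i : ℝ) * Complex.I * (ghat g (freq N i) *
        Complex.exp (-(2 * Real.pi * θ.1 k * freq N i : ℝ) * Complex.I)) * (h.1 k * θ.2 k l) +
       ghat g (freq N i) *
        Complex.exp (-(2 * Real.pi * θ.1 k * freq N i : ℝ) * Complex.I) * h.2 k l) 0 := by
    intro k
    have e1 : HasDerivAt (fun t : ℝ => (t : ℂ)) 1 0 := Complex.ofRealCLM.hasDerivAt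
    have e2 : HasDerivAt (fun t : ℝ =>
        (-(2 * Real.pi * (θ.1 k + t * h.1 k) * freq N i : ℝ) * Complex.I : ℂ))
        (-(2 * Real.pi * freq N i : ℝ) * Complex.I * h.1 k) 0 := by
      have := (((e1.mul_const (h.1 k : ℂ)).const_add (θ.1 k : ℂ)).const_mul
        (-(2 * Real.pi : ℂ) * freq N i * Complex.I))
      refine (this.congr_deriv ?_).congr_of_eventuallyEq (Eventually.of_forall fun t => ?_)
      · push_cast; ring
      · push_cast; ring
    have e3 : HasDerivAt (fun t : ℝ => (θ.2 k l + t * h.2 k l)) (h.2 k l) 0 := by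
      simpa using (e1.mul_const (h.2 k l)).const_add (θ.2 k l)
    refine ((e2.cexp.const_mul (ghat g (freq N i))).mul e3).congr_deriv ?_
    simp only [zero_mul, add_zero, Complex.ofReal_zero]
    ring
  have h5 := HasDerivAt.fun_sum (u := Finset.univ) fun k _ => h4 k
  refine (h5.congr_deriv ?_).congr_of_eventuallyEq (Eventually.of_forall fun t => ?_)
  · rw [Matrix.add_apply, Matrix.mul_apply, Matrix.mul_apply, ← Finset.sum_add_distrib]
    refine Finset.sum_congr rfl fun k _ => ?_
    simp only [derivPhi, Matrix.of_apply, G_mul_Phi_apply]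
  · simp [signal_apply]

end model

/-! ### Profiling out the amplitudes and the inverse map -/

section inverseMap
variable {N K L : ℕ} {g : ℝ → ℝ} {τ : EuclideanSpace ℝ (Fin K)} {X : Matrix (Fin K) (Fin L) ℂ}

lemma frobNorm_sq {m n : ℕ} (Y : Matrix (Fin m) (Fin n) ℂ) :
    frobNorm Y ^ 2 = ∑ l, ‖WithLp.toLp 2 fun i => Y i l‖ ^ 2 := by
  rw [frobNorm, Real.sq_sqrt (by positivity), Finset.sum_comm]
  simp only [EuclideanSpace.norm_sq_eq]

/-- The linear map `b ↦ G Φ_γ b`. -/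
noncomputable def pulseMap (g : ℝ → ℝ) (N : ℕ) {K : ℕ} (γ : EuclideanSpace ℝ (Fin K)) :
    EuclideanSpace ℂ (Fin K) →ₗ[ℂ] EuclideanSpace ℂ (Fin N) :=
  Matrix.toEuclideanLin (G g N * Phi N γ)

lemma signal_col (γ : EuclideanSpace ℝ (Fin K)) (B : Fin K → Fin L → ℂ) (l : Fin L) :
    (WithLp.toLp 2 fun i => signal g N (γ, B) i l) =
      pulseMap g N γ (WithLp.toLp 2 fun k => B k l) :=
  toLp_mul_col _ (Matrix.of B) l

lemma loss_eq (γ : EuclideanSpace ℝ (Fin K)) (Z : Matrix (Fin N) (Fin L) ℂ) :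
    loss g N τ X γ Z = ∑ l, ‖(LinearMap.range (pulseMap g N γ))ᗮ.starProjection
      (WithLp.toLp 2 fun i => signal g N (τ, X) i l + Z i l)‖ ^ 2 := by
  rw [loss, frobNorm_sq]
  refine Finset.sum_congr rfl fun l _ => ?_
  rw [toLp_mul_col, Pperp, LinearEquiv.apply_symm_apply]
  rfl

lemma norm_residual_sq (γ : EuclideanSpace ℝ (Fin K)) (B : Fin K → Fin L → ℂ)
    (z : EuclideanSpace ℝ ((Fin N × Fin L) ⊕ (Fin N × Fin L))) :
    ‖iotaCLM N L (signal g N (γ, B)) - iotaCLM N L (signal g N (τ, X)) - z‖ ^ 2 =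
      ∑ l, ‖(WithLp.toLp 2 fun i => signal g N (τ, X) i l + iotaInv z i l) -
        pulseMap g N γ (WithLp.toLp 2 fun k => B k l)‖ ^ 2 := by
  conv_lhs => rw [← iotaCLM_iotaInv z]
  rw [← map_sub, ← map_sub, norm_iotaCLM_sq]
  refine Finset.sum_congr rfl fun l _ => ?_
  rw [← signal_col, ← norm_neg]
  congr 2
  ext i
  simp
  ring

/-- Profiling out the amplitudes: the loss is at most the least squares residual. -/
lemma loss_le_norm_residual_sq (γ : EuclideanSpace ℝ (Fin K)) (B : Fin K → Fin L → ℂ)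
    (z : EuclideanSpace ℝ ((Fin N × Fin L) ⊕ (Fin N × Fin L))) :
    loss g N τ X γ (iotaInv z) ≤
      ‖iotaCLM N L (signal g N (γ, B)) - iotaCLM N L (signal g N (τ, X)) - z‖ ^ 2 := by
  rw [loss_eq, norm_residual_sq]
  refine Finset.sum_le_sum fun l _ => pow_le_pow_left₀ (norm_nonneg _) ?_ 2
  set y : EuclideanSpace ℂ (Fin N) :=
    WithLp.toLp 2 fun i => signal g N (τ, X) i l + iotaInv z i l
  set b : EuclideanSpace ℂ (Fin K) := WithLp.toLp 2 fun k => B k l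
  have h : (LinearMap.range (pulseMap g N γ))ᗮ.starProjection y =
      (LinearMap.range (pulseMap g N γ))ᗮ.starProjection (y - pulseMap g N γ b) := by
    rw [map_sub, Submodule.starProjection_orthogonal_apply_eq_zero (LinearMap.mem_range_self _ _),
      sub_zero]
  rw [h]
  exact Submodule.norm_starProjection_apply_le _ _

/-- Profiling out the amplitudes: the loss is the residual of a best fit. -/
lemma exists_norm_residual_sq_eq_loss (γ : EuclideanSpace ℝ (Fin K))
    (z : EuclideanSpace ℝ ((Fin N × Fin L) ⊕ (Fin N × Fin L))) :
    ∃ B : Fin K → Fin L → ℂ,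
      ‖iotaCLM N L (signal g N (γ, B)) - iotaCLM N L (signal g N (τ, X)) - z‖ ^ 2 =
        loss g N τ X γ (iotaInv z) := by
  have h : ∀ l : Fin L, ∃ b, pulseMap g N γ b =
      (LinearMap.range (pulseMap g N γ)).starProjection
        (WithLp.toLp 2 fun i => signal g N (τ, X) i l + iotaInv z i l) :=
    fun l => (LinearMap.range (pulseMap g N γ)).starProjection_apply_mem _
  choose b hb using h
  refine ⟨fun k l => b l k, ?_⟩
  rw [loss_eq, norm_residual_sq]
  refine Finset.sum_congr rfl fun l _ => ?_
  rw [Submodule.starProjection_orthogonal_val, ← hb]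

lemma continuous_toEuclideanLin {m n : ℕ} : Continuous fun M : Matrix (Fin m) (Fin n) ℂ =>
    LinearMap.toContinuousLinearMap (Matrix.toEuclideanLin M) :=
  LinearMap.continuous_of_finiteDimensional
    ((LinearMap.toContinuousLinearMap (𝕜 := ℂ) (E := EuclideanSpace ℂ (Fin n))
      (F' := EuclideanSpace ℂ (Fin m))).toLinearMap ∘ₗ
      (Matrix.toEuclideanLin (𝕜 := ℂ) (m := Fin m) (n := Fin n)).toLinearMap)

lemma continuous_pulseMap : Continuous fun γ : EuclideanSpace ℝ (Fin K) =>
    LinearMap.toContinuousLinearMap (pulseMap g N γ) := by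
  refine continuous_toEuclideanLin.comp (continuous_pi fun i => continuous_pi fun k => ?_)
  simp only [G_mul_Phi_apply]
  fun_prop

/-- Injectivity of `G Φ_γ` is stable near `τ`. -/
lemma eventually_norm_pulseMap_ge {c : ℝ} (hc : 0 < c)
    (h : ∀ b, c * ‖b‖ ≤ ‖pulseMap g N τ b‖) :
    ∀ᶠ γ in 𝓝 τ, ∀ b, c / 2 * ‖b‖ ≤ ‖pulseMap g N γ b‖ := by
  have h1 := (continuous_pulseMap (g := g) (N := N)).tendsto τ
  rw [tendsto_iff_norm_sub_tendsto_zero] at h1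
  filter_upwards [h1.eventually (gt_mem_nhds (half_pos hc))] with γ hγ b
  have h2 := ContinuousLinearMap.le_opNorm (LinearMap.toContinuousLinearMap (pulseMap g N γ) -
    LinearMap.toContinuousLinearMap (pulseMap g N τ)) b
  have h3 : ‖pulseMap g N γ b - pulseMap g N τ b‖ ≤ c / 2 * ‖b‖ :=
    h2.trans (mul_le_mul_of_nonneg_right hγ.le (norm_nonneg _))
  have h4 := norm_sub_norm_le (pulseMap g N τ b) (pulseMap g N γ b)
  rw [norm_sub_rev] at h4
  linarith [h b]

/-- The linear map `c ↦ D c`, where `D diag(b)` is the derivative of `G Φ_γ b` in `γ`. -/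
noncomputable def derivMap (g : ℝ → ℝ) (N : ℕ) {K : ℕ} (γ : EuclideanSpace ℝ (Fin K)) :
    EuclideanSpace ℂ (Fin K) →ₗ[ℂ] EuclideanSpace ℂ (Fin N) :=
  Matrix.toEuclideanLin (derivPhi g N γ)

lemma norm_fderiv_signal_sq (h : EuclideanSpace ℝ (Fin K) × (Fin K → Fin L → ℂ)) :
    ‖iotaCLM N L (fderiv ℝ (signal g N) (τ, X) h)‖ ^ 2 =
      ∑ l, ‖derivMap g N τ (WithLp.toLp 2 fun k => (h.1 k : ℂ) * X k l) +
        pulseMap g N τ (WithLp.toLp 2 fun k => h.2 k l)‖ ^ 2 := by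
  rw [fderiv_signal, norm_iotaCLM_sq]
  refine Finset.sum_congr rfl fun l _ => ?_
  have h1 := toLp_mul_col (derivPhi g N τ) (Matrix.of fun k l => (h.1 k : ℂ) * X k l) l
  have h2 := toLp_mul_col (G g N * Phi N τ) (Matrix.of h.2) l
  simp only [Matrix.of_apply] at h1 h2
  rw [derivMap, pulseMap, ← h1, ← h2]
  rfl

/-- Amplitudes fitted at the estimated locations converge to the true ones. -/
lemma tendsto_amplitudes {Y : Fin K → Fin L → ℂ} {c : ℝ} (hc : 0 < c)
    (hinj : ∀ b, c * ‖b‖ ≤ ‖pulseMap g N τ b‖)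
    {γ : EuclideanSpace ℝ ((Fin N × Fin L) ⊕ (Fin N × Fin L)) → EuclideanSpace ℝ (Fin K)}
    {B : EuclideanSpace ℝ ((Fin N × Fin L) ⊕ (Fin N × Fin L)) → Fin K → Fin L → ℂ}
    (hγ : Tendsto γ (𝓝 0) (𝓝 τ))
    (hB : ∀ᶠ z in 𝓝 0,
      ‖iotaCLM N L (signal g N (γ z, B z)) - iotaCLM N L (signal g N (τ, Y)) - z‖ ≤ ‖z‖) :
    Tendsto B (𝓝 0) (𝓝 Y) := by
  have hcont : Continuous fun γ : EuclideanSpace ℝ (Fin K) => iotaCLM N L (signal g N (γ, Y)) :=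
    (iotaCLM N L).continuous.comp
      ((differentiable_signal g).continuous.comp (continuous_id.prodMk continuous_const))
  have h1 : Tendsto (fun z => 2 * ‖z‖ + ‖iotaCLM N L (signal g N (γ z, Y)) -
      iotaCLM N L (signal g N (τ, Y))‖) (𝓝 0) (𝓝 0) := by
    have h2 := (tendsto_iff_norm_sub_tendsto_zero.mp ((hcont.tendsto τ).comp hγ))
    have h3 : Tendsto (fun z : EuclideanSpace ℝ ((Fin N × Fin L) ⊕ (Fin N × Fin L)) => 2 * ‖z‖)
        (𝓝 0) (𝓝 0) := by
      have : Continuous fun z : EuclideanSpace ℝ ((Fin N × Fin L) ⊕ (Fin N × Fin L)) =>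
        2 * ‖z‖ := by fun_prop
      simpa using this.tendsto 0
    simpa using h3.add h2
  refine tendsto_pi_nhds.mpr fun k => tendsto_pi_nhds.mpr fun l => ?_
  rw [tendsto_iff_norm_sub_tendsto_zero]
  have h4 : Tendsto (fun z => (c / 2)⁻¹ * (2 * ‖z‖ + ‖iotaCLM N L (signal g N (γ z, Y)) -
      iotaCLM N L (signal g N (τ, Y))‖)) (𝓝 0) (𝓝 0) := by
    simpa using h1.const_mul (c / 2)⁻¹
  refine squeeze_zero' (Eventually.of_forall fun z => norm_nonneg _) ?_ h4
  filter_upwards [hB, hγ.eventually (eventually_norm_pulseMap_ge hc hinj)] with z hz hz'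
  set b : EuclideanSpace ℂ (Fin K) := WithLp.toLp 2 fun k => B z k l - Y k l with hb
  have h5 : ‖B z k l - Y k l‖ ≤ ‖b‖ := by
    have := PiLp.norm_apply_le b k
    simpa [hb] using this
  have h6 : ‖pulseMap g N (γ z) b‖ ≤
      ‖iotaCLM N L (signal g N (γ z, B z)) - iotaCLM N L (signal g N (γ z, Y))‖ := by
    rw [← map_sub]
    refine le_of_sq_le_sq ?_ (norm_nonneg _)
    rw [norm_iotaCLM_sq]
    have h7 : pulseMap g N (γ z) b =
        WithLp.toLp 2 fun i => (signal g N (γ z, B z) - signal g N (γ z, Y)) i l := by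
      have e : b = (WithLp.toLp 2 fun k => B z k l) - (WithLp.toLp 2 fun k => Y k l) := rfl
      rw [e, map_sub, ← signal_col, ← signal_col]
      rfl
    rw [h7]
    exact Finset.single_le_sum (f := fun l => ‖WithLp.toLp 2 fun i =>
      (signal g N (γ z, B z) - signal g N (γ z, Y)) i l‖ ^ 2) (fun _ _ => by positivity)
      (Finset.mem_univ l)
  have h8 : ‖iotaCLM N L (signal g N (γ z, B z)) - iotaCLM N L (signal g N (γ z, Y))‖ ≤
      2 * ‖z‖ + ‖iotaCLM N L (signal g N (γ z, Y)) - iotaCLM N L (signal g N (τ, Y))‖ := by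
    have e : iotaCLM N L (signal g N (γ z, B z)) - iotaCLM N L (signal g N (γ z, Y)) =
        (iotaCLM N L (signal g N (γ z, B z)) - iotaCLM N L (signal g N (τ, Y)) - z) + z -
          (iotaCLM N L (signal g N (γ z, Y)) - iotaCLM N L (signal g N (τ, Y))) := by abel
    rw [e]
    refine (norm_sub_le _ _).trans (add_le_add_left ((norm_add_le _ _).trans ?_) _)
    linarith
  rw [inv_mul_eq_div, le_div_iff₀ (half_pos hc), mul_comm]
  have h9 := hz' b
  have h10 := mul_le_mul_of_nonneg_left h5 (half_pos hc).le
  linarith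

/-- The inverse map is differentiable, and the norm of its derivative is controlled by the
coercivity of the linearized model. -/
theorem IsInverseMap.differentiableAt_and_norm_fderiv_le
    {ψ : Matrix (Fin N) (Fin L) ℂ → EuclideanSpace ℝ (Fin K)} (hψ : IsInverseMap g N τ X ψ)
    {c σ : ℝ} (hc : 0 < c) (hσ : 0 < σ) (hinj : ∀ b, c * ‖b‖ ≤ ‖pulseMap g N τ b‖)
    (hco : ∀ (δ : Fin K → ℝ) (B : Fin L → EuclideanSpace ℂ (Fin K)),
      σ ^ 2 * ∑ k, δ k ^ 2 ≤ ∑ l, ‖derivMap g N τ (WithLp.toLp 2 fun k => (δ k : ℂ) * X k l) +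
        pulseMap g N τ (B l)‖ ^ 2) :
    DifferentiableAt ℝ (fun z => ψ (iotaInv z)) 0 ∧
      ‖fderiv ℝ (fun z => ψ (iotaInv z)) 0‖ ≤ σ⁻¹ := by
  set F : EuclideanSpace ℝ (Fin K) × (Fin K → Fin L → ℂ) →
    EuclideanSpace ℝ ((Fin N × Fin L) ⊕ (Fin N × Fin L)) :=
    fun θ => iotaCLM N L (signal g N θ) with hF
  set θ₀ : EuclideanSpace ℝ (Fin K) × (Fin K → Fin L → ℂ) := (τ, X) with hθ₀
  set T := (iotaCLM N L).comp (fderiv ℝ (signal g N) θ₀) with hTdef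
  have hFT : HasFDerivAt F T θ₀ :=
    (iotaCLM N L).hasFDerivAt.comp θ₀ (differentiable_signal g θ₀).hasFDerivAt
  have hTsq : ∀ h, ‖T h‖ ^ 2 = ∑ l, ‖derivMap g N τ (WithLp.toLp 2 fun k => (h.1 k : ℂ) * X k l) +
        pulseMap g N τ (WithLp.toLp 2 fun k => h.2 k l)‖ ^ 2 := fun h => norm_fderiv_signal_sq h
  have hTσ : ∀ h, σ * ‖h.1‖ ≤ ‖T h‖ := by
    intro h
    refine le_of_sq_le_sq ?_ (norm_nonneg _)
    rw [hTsq, mul_pow, EuclideanSpace.norm_sq_eq]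
    simpa using hco h.1 fun l => WithLp.toLp 2 fun k => h.2 k l
  have hTinj : Function.Injective T := by
    rw [injective_iff_map_eq_zero]
    intro h hh
    have h1 := hTσ h
    rw [hh, norm_zero] at h1
    have h2 : h.1 = 0 := by
      rw [← norm_le_zero_iff]
      exact nonpos_of_mul_nonpos_right h1 hσ
    have h3 := hTsq h
    have hz : ∀ l, derivMap g N τ (WithLp.toLp 2 fun k => (h.1 k : ℂ) * X k l) = 0 := by
      intro l
      have e : (WithLp.toLp 2 fun k => (h.1 k : ℂ) * X k l : EuclideanSpace ℂ (Fin K)) = 0 := by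
        ext k; simp [h2]
      rw [e]
      exact LinearMap.map_zero _
    rw [hh, norm_zero] at h3
    simp only [hz, zero_add] at h3
    have h4 := (Finset.sum_eq_zero_iff_of_nonneg fun l _ => by positivity).mp
      (h3.symm.trans (by norm_num))
    refine Prod.ext h2 ?_
    funext k l
    have h5 := h4 l (Finset.mem_univ l)
    have h6 := hinj (WithLp.toLp 2 fun k => h.2 k l)
    rw [pow_eq_zero_iff two_ne_zero] at h5
    rw [h5] at h6
    have h7 : (WithLp.toLp 2 fun k => h.2 k l : EuclideanSpace ℂ (Fin K)) = 0 := by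
      rw [← norm_le_zero_iff]
      exact nonpos_of_mul_nonpos_right h6 hc
    have h8 := congrArg (fun v : EuclideanSpace ℂ (Fin K) => v k) h7
    simpa using h8
  set Te := LinearEquiv.ofInjective T.toLinearMap hTinj with hTe
  set R := (LinearMap.toContinuousLinearMap Te.symm.toLinearMap).comp
    (LinearMap.range T.toLinearMap).orthogonalProjectionOnto with hR
  have hTR : ∀ z, T (R z) = (LinearMap.range T.toLinearMap).starProjection z := by
    intro z
    have h1 := LinearEquiv.apply_symm_apply Te
      ((LinearMap.range T.toLinearMap).orthogonalProjectionOnto z)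
    exact congrArg Subtype.val h1
  choose B hB using fun z => exists_norm_residual_sq_eq_loss (g := g) (τ := τ) (X := X)
    (ψ (iotaInv z)) z
  have hargmin := (continuous_iotaInv (N := N) (L := L)).tendsto 0
  rw [iotaInv_zero] at hargmin
  have hγ : Tendsto (fun z => ψ (iotaInv z)) (𝓝 0) (𝓝 τ) := by
    have h1 := hψ.continuousAt_zero.tendsto
    rw [hψ.map_zero] at h1
    exact h1.comp hargmin
  have hmin : ∀ᶠ z in 𝓝 0, ∀ θ', ‖F (ψ (iotaInv z), B z) - F θ₀ - z‖ ≤ ‖F θ' - F θ₀ - z‖ := by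
    filter_upwards [hargmin.eventually hψ.argmin] with z hz θ'
    refine le_of_sq_le_sq ?_ (norm_nonneg _)
    refine (hB z).le.trans ((hz θ'.1).trans ?_)
    exact loss_le_norm_residual_sq θ'.1 θ'.2 z
  have hBX : Tendsto B (𝓝 0) (𝓝 X) := by
    refine tendsto_amplitudes hc hinj hγ ?_
    filter_upwards [hmin] with z hz
    simpa using hz θ₀
  have key := hasFDerivAt_of_forall_norm_sub_le hFT hTinj (θ := fun z => (ψ (iotaInv z), B z))
    (hγ.prodMk_nhds hBX) hmin R hTR
  have hfst := (hasFDerivAt_fst (𝕜 := ℝ)).comp (0 : EuclideanSpace ℝ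
    ((Fin N × Fin L) ⊕ (Fin N × Fin L))) key
  have hfst' : HasFDerivAt (fun z => ψ (iotaInv z))
    ((ContinuousLinearMap.fst ℝ (EuclideanSpace ℝ (Fin K)) (Fin K → Fin L → ℂ)).comp R) 0 := hfst
  refine ⟨hfst'.differentiableAt, ?_⟩
  rw [hfst'.fderiv]
  refine ContinuousLinearMap.opNorm_le_bound _ (inv_nonneg.mpr hσ.le) fun z => ?_
  rw [inv_mul_eq_div, le_div_iff₀ hσ, mul_comm]
  refine (hTσ (R z)).trans ?_
  rw [hTR]
  exact Submodule.norm_starProjection_apply_le _ _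

end inverseMap

/-! ### The linearized model and the energy form -/

lemma freq_succ_eq_node (M : ℕ) (i : Fin (M + 1)) : freq (M + 1) i = node M i := by
  simp only [freq, node]; push_cast; ring

/-- The linearized model in terms of the normalized spectrum. -/
lemma norm_pulseMap_sub_derivMap_sq {K M : ℕ} {g : ℝ → ℝ} (τ : EuclideanSpace ℝ (Fin K))
    {E₀ E₁ : ℝ} (hE₀ : 0 < E₀) (hE₁ : 0 < E₁) (b c : EuclideanSpace ℂ (Fin K)) :
    ‖pulseMap g (M + 1) τ b - derivMap g (M + 1) τ c‖ ^ 2 =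
      energyFormC M (fun f => ‖ghat g f‖ ^ 2 / E₀) (2 * Real.pi * √(E₀ / E₁)) τ
        (fun k => (√E₀ : ℂ) * b k) (fun k => (√E₁ : ℂ) * c k) := by
  have hs : √(E₀ / E₁) * √E₁ = √E₀ := by
    rw [← Real.sqrt_mul (by positivity), div_mul_cancel₀ _ hE₁.ne']
  rw [energyFormC, EuclideanSpace.norm_sq_eq, ← Fin.sum_univ_eq_sum_range (fun n =>
    ‖ghat g (node M n)‖ ^ 2 / E₀ * ‖∑ k, ((√E₀ : ℂ) * b k + Complex.I *
      ((2 * Real.pi * √(E₀ / E₁)) * node M n : ℝ) * ((√E₁ : ℂ) * c k)) *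
        Complex.exp (-(2 * Real.pi * τ k * node M n : ℝ) * Complex.I)‖ ^ 2)]
  refine Finset.sum_congr rfl fun i _ => ?_
  have h1 : (pulseMap g (M + 1) τ b - derivMap g (M + 1) τ c) i = ghat g (node M i) *
      ∑ k, (b k + Complex.I * (2 * Real.pi * node M i : ℝ) * c k) *
        Complex.exp (-(2 * Real.pi * τ k * node M i : ℝ) * Complex.I) := by
    rw [← freq_succ_eq_node, Finset.mul_sum]
    simp only [pulseMap, derivMap, PiLp.sub_apply, Matrix.toLpLin_apply, Matrix.mulVec, dotProduct,
      derivPhi, Matrix.of_apply, G_mul_Phi_apply]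
    rw [← Finset.sum_sub_distrib]
    exact Finset.sum_congr rfl fun k _ => by ring
  have h2 : ∑ k, ((√E₀ : ℂ) * b k + Complex.I *
      ((2 * Real.pi * √(E₀ / E₁)) * node M i : ℝ) * ((√E₁ : ℂ) * c k)) *
        Complex.exp (-(2 * Real.pi * τ k * node M i : ℝ) * Complex.I) = (√E₀ : ℂ) *
      ∑ k, (b k + Complex.I * (2 * Real.pi * node M i : ℝ) * c k) *
        Complex.exp (-(2 * Real.pi * τ k * node M i : ℝ) * Complex.I) := by
    rw [Finset.mul_sum]
    refine Finset.sum_congr rfl fun k _ => ?_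
    have hs' : ((√(E₀ / E₁) : ℝ) : ℂ) * (√E₁ : ℝ) = (√E₀ : ℝ) := by rw [← Complex.ofReal_mul, hs]
    rw [← hs']
    push_cast
    ring
  rw [h1, h2, norm_mul, norm_mul, mul_pow, mul_pow, Complex.norm_real, Real.norm_eq_abs, sq_abs,
    Real.sq_sqrt hE₀.le]
  field_simp

/-! ### The spectrum of the pulse -/

section spectrum
variable {g : ℝ → ℝ}

lemma continuous_fourier_of_integrable {u : ℝ → ℂ} (hu : Integrable u) : Continuous (𝓕 u) :=
  VectorFourier.fourierIntegral_continuous Real.continuous_fourierChar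
    (L := innerₗ ℝ) continuous_inner hu

lemma continuous_ghat (hg : Integrable g) : Continuous (ghat g) :=
  continuous_fourier_of_integrable hg.ofReal

lemma ghat_neg (f : ℝ) : ghat g (-f) = starRingEnd ℂ (ghat g f) := by
  rw [ghat, Real.fourier_real_eq_integral_exp_smul, Real.fourier_real_eq_integral_exp_smul,
    ← integral_conj]
  refine integral_congr_ae (Eventually.of_forall fun t => ?_)
  simp only [smul_eq_mul, map_mul, Complex.conj_ofReal, ← Complex.exp_conj, Complex.conj_I]
  congr 2
  push_cast
  ring

lemma norm_ghat_neg (f : ℝ) : ‖ghat g (-f)‖ = ‖ghat g f‖ := by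
  rw [ghat_neg, RCLike.norm_conj]

lemma integral_fourier_mul_eq {u v : ℝ → ℂ} (hu : Integrable u) (hv : Integrable v) :
    ∫ x, 𝓕 u x * v x = ∫ x, u x * 𝓕 v x := by
  simpa using! VectorFourier.integral_bilin_fourierIntegral_eq_flip (ContinuousLinearMap.mul ℂ ℂ)
    (L := innerₗ ℝ) Real.continuous_fourierChar continuous_inner hu hv

/-- The `L²` Fourier transform of `g'` is `2πi f ĝ(f)`. -/
lemma ghatDeriv_ae_eq (hg : Integrable g) (hgd : Differentiable ℝ g)
    (hg' : MemLp (fun t : ℝ => ((deriv g t : ℝ) : ℂ)) 2 volume) :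
    ghatDeriv g hg' =ᵐ[volume] fun f => 2 * Real.pi * Complex.I * f * ghat g f := by
  have hgc : Integrable (fun t => (g t : ℂ)) := hg.ofReal
  refine ae_eq_of_integral_contDiff_smul_eq ?_ ?_ fun φ hφ hφs => ?_
  · exact (Lp.memLp _).locallyIntegrable (by norm_num)
  · refine Continuous.locallyIntegrable ?_
    have := continuous_ghat hg
    fun_prop
  have hφc : ContDiff ℝ (⊤ : ℕ∞) (fun x => (φ x : ℂ)) := Complex.ofRealCLM.contDiff.comp hφ
  have hφcs : HasCompactSupport (fun x => (φ x : ℂ)) := hφs.comp_left (g := ((↑) : ℝ → ℂ)) rfl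
  set Φ : SchwartzMap ℝ ℂ := hφcs.toSchwartzMap hφc with hΦ
  have hΦφ : ∀ x, Φ x = (φ x : ℂ) := fun x => rfl
  have hxΦ : Integrable (fun x : ℝ => x • Φ x) := by
    refine Continuous.integrable_of_hasCompactSupport (by fun_prop) ?_
    exact hφcs.mul_left (f := fun x : ℝ => (x : ℂ))
  -- Parseval's relation in `L²`
  have h1 : ∫ x, φ x • ghatDeriv g hg' x = ∫ t, 𝓕 (Φ : ℝ → ℂ) t * ((deriv g t : ℝ) : ℂ) := by
    have h2 := congrArg (fun T => T Φ) (Lp.fourier_toTemperedDistribution_eq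
      (hg'.toLp (fun t : ℝ => ((deriv g t : ℝ) : ℂ))))
    simp only [TemperedDistribution.fourier_apply, Lp.toTemperedDistribution_apply] at h2
    refine Eq.trans ?_ (h2.symm.trans ?_)
    · rfl
    · refine integral_congr_ae ?_
      filter_upwards [hg'.coeFn_toLp] with t ht
      rw [ht, SchwartzMap.fourier_coe]
      rfl
  -- integration by parts
  have hderiv : ∀ t, HasDerivAt (𝓕 (Φ : ℝ → ℂ))
      (𝓕 (fun x : ℝ => (-2 * Real.pi * Complex.I * x) • Φ x) t) t :=
    Real.hasDerivAt_fourier Φ.integrable hxΦ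
  have hψ : Integrable (fun x : ℝ => (-2 * Real.pi * Complex.I * x) • Φ x) := by
    refine (hxΦ.const_mul (-2 * Real.pi * Complex.I)).congr (Eventually.of_forall fun x => ?_)
    simp only [Complex.real_smul, smul_eq_mul]
    ring
  have hbdd : ∀ {v : ℝ → ℂ}, Integrable v → Integrable (fun t => 𝓕 v t * (g t : ℂ)) := by
    intro v hv
    refine hgc.bdd_mul (c := ∫ x, ‖v x‖) (continuous_fourier_of_integrable hv).aestronglyMeasurable
      (Eventually.of_forall fun t => ?_)
    exact VectorFourier.norm_fourierIntegral_le_integral_norm _ _ _ _ _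
  have h3 : ∫ t, 𝓕 (Φ : ℝ → ℂ) t * ((deriv g t : ℝ) : ℂ) =
      -∫ t, 𝓕 (fun x : ℝ => (-2 * Real.pi * Complex.I * x) • Φ x) t * (g t : ℂ) := by
    refine integral_mul_deriv_eq_deriv_mul_of_integrable (fun t _ => hderiv t)
      (fun t _ => (hgd t).hasDerivAt.ofReal_comp) ?_ (hbdd hψ) (hbdd Φ.integrable)
    have h4 : MemLp (𝓕 (Φ : ℝ → ℂ)) 2 volume := by
      rw [← SchwartzMap.fourier_coe]
      exact (𝓕 Φ).memLp 2
    exact h4.integrable_mul hg'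
  rw [h1, h3, integral_fourier_mul_eq hψ hgc, ← integral_neg]
  refine integral_congr_ae (Eventually.of_forall fun x => ?_)
  simp only [hΦφ, smul_eq_mul, Complex.real_smul, ghat]
  ring

end spectrum

/-! ### Variation modulo null sets -/

section totalVar
variable {u : ℝ → ℝ} {a b : ℝ}

lemma quasiMeasurePreserving_add_mul (c : ℝ) {r : ℝ} (hr : r ≠ 0) :
    Measure.QuasiMeasurePreserving (fun x : ℝ => c + x * r) := by
  have h1 : Measure.QuasiMeasurePreserving (fun x : ℝ => x * r) := by
    refine ⟨by fun_prop, ?_⟩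
    rw [Real.map_volume_mul_right hr]
    exact Measure.smul_absolutelyContinuous
  exact (measurePreserving_add_left volume c).quasiMeasurePreserving.comp h1

lemma neBot_ae_inf_nhdsLT (x : ℝ) : (ae (volume : Measure ℝ) ⊓ 𝓝[<] x).NeBot := by
  rw [inf_neBot_iff]
  intro s hs t ht
  obtain ⟨l, hl, hlt⟩ := (mem_nhdsLT_iff_exists_Ioo_subset).mp ht
  by_contra hne
  rw [Set.not_nonempty_iff_eq_empty] at hne
  have h1 : Set.Ioo l x ⊆ sᶜ := fun y hy hys => by
    have : y ∈ s ∩ t := ⟨hys, hlt hy⟩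
    rw [hne] at this
    exact this
  have h2 : volume (Set.Ioo l x) = 0 := measure_mono_null h1 hs
  rw [Real.volume_Ioo, ENNReal.ofReal_eq_zero] at h2
  have : l < x := hl
  linarith

/-- Among the functions that agree almost everywhere with a continuous function cut off to an
interval, that function itself has the least variation: sample any other one after a slight
contraction towards an interior point. -/
lemma eVariationOn_indicator_le (hu : Continuous u) (hab : a < b) {v : ℝ → ℝ}
    (hv : v =ᵐ[volume] (Set.Icc a b).indicator u) :
    eVariationOn ((Set.Icc a b).indicator u) Set.univ ≤ eVariationOn v Set.univ := by
  refine iSup_le fun ⟨n, t, ht, _⟩ => ?_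
  -- the center of the contraction must not be a node of the partition
  obtain ⟨c, hc, hct⟩ : ∃ c ∈ Set.Ioo a b, c ∉ Set.range t := by
    by_contra! hcon
    exact (Cardinal.Real.Ioo_countable_iff.not.mpr hab.not_ge)
      ((Set.countable_range t).mono hcon)
  refine (eVariationOn.sum_le (s := Set.range t) ht fun i => Set.mem_range_self i).trans ?_
  by_contra! hlt
  have htend : ∀ x ∈ Set.range t, Tendsto (fun lam : ℝ => v (c + lam * (x - c)))
      (ae volume ⊓ 𝓝[<] 1) (𝓝 ((Set.Icc a b).indicator u x)) := by
    intro x hx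
    have hxc : x - c ≠ 0 := sub_ne_zero.mpr fun h => hct (h ▸ hx)
    have h1 : (fun lam : ℝ => v (c + lam * (x - c))) =ᶠ[ae volume ⊓ 𝓝[<] 1]
        fun lam => (Set.Icc a b).indicator u (c + lam * (x - c)) :=
      ((quasiMeasurePreserving_add_mul c hxc).ae_eq hv).filter_mono inf_le_left
    refine Tendsto.congr' h1.symm (Tendsto.mono_left ?_ inf_le_right)
    have hcont : Continuous fun lam : ℝ => c + lam * (x - c) := by fun_prop
    have hlim : Tendsto (fun lam : ℝ => c + lam * (x - c)) (𝓝[<] 1) (𝓝 x) := by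
      have h2 := hcont.tendsto 1
      rw [one_mul, add_sub_cancel] at h2
      exact h2.mono_left nhdsWithin_le_nhds
    by_cases hxI : x ∈ Set.Icc a b
    · rw [Set.indicator_of_mem hxI]
      refine Tendsto.congr' ?_ ((hu.tendsto x).comp hlim)
      filter_upwards [Ioo_mem_nhdsLT (zero_lt_one' ℝ)] with lam hlam
      rw [Set.indicator_of_mem, Function.comp]
      have := (convex_Icc a b).add_smul_sub_mem ⟨hc.1.le, hc.2.le⟩ hxI ⟨hlam.1.le, hlam.2.le⟩
      simpa using this
    · rw [Set.indicator_of_notMem hxI]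
      refine tendsto_const_nhds.congr' ?_
      filter_upwards [hlim.eventually (isClosed_Icc.isOpen_compl.mem_nhds hxI)] with lam hlam
      rw [Set.indicator_of_notMem hlam]
  have := neBot_ae_inf_nhdsLT 1
  have hev := eVariationOn.lowerSemicontinuous_aux htend hlt
  have hpos : ∀ᶠ lam : ℝ in ae volume ⊓ 𝓝[<] 1, 0 < lam :=
    Eventually.filter_mono inf_le_right
      (Filter.Eventually.mono (Ioo_mem_nhdsLT (zero_lt_one' ℝ)) fun _ h => h.1)
  obtain ⟨lam, h1, h2⟩ := (hev.and hpos).exists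
  refine absurd h1 (not_lt.mpr ?_)
  refine eVariationOn.comp_le_of_monotoneOn v (fun x => c + lam * (x - c)) ?_
    (Set.mapsTo_univ _ _)
  intro x _ y _ hxy
  have : lam * (x - c) ≤ lam * (y - c) := mul_le_mul_of_nonneg_left (by linarith) h2.le
  simp only
  linarith

/-- The jumps at the ends of the band are part of the total variation on the line. -/
lemma boundedVariationOn_and_extVar_le_totalVar (hu : Continuous u) (hab : a < b)
    (hfin : totalVar ((Set.Icc a b).indicator u) ≠ ⊤) :
    BoundedVariationOn u (Set.Icc a b) ∧
      extVar u a b ≤ (totalVar ((Set.Icc a b).indicator u)).toReal := by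
  set w := (Set.Icc a b).indicator u with hw
  have h1 : eVariationOn w Set.univ ≤ totalVar w :=
    le_iInf fun v => le_iInf fun hv => eVariationOn_indicator_le hu hab hv
  have hwa : w a = u a := Set.indicator_of_mem (Set.left_mem_Icc.mpr hab.le) u
  have hwb : w b = u b := Set.indicator_of_mem (Set.right_mem_Icc.mpr hab.le) u
  have hwa' : w (a - 1) = 0 := Set.indicator_of_notMem (fun h => by linarith [h.1]) u
  have hwb' : w (b + 1) = 0 := Set.indicator_of_notMem (fun h => by linarith [h.2]) u
  have h2 : edist (u a) 0 + eVariationOn u (Set.Icc a b) + edist (u b) 0 ≤ totalVar w := by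
    have e1 : eVariationOn u (Set.Icc a b) = eVariationOn w (Set.Icc a b) :=
      eVariationOn.congr fun x hx => (Set.indicator_of_mem hx u).symm
    have e2 := eVariationOn.add_le_union w (s := {a, a - 1}) (t := Set.Icc a b) (by
      rintro x (rfl | rfl) y hy
      · exact hy.1
      · linarith [hy.1])
    have e3 := eVariationOn.add_le_union w (s := {a, a - 1} ∪ Set.Icc a b) (t := {b, b + 1}) (by
      rintro x ((rfl | rfl) | hx) y (rfl | rfl)
      · exact hab.le
      · linarith
      · linarith
      · linarith
      · exact hx.2
      · linarith [hx.2])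
    rw [eVariationOn.pair, hwa, hwa'] at e2
    rw [eVariationOn.pair, hwb, hwb'] at e3
    rw [e1]
    calc _ ≤ eVariationOn w ({a, a - 1} ∪ Set.Icc a b) + edist (u b) 0 := add_le_add_left e2 _
      _ ≤ eVariationOn w Set.univ := e3.trans (eVariationOn.mono w (Set.subset_univ _))
      _ ≤ _ := h1
  have hbv : BoundedVariationOn u (Set.Icc a b) :=
    ne_top_of_le_ne_top hfin ((le_add_left le_rfl).trans (le_self_add.trans h2))
  refine ⟨hbv, ?_⟩
  have h3 := ENNReal.toReal_mono hfin h2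
  rw [ENNReal.toReal_add (ENNReal.add_ne_top.mpr ⟨edist_ne_top _ _, hbv⟩) (edist_ne_top _ _),
    ENNReal.toReal_add (edist_ne_top _ _) hbv, ← dist_edist, ← dist_edist, Real.dist_eq,
    Real.dist_eq, sub_zero, sub_zero] at h3
  rw [extVar, intervalVar]
  linarith

lemma boundedVariationOn_div_and_extVar_le (h : BoundedVariationOn u (Set.Icc a b)) {E : ℝ}
    (hE : 0 < E) : BoundedVariationOn (fun f => u f / E) (Set.Icc a b) ∧
      extVar (fun f => u f / E) a b ≤ extVar u a b / E := by
  have h1 := boundedVariationOn_and_intervalVar_le (u := fun f => u f / E) (a := a) (b := b)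
    (C := intervalVar u a b / E) fun n t ht hm => by
      have h2 := sum_abs_sub_le_intervalVar h n ht hm
      have h3 : ∀ x y : ℝ, |x / E - y / E| = |x - y| / E := fun x y => by
        rw [← sub_div, abs_div, abs_of_pos hE]
      simp only [h3, ← Finset.sum_div]
      gcongr
  refine ⟨h1.1, ?_⟩
  have h2 := h1.2 (div_nonneg intervalVar_nonneg hE.le)
  simp only [extVar, abs_div, abs_of_pos hE, add_div]
  linarith

lemma totalVar_congr {u v : ℝ → ℝ} (h : u =ᵐ[volume] v) : totalVar u = totalVar v := by
  have key : ∀ {u v : ℝ → ℝ}, u =ᵐ[volume] v → totalVar u ≤ totalVar v := fun h =>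
    le_iInf fun w => le_iInf fun hw => iInf_le_of_le w (iInf_le_of_le (hw.trans h.symm) le_rfl)
  exact le_antisymm (key h) (key h.symm)

end totalVar

/-- The normalized spectra of the pulse and of its derivative form a flat pair. -/
lemma flatPair_ghat {M : ℕ} {g : ℝ → ℝ} (hg : Integrable g) (hgd : Differentiable ℝ g)
    (hg' : MemLp (fun t : ℝ => ((deriv g t : ℝ) : ℂ)) 2 volume)
    (hE₁ : 0 < bandEnergy (M + 1) (ghatDeriv g hg'))
    (hvar₀ : bandVar (M + 1) (ghat g) ≠ ⊤) (hvar₁ : bandVar (M + 1) (ghatDeriv g hg') ≠ ⊤) :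
    0 < bandEnergy (M + 1) (ghat g) ∧
    FlatPair M (fun f => ‖ghat g f‖ ^ 2 / bandEnergy (M + 1) (ghat g))
      (fun f => (2 * Real.pi * f) ^ 2 * ‖ghat g f‖ ^ 2 / bandEnergy (M + 1) (ghatDeriv g hg'))
      (2 * Real.pi * √(bandEnergy (M + 1) (ghat g) / bandEnergy (M + 1) (ghatDeriv g hg')))
      (flatness (M + 1) (ghat g) (ghatDeriv g hg')) := by
  set E₀ := bandEnergy (M + 1) (ghat g) with hE₀def
  set E₁ := bandEnergy (M + 1) (ghatDeriv g hg') with hE₁def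
  have hband : band (M + 1) = Set.Icc (-((M : ℝ) / 2)) ((M : ℝ) / 2) := by
    simp [band]
  set u : ℝ → ℝ := fun f => ‖ghat g f‖ ^ 2 with hu
  set v : ℝ → ℝ := fun f => (2 * Real.pi * f) ^ 2 * ‖ghat g f‖ ^ 2 with hv
  have hgc := continuous_ghat hg
  have huc : Continuous u := by fun_prop
  have hvc : Continuous v := by fun_prop
  have hae : (fun f => ‖ghatDeriv g hg' f‖ ^ 2) =ᵐ[volume] v := by
    filter_upwards [ghatDeriv_ae_eq hg hgd hg'] with f hf
    rw [hf, norm_mul, mul_pow, hv]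
    congr 1
    rw [← sq_abs (2 * Real.pi * f)]
    congr 1
    simp [abs_mul, abs_of_pos Real.pi_pos]
  have hE₁v : E₁ = ∫ f in band (M + 1), v f := by
    rw [hE₁def, bandEnergy]
    exact integral_congr_ae (ae_restrict_of_ae hae)
  have hE₀u : E₀ = ∫ f in band (M + 1), u f := rfl
  have hvar₁' : bandVar (M + 1) (ghatDeriv g hg') = totalVar ((band (M + 1)).indicator v) := by
    refine totalVar_congr ?_
    filter_upwards [hae] with f hf
    by_cases hfb : f ∈ band (M + 1)
    · rw [Set.indicator_of_mem hfb, Set.indicator_of_mem hfb, hf]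
    · rw [Set.indicator_of_notMem hfb, Set.indicator_of_notMem hfb]
  have hM : 0 < (M : ℝ) / 2 := by
    rcases Nat.eq_zero_or_pos M with hM0 | hM0
    · exfalso
      rw [hE₁v, hband, hM0] at hE₁
      simp at hE₁
    · positivity
  have hle : -((M : ℝ) / 2) ≤ (M : ℝ) / 2 := by linarith
  have hE₀pos : 0 < E₀ := by
    have h1 : E₁ ≤ (2 * Real.pi * ((M : ℝ) / 2)) ^ 2 * E₀ := by
      rw [hE₁v, hE₀u, ← integral_const_mul, hband]
      refine setIntegral_mono_on (hvc.integrableOn_Icc) ((huc.const_mul _).integrableOn_Icc)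
        measurableSet_Icc fun f hf => ?_
      refine mul_le_mul_of_nonneg_right ?_ (by positivity)
      rw [← sq_abs]
      refine pow_le_pow_left₀ (abs_nonneg _) ?_ 2
      rw [abs_mul, abs_of_pos Real.two_pi_pos]
      exact mul_le_mul_of_nonneg_left (abs_le.mpr hf) Real.two_pi_pos.le
    by_contra hneg
    rw [not_lt] at hneg
    have := mul_nonpos_of_nonneg_of_nonpos (sq_nonneg (2 * Real.pi * ((M : ℝ) / 2))) hneg
    linarith
  refine ⟨hE₀pos, ?_⟩
  have hab : -((M : ℝ) / 2) < (M : ℝ) / 2 := by linarith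
  have hu1 := boundedVariationOn_and_extVar_le_totalVar huc hab
    (by rw [← hband]; exact hvar₀)
  have hv1 := boundedVariationOn_and_extVar_le_totalVar hvc hab
    (by rw [← hband, ← hvar₁']; exact hvar₁)
  rw [← hband] at hu1 hv1
  rw [← hvar₁'] at hv1
  have hu2 := boundedVariationOn_div_and_extVar_le (hband ▸ hu1.1) hE₀pos
  have hv2 := boundedVariationOn_div_and_extVar_le (hband ▸ hv1.1) hE₁
  refine ⟨?_, huc.div_const _, fun f => by positivity, fun f => ?_, fun f => ?_, ?_, ?_, hu2.1,
    hv2.1, hu2.2.trans ?_, hv2.2.trans ?_⟩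
  · have := Real.pi_pos
    positivity
  · simp only [norm_ghat_neg]
  · have hE₁' := hE₁.ne'
    have hE₀' := hE₀pos.ne'
    simp only [mul_pow]
    rw [Real.sq_sqrt (by positivity)]
    field_simp
  · rw [intervalIntegral.integral_div, intervalIntegral.integral_of_le hle,
      ← integral_Icc_eq_integral_Ioc, ← hband, ← hE₀u, div_self hE₀pos.ne']
  · rw [intervalIntegral.integral_div, intervalIntegral.integral_of_le hle,
      ← integral_Icc_eq_integral_Ioc, ← hband, ← hE₁v, div_self hE₁.ne']
  · refine le_trans ?_ (le_max_left _ _)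
    exact div_le_div_of_nonneg_right hu1.2 hE₀pos.le
  · refine le_trans ?_ (le_max_right _ _)
    exact div_le_div_of_nonneg_right hv1.2 hE₁.le

/-! ### Amplitude matrices -/

section amplitudes
variable {K L : ℕ} (X : Matrix (Fin K) (Fin L) ℂ)

lemma gram_diag (k : Fin K) : (X * Xᴴ) k k = ((∑ l, ‖X k l‖ ^ 2 : ℝ) : ℂ) := by
  rw [Matrix.mul_apply, Complex.ofReal_sum]
  refine Finset.sum_congr rfl fun l _ => ?_
  rw [Matrix.conjTranspose_apply, RCLike.star_def, Complex.mul_conj, Complex.normSq_eq_norm_sq]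

lemma minDiag_le (k : Fin K) : minDiag X ≤ ∑ l, ‖X k l‖ ^ 2 := by
  have h := ciInf_le (Set.finite_range fun k : Fin K => ((X * Xᴴ) k k).re).bddBelow k
  rwa [gram_diag, Complex.ofReal_re] at h

lemma minDiag_pos [Nonempty (Fin K)] (hX : ∀ k, ∃ l, X k l ≠ 0) : 0 < minDiag X := by
  obtain ⟨k, hk⟩ := exists_eq_ciInf_of_finite (f := fun k : Fin K => ((X * Xᴴ) k k).re)
  rw [minDiag, ← hk, gram_diag, Complex.ofReal_re]
  obtain ⟨l, hl⟩ := hX k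
  exact Finset.sum_pos' (fun _ _ => by positivity) ⟨l, Finset.mem_univ l, by positivity⟩

lemma col_le_maxColNorm {m n : ℕ} (A : Matrix (Fin m) (Fin n) ℂ) (k : Fin n) :
    √(∑ j, ‖A j k‖ ^ 2) ≤ maxColNorm A :=
  le_ciSup (f := fun k => √(∑ j, ‖A j k‖ ^ 2)) (Set.finite_range _).bddAbove k

lemma minDiag_le_maxColNorm [Nonempty (Fin K)] : minDiag X ≤ maxColNorm (X * Xᴴ) := by
  obtain ⟨k⟩ := ‹Nonempty (Fin K)›
  refine (minDiag_le X k).trans (le_trans ?_ (col_le_maxColNorm _ k))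
  refine Real.le_sqrt_of_sq_le ?_
  have h : ∑ l, ‖X k l‖ ^ 2 = ‖(X * Xᴴ) k k‖ := by
    rw [gram_diag, Complex.norm_real, Real.norm_of_nonneg (by positivity)]
  rw [h]
  exact Finset.single_le_sum (f := fun j => ‖(X * Xᴴ) j k‖ ^ 2) (fun _ _ => by positivity)
    (Finset.mem_univ k)

/-- The squared spectral norm dominates the squared norm of every row. -/
lemma sum_row_sq_le_spectralNorm_sq (k : Fin K) : ∑ l, ‖X k l‖ ^ 2 ≤ spectralNorm X ^ 2 := by
  set r := ∑ l, ‖X k l‖ ^ 2 with hr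
  have hr0 : 0 ≤ r := by positivity
  set v : EuclideanSpace ℂ (Fin L) := WithLp.toLp 2 fun l => starRingEnd ℂ (X k l) with hv
  have h1 : ‖v‖ ^ 2 = r := by
    rw [EuclideanSpace.norm_sq_eq]
    simp [hv, hr]
  have h2 : Matrix.toEuclideanLin X v k = (r : ℂ) := by
    rw [hr, ← gram_diag]
    simp [hv, Matrix.toLpLin_apply, Matrix.mulVec, dotProduct, Matrix.mul_apply]
  have h3 : r ≤ spectralNorm X * ‖v‖ := by
    have h4 := (LinearMap.toContinuousLinearMap (Matrix.toEuclideanLin X)).le_opNorm v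
    have h5 := PiLp.norm_apply_le (Matrix.toEuclideanLin X v) k
    rw [h2, Complex.norm_real, Real.norm_of_nonneg hr0] at h5
    exact h5.trans h4
  have h6 : 0 ≤ spectralNorm X := norm_nonneg _
  rcases hr0.eq_or_lt with h0 | h0
  · rw [← h0]; positivity
  · have h7 : r * r ≤ spectralNorm X ^ 2 * r := by
      calc r * r ≤ (spectralNorm X * ‖v‖) * (spectralNorm X * ‖v‖) :=
            mul_le_mul h3 h3 hr0 (by positivity)
        _ = spectralNorm X ^ 2 * r := by rw [← h1]; ring
    exact le_of_mul_le_mul_right h7 h0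

end amplitudes

/-- The bound with the noise level normalized: `σ` is the coercivity constant of the linearized
model. -/
lemma sensitivity_bound {E₀ E₁ m S F x r σ D Y : ℝ} (hE₀ : 0 < E₀) (hE₁ : 0 < E₁) (hm : 0 < m)
    (hS : 0 < S) (hF : 0 ≤ F) (hx : 0 ≤ x) (hr : 2 / 3 * x * r < 1)
    (hσ : σ = √E₁ * (m * (1 - 2 / 3 * x * r)) / (S * √(1 + 2 / 3 * x)))
    (hD : D ≤ σ⁻¹) (hY : 0 ≤ Y) (hYF : Y ^ 2 ≤ E₀ * (1 + 1 / 2 * x) * F ^ 2) :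
    D * Y ≤ S * F / m * √((1 + 2 / 3 * x) * (1 + 1 / 2 * x)) /
      (√(E₁ / E₀) * (1 - 2 / 3 * x * r)) := by
  have hw : 0 < 1 - 2 / 3 * x * r := by linarith
  have h1 : Y ≤ √E₀ * √(1 + 1 / 2 * x) * F := by
    refine le_of_sq_le_sq ?_ (by positivity)
    rw [mul_pow, mul_pow, Real.sq_sqrt hE₀.le, Real.sq_sqrt (by positivity)]
    exact hYF
  have hsE₀ := Real.sqrt_pos.mpr hE₀
  have hsE₁ := Real.sqrt_pos.mpr hE₁
  have hs : 0 < √(1 + 2 / 3 * x) := Real.sqrt_pos.mpr (by positivity)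
  have hσ0 : 0 ≤ σ⁻¹ := by rw [hσ]; positivity
  calc D * Y ≤ σ⁻¹ * (√E₀ * √(1 + 1 / 2 * x) * F) := mul_le_mul hD h1 hY hσ0
    _ = _ := by
      rw [hσ, Real.sqrt_mul (by positivity), Real.sqrt_div hE₁.le]
      generalize 1 - 2 / 3 * x * r = w at hw
      field_simp

end PulseLocation

theorem corollary1 (N K L : ℕ) (hK : 1 ≤ K)
    (g : ℝ → ℝ) (hg : MeasureTheory.Integrable g) (hgd : Differentiable ℝ g)
    (hg' : MeasureTheory.MemLp (fun t : ℝ => ((deriv g t : ℝ) : ℂ)) 2 MeasureTheory.volume)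
    (E₀ E₁ ρ κ η : ℝ)
    (hE₀ : E₀ = PulseLocation.bandEnergy N (PulseLocation.ghat g))
    (hE₁ : E₁ = PulseLocation.bandEnergy N (PulseLocation.ghatDeriv g hg'))
    (hE₁pos : 0 < E₁)
    (hvar₀ : PulseLocation.bandVar N (PulseLocation.ghat g) ≠ ⊤)
    (hvar₁ : PulseLocation.bandVar N (PulseLocation.ghatDeriv g hg') ≠ ⊤)
    (hρ : ρ = PulseLocation.flatness N (PulseLocation.ghat g) (PulseLocation.ghatDeriv g hg'))
    (X : Matrix (Fin K) (Fin L) ℂ) (hX : ∀ k : Fin K, ∃ l : Fin L, X k l ≠ 0)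
    (hκ : κ = PulseLocation.dynRange X) (hη : η = PulseLocation.ampRange X)
    (τ : EuclideanSpace ℝ (Fin K)) (Δ : ℝ) (hΔ_one : Δ ≤ 1)
    (hsep : ∀ k k' : Fin K, k ≠ k' → ∀ j : ℤ, Δ ≤ |τ k - τ k' + j|)
    (hΔ : 2 / 3 * ρ * κ < Δ)
    (ψ : Matrix (Fin N) (Fin L) ℂ → EuclideanSpace ℝ (Fin K))
    (hψ : PulseLocation.IsInverseMap g N τ X ψ) :
    DifferentiableAt ℝ (fun z => ψ (PulseLocation.iotaInv z)) 0 ∧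
    ‖fderiv ℝ (fun z => ψ (PulseLocation.iotaInv z)) 0‖ *
        PulseLocation.frobNorm (PulseLocation.G g N * PulseLocation.Phi N τ * X) ≤
      η * √((1 + 2 / 3 * ρ * Δ⁻¹) * (1 + 1 / 2 * ρ * Δ⁻¹)) /
        (√(E₁ / E₀) * (1 - 2 / 3 * ρ * κ * Δ⁻¹)) := by
  obtain ⟨M, rfl⟩ : ∃ M, N = M + 1 := by
    rcases N with _ | M
    · -- without samples the band is empty
      exfalso
      have hband : PulseLocation.band 0 = ∅ := by
        rw [PulseLocation.band, Set.Icc_eq_empty_iff]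
        norm_num
      rw [hE₁, PulseLocation.bandEnergy, hband] at hE₁pos
      simp at hE₁pos
    · exact ⟨M, rfl⟩
  have hne : Nonempty (Fin K) := ⟨⟨0, hK⟩⟩
  obtain ⟨hE₀pos, H⟩ := PulseLocation.flatPair_ghat hg hgd hg' (hE₁ ▸ hE₁pos) hvar₀ hvar₁
  rw [← hE₀, ← hE₁, ← hρ] at H
  rw [← hE₀] at hE₀pos
  have hρ0 := H.rho_nonneg
  set m := PulseLocation.minDiag X with hm
  have hm0 : 0 < m := PulseLocation.minDiag_pos X hX
  have hκm : κ * m = PulseLocation.maxColNorm (X * Xᴴ) := by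
    rw [hκ, PulseLocation.dynRange, ← hm, div_mul_cancel₀ _ hm0.ne']
  have hκ1 : 1 ≤ κ := by
    rw [hκ, PulseLocation.dynRange, ← hm, one_le_div hm0]
    exact PulseLocation.minDiag_le_maxColNorm X
  have hΔ0 : 0 < Δ := lt_of_le_of_lt (by positivity) hΔ
  obtain ⟨x, hx⟩ : ∃ x, x = ρ / Δ := ⟨_, rfl⟩
  have hx0 : 0 ≤ x := by rw [hx]; positivity
  have hxκ : 2 / 3 * x * κ < 1 := by
    have e : 2 / 3 * x * κ = 2 / 3 * ρ * κ / Δ := by rw [hx]; ring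
    rw [e, div_lt_one hΔ0]
    exact hΔ
  have hx2 : x < 3 / 2 := by nlinarith
  have hw : 0 < 1 - 2 / 3 * x * κ := by linarith
  set S := PulseLocation.spectralNorm X with hSdef
  have hSm : m ≤ S ^ 2 := by
    obtain ⟨k⟩ := hne
    exact (PulseLocation.minDiag_le X k).trans (PulseLocation.sum_row_sq_le_spectralNorm_sq X k)
  have hS0 : 0 < S := by
    have h1 : 0 ≤ S := norm_nonneg _
    rcases h1.eq_or_lt with h2 | h2
    · rw [← h2] at hSm; norm_num at hSm; linarith
    · exact h2
  have hsep' : PulseLocation.Separated (fun k => τ k) Δ := hsep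
  have hAD := PulseLocation.norm_pulseMap_sub_derivMap_sq (g := g) (M := M) τ hE₀pos hE₁pos
  -- the energy of a superposition of pulses
  have henergy : ∀ b : EuclideanSpace ℂ (Fin K),
      |‖PulseLocation.pulseMap g (M + 1) τ b‖ ^ 2 - E₀ * ‖b‖ ^ 2| ≤
        1 / 2 * x * (E₀ * ‖b‖ ^ 2) := by
    intro b
    have h1 := hAD b 0
    rw [map_zero, sub_zero] at h1
    have h2 := H.abs_energyFormC_zero_right_sub_le hsep' hΔ0 hΔ_one (fun k => (√E₀ : ℂ) * b k)
    have h3 : (fun k => (√E₁ : ℂ) * (0 : EuclideanSpace ℂ (Fin K)) k) = 0 := by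
      funext k; simp
    have h4 : ∑ k, ‖(√E₀ : ℂ) * b k‖ ^ 2 = E₀ * ‖b‖ ^ 2 := by
      rw [EuclideanSpace.norm_sq_eq, Finset.mul_sum]
      refine Finset.sum_congr rfl fun k _ => ?_
      rw [norm_mul, mul_pow, Complex.norm_real, Real.norm_eq_abs, sq_abs, Real.sq_sqrt hE₀pos.le]
    rw [h3] at h1
    rw [← h1, h4, ← hx] at h2
    exact h2
  have hc : 0 < √(E₀ * (1 - 1 / 2 * x)) := Real.sqrt_pos.mpr (mul_pos hE₀pos (by linarith))
  have hinj : ∀ b, √(E₀ * (1 - 1 / 2 * x)) * ‖b‖ ≤ ‖PulseLocation.pulseMap g (M + 1) τ b‖ := by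
    intro b
    refine le_of_sq_le_sq ?_ (norm_nonneg _)
    rw [mul_pow, Real.sq_sqrt (mul_nonneg hE₀pos.le (by linarith))]
    have := (abs_le.mp (henergy b)).1
    linarith
  -- the lower bound of `FlatPair.coercive`, for the norm in place of its square
  set σ := √E₁ * (m * (1 - 2 / 3 * x * κ)) / (S * √(1 + 2 / 3 * x)) with hσ
  have hσ0 : 0 < σ := by
    have := Real.sqrt_pos.mpr hE₁pos
    have : 0 < √(1 + 2 / 3 * x) := Real.sqrt_pos.mpr (by positivity)
    positivity
  have hσsq : σ ^ 2 = E₁ * (m ^ 2 * (1 - 2 / 3 * x * κ) ^ 2 / (S ^ 2 * (1 + 2 / 3 * x))) := by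
    rw [hσ, div_pow, mul_pow, mul_pow, mul_pow, Real.sq_sqrt hE₁pos.le,
      Real.sq_sqrt (by positivity), mul_div_assoc]
  have hcoercive := fun δ B => H.coercive hsep' hΔ0 hΔ_one (E₀ := E₀) hE₁pos hm0 hκ1 hSm
    (by rw [← hx]; exact hxκ) X (PulseLocation.minDiag_le X)
    (fun k => hκm ▸ PulseLocation.col_le_maxColNorm (X * Xᴴ) k)
    (PulseLocation.pulseMap g (M + 1) τ) (PulseLocation.derivMap g (M + 1) τ) hAD δ B
  rw [← hx] at hcoercive
  have hmain := hψ.differentiableAt_and_norm_fderiv_le hc hσ0 hinj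
    (fun δ B => by rw [hσsq]; exact hcoercive δ B)
  refine ⟨hmain.1, ?_⟩
  have hF0 : 0 ≤ PulseLocation.frobNorm X := Real.sqrt_nonneg _
  have hY : PulseLocation.frobNorm
      (PulseLocation.G g (M + 1) * PulseLocation.Phi (M + 1) τ * X) ^ 2 ≤
      E₀ * (1 + 1 / 2 * x) * PulseLocation.frobNorm X ^ 2 := by
    rw [PulseLocation.frobNorm_sq, PulseLocation.frobNorm_sq, Finset.mul_sum]
    refine Finset.sum_le_sum fun l _ => ?_
    have h1 := PulseLocation.toLp_mul_col
      (PulseLocation.G g (M + 1) * PulseLocation.Phi (M + 1) τ) X l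
    have h2 := (abs_le.mp (henergy (WithLp.toLp 2 fun k => X k l))).2
    rw [PulseLocation.pulseMap, ← h1] at h2
    linarith
  have hbound := PulseLocation.sensitivity_bound hE₀pos hE₁pos hm0 hS0 hF0 hx0 hxκ hσ hmain.2
    (Real.sqrt_nonneg _) hY
  have e1 : 2 / 3 * ρ * Δ⁻¹ = 2 / 3 * x := by rw [hx]; ring
  have e2 : 1 / 2 * ρ * Δ⁻¹ = 1 / 2 * x := by rw [hx]; ring
  have e3 : 2 / 3 * ρ * κ * Δ⁻¹ = 2 / 3 * x * κ := by rw [hx]; ring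
  rw [hη, e1, e2, e3]
  exact hbound
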